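/- Let $k$ be an algebraically closed field, let $D$ be a finitely generated abelian group, and let $S=k[T_1,\dots,T_n]$ be graded by $D$ with homogeneous variables, $\deg T_i=w_i\in D$, such that $D$ is generated by the support $\{d\in D : S_d\neq 0\}$. A homogeneous element $f\in S$ is called relevant if the degrees of the homogeneous units of $S_f$ generate a subgroup of finite index in $D$. Let $S_+\subseteq S$ be the ideal generated by the relevant elements, let $X=\operatorname{Spec}(S)\setminus V(S_+)$ be the relevant locus, let $$\operatorname{Proj}^D(S)=\bigcup_{f\ \text{relevant}}\operatorname{Spec}(S_{(f)})$$ (where $S_{(f)}$ is the degree $0$ part of $S_f$, and $\operatorname{Spec}(S_{(f)})$, $\operatorname{Spec}(S_{(g)})$ are glued along $\operatorname{Spec}(S_{(fg)})$), and let $p\colon X\to \operatorname{Proj}^D(S)$ be the canonical morphism that is given by $\operatorname{Spec}(S_f)\to\operatorname{Spec}(S_{(f)})$ for $f$ relevant. The group scheme $G=\operatorname{Spec}(S_0[D])$ over $\operatorname{Spec}(S_0)$ acts on $\operatorname{Spec}(S)$ via the coaction $S\to S_0[D]\otimes_{S_0}S$, $s\mapsto \chi^d\otimes s$ for $s\in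 S_d$, and $X$ is stable under this action. A prevariety is a reduced, not necessarily separated, scheme of finite type over $k$. A toric prevariety is a normal integral prevariety with an action of a torus $T\cong\operatorname{Spec}(k[\mathbb Z^m])$ and a $T$-equivariant open immersion of $T$ in it; toric morphisms are the morphisms over $k$ that restrict to a homomorphism of the tori and are equivariant with respect to it. A morphism $f\colon X\to Z$ is $G$-invariant if its compositions with the action map and with the projection $G\times_{\operatorname{Spec}(S_0)}X\to X$ agree, and $G$-invariance of sections is defined in the same way. Then: 1. $p$ is a good prequotient for the action of $G$ on $X$: $X$ and $\operatorname{Proj}^D(S)$ are prevarieties over $k$, the morphism $p$ is $G$-invariant, surjective and affine, and for every open $V\subseteq\operatorname{Proj}^D(S)$ the pullback of functions along $p$ is an isomorphism of $\mathcal O_{\operatorname{Proj}^D(S)}(V)$ onto the subring $\mathcal O_X(p^{-1}(V))^G$ of $G$-invariant sections. 2. Moreover, $p$ is a toric prequotient: $X$, with the open torus $\operatorname{Spec}(k[T_1^{\pm1},\dots,T_n^{\pm1}])$, is a toric prevariety, $\operatorname{Proj}^D(S)$ carries the structure of a toric prevariety for which $p$ is a $G$-invariant toric morphism, and for every toric prevariety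 $Z$ and every $G$-invariant toric morphism $f\colon X\to Z$ there is a unique toric morphism $g\colon\operatorname{Proj}^D(S)\to Z$ with $g\circ p=f$. -/

import Mathlib

open CategoryTheory CategoryTheory.Limits AlgebraicGeometry HomogeneousLocalization
open MonoidalCategory CartesianMonoidalCategory
universe u

namespace MultiProj

section Relevant

variable {A : Type u} {D : Type u} {σ : Type*} [CommRing A] [AddCommGroup D] [DecidableEq D]
  [SetLike σ A] [AddSubgroupClass σ A] (𝒜 : D → σ) [GradedRing 𝒜]

/-- The degrees of the homogeneous units of the localization `A_f`, where `f` is homogeneous of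
degree `d`: the unit `a / f ^ n` has degree `c` when `a` has degree `c + n • d`. -/
def unitDegrees (f : A) (d : D) : Set D :=
  {c | ∃ (n : ℕ) (a : A), a ∈ 𝒜 (c + n • d) ∧
    IsUnit (Localization.mk a ⟨f ^ n, n, rfl⟩ : Localization.Away f)}

/-- A homogeneous element `f` is relevant if the group of degrees of the (homogeneous) units
of `A_f` has finite index in the grading group. -/
def IsRelevant (f : A) : Prop :=
  ∃ d : D, f ∈ 𝒜 d ∧ (AddSubgroup.closure (unitDegrees 𝒜 f d)).FiniteIndex

variable {𝒜}

lemma exists_mul_eq_pow {f : A} {d c : D} (hf : f ∈ 𝒜 d) (hc : c ∈ unitDegrees 𝒜 f d) :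
    ∃ (n m : ℕ) (a b : A), a ∈ 𝒜 (c + n • d) ∧ b ∈ 𝒜 (m • d - c) ∧ a * b = f ^ (n + m) := by
  obtain ⟨n, a, ha, hu⟩ := hc
  have h1 : ∃ (b : A) (N : ℕ), a * b = f ^ N := by
    have h2 : IsUnit (algebraMap A (Localization.Away f) a) := by
      have : algebraMap A (Localization.Away f) a =
          Localization.mk a (⟨f ^ n, n, rfl⟩ : Submonoid.powers f) *
            algebraMap A _ (f ^ n) := by
        rw [← Localization.mk_one_eq_algebraMap, ← Localization.mk_one_eq_algebraMap,
          Localization.mk_mul, Localization.mk_eq_mk_iff, Localization.r_iff_exists]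
        exact ⟨1, by simp; ring⟩
      rw [this, map_pow]
      exact hu.mul ((IsLocalization.Away.algebraMap_isUnit f).pow n)
    rw [IsLocalization.algebraMap_isUnit_iff (Submonoid.powers f)] at h2
    obtain ⟨_, ⟨N, rfl⟩, b, hb⟩ := h2
    exact ⟨b, N, hb.symm⟩
  obtain ⟨b, N, hb⟩ := h1
  -- we take the appropriate homogeneous component of `b * f ^ n`
  refine ⟨n, N, a, (DirectSum.decompose 𝒜 (b * f ^ n) (N • d - c) : 𝒜 _), ha, SetLike.coe_mem _, ?_⟩
  have h3 : a * (b * f ^ n) = f ^ (n + N) := by rw [← mul_assoc, hb]; ring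
  have h4 : a * (b * f ^ n) ∈ 𝒜 ((c + n • d) + (N • d - c)) := by
    rw [h3]
    convert SetLike.pow_mem_graded (n + N) hf using 2
    rw [add_smul]; abel
  have h5 := DirectSum.coe_decompose_mul_add_of_left_mem 𝒜 (i := c + n • d) (j := N • d - c)
    (b := b * f ^ n) ha
  rw [DirectSum.decompose_of_mem_same _ h4, h3] at h5
  exact h5.symm

lemma zero_mem_unitDegrees (f : A) (d : D) : (0 : D) ∈ unitDegrees 𝒜 f d := by
  refine ⟨0, 1, by simpa using SetLike.GradedOne.one_mem, ?_⟩
  convert isUnit_one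
  exact (congrArg _ (Subtype.ext (pow_zero f))).trans (Localization.mk_self (1 : Submonoid.powers f))

lemma mem_unitDegrees_of_mul {f : A} {d c : D} {n m : ℕ} {a b : A} (ha : a ∈ 𝒜 (c + n • d))
    (hab : a * b = f ^ (n + m)) : c ∈ unitDegrees 𝒜 f d := by
  refine ⟨n, a, ha, IsUnit.of_mul_eq_one (Localization.mk b ⟨f ^ m, m, rfl⟩) ?_⟩
  rw [Localization.mk_mul, hab]
  convert Localization.mk_self (⟨f ^ (n + m), n + m, rfl⟩ : Submonoid.powers f)
  exact Subtype.ext (by simp [pow_add])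

lemma mem_unitDegrees_of_mem_closure {f : A} {d c : D} (hf : f ∈ 𝒜 d)
    (hc : c ∈ AddSubgroup.closure (unitDegrees 𝒜 f d)) : c ∈ unitDegrees 𝒜 f d := by
  induction hc using AddSubgroup.closure_induction with
  | mem x hx => exact hx
  | zero => exact zero_mem_unitDegrees f d
  | add x y _ _ hx hy =>
    obtain ⟨n, m, a, b, ha, hb, hab⟩ := exists_mul_eq_pow hf hx
    obtain ⟨n', m', a', b', ha', hb', hab'⟩ := exists_mul_eq_pow hf hy
    refine mem_unitDegrees_of_mul (n := n + n') (m := m + m') (a := a * a') (b := b * b') ?_ ?_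
    · convert SetLike.mul_mem_graded ha ha' using 2
      rw [add_smul]; abel
    · rw [mul_mul_mul_comm, hab, hab']; ring
  | neg x _ hx =>
    obtain ⟨n, m, a, b, ha, hb, hab⟩ := exists_mul_eq_pow hf hx
    refine mem_unitDegrees_of_mul (n := m) (m := n) (a := b) (b := a) ?_ ?_
    · convert hb using 2; abel
    · rw [mul_comm, hab, add_comm]

lemma IsRelevant.mul {f g : A} {e : D} (hf : IsRelevant 𝒜 f) (hg : g ∈ 𝒜 e) :
    IsRelevant 𝒜 (f * g) := by
  obtain ⟨d, hd, hfin⟩ := hf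
  refine ⟨d + e, SetLike.mul_mem_graded hd hg, ?_⟩
  refine AddSubgroup.finiteIndex_of_le (H := AddSubgroup.closure (unitDegrees 𝒜 f d)) ?_
  refine AddSubgroup.closure_mono fun c hc ↦ ?_
  obtain ⟨n, m, a, b, ha, hb, hab⟩ := exists_mul_eq_pow hd hc
  refine mem_unitDegrees_of_mul (n := n) (m := m) (a := a * g ^ n) (b := b * g ^ m) ?_ ?_
  · convert SetLike.mul_mem_graded ha (SetLike.pow_mem_graded n hg) using 2
    rw [smul_add]; abel
  · rw [mul_mul_mul_comm, hab]; ring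

/-- Some positive multiple of each degree is the degree of a unit of `A_f` for `f` relevant. -/
lemma IsRelevant.exists_data {f : A} (hf : IsRelevant 𝒜 f) (e : D) :
    ∃ (d : D) (N n m : ℕ) (a b : A), f ∈ 𝒜 d ∧ a ∈ 𝒜 ((N + 1) • e + n • d) ∧
      b ∈ 𝒜 (m • d - (N + 1) • e) ∧ a * b = f ^ (n + m) := by
  obtain ⟨d, hd, hfin⟩ := hf
  obtain ⟨N, hN, hN'⟩ : ∃ N : ℕ, 0 < N ∧ N • e ∈ AddSubgroup.closure (unitDegrees 𝒜 f d) := by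
    obtain ⟨N, h0, -, hN⟩ := AddSubgroup.exists_nsmul_mem_of_index_ne_zero hfin.index_ne_zero e
    exact ⟨N, h0, hN⟩
  obtain ⟨N, rfl⟩ := Nat.exists_eq_succ_of_ne_zero hN.ne'
  obtain ⟨n, m, a, b, ha, hb, hab⟩ :=
    exists_mul_eq_pow hd (mem_unitDegrees_of_mem_closure hd hN')
  exact ⟨d, N, n, m, a, b, hd, ha, hb, hab⟩

/-- If `a / f ^ n` is a unit of degree `(N + 1) • deg g` in `A_f`, with inverse `b / f ^ m`,
then `A_{(fg)}` is the localization of `A_{(f)}` at `b * g ^ (N + 1) / f ^ m`. -/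
lemma isLocalization_awayMap {f g x : A} {d e : D} {N n m : ℕ} {a b : A} (hf : f ∈ 𝒜 d)
    (hg : g ∈ 𝒜 e) (ha : a ∈ 𝒜 ((N + 1) • e + n • d)) (hbg : b * g ^ (N + 1) ∈ 𝒜 (m • d))
    (hb : b ∈ 𝒜 (m • d - (N + 1) • e))
    (hab : a * b = f ^ (n + m)) (hx : x = f * g) :
    letI := (awayMap 𝒜 hg hx).toAlgebra
    IsLocalization.Away (Away.mk 𝒜 hf m (b * g ^ (N + 1)) hbg) (Away 𝒜 x) := by
  have hxd : x ∈ 𝒜 (d + e) := hx ▸ SetLike.mul_mem_graded hf hg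
  let _ := (awayMap 𝒜 hg hx).toAlgebra
  constructor; constructor
  · rintro ⟨_, l, rfl⟩
    rw [map_pow, RingHom.algebraMap_toAlgebra]
    let z : Away 𝒜 x := Away.mk 𝒜 hxd (N + 1 + n) (a * f ^ (N + 1) * g ^ n) <| by
      convert SetLike.mul_mem_graded (SetLike.mul_mem_graded ha (SetLike.pow_mem_graded (N + 1) hf))
        (SetLike.pow_mem_graded n hg) using 2
      rw [smul_add, add_smul _ _ d, add_smul _ _ e]; abel
    refine (isUnit_iff_exists_inv.mpr ⟨z, ?_⟩).pow _
    ext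
    simp only [val_mul, val_one, awayMap_mk, Away.val_mk, z, Localization.mk_mul]
    rw [← Localization.mk_one, Localization.mk_eq_mk_iff, Localization.r_iff_exists]
    use 1
    simp only [OneMemClass.coe_one, one_mul, Submonoid.coe_mul, mul_one, hx]
    linear_combination (g ^ (N + 1) * g ^ m * f ^ (N + 1) * g ^ n) * hab
  · intro z
    obtain ⟨l, s, hs, rfl⟩ := Away.mk_surjective 𝒜 hxd z
    let t : Away 𝒜 f := Away.mk 𝒜 hf (m * l + l) (s * b ^ l * g ^ (N * l)) <| by
      convert SetLike.mul_mem_graded (SetLike.mul_mem_graded hs (SetLike.pow_mem_graded l hb))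
        (SetLike.pow_mem_graded (N * l) hg) using 2
      simp only [smul_add, smul_sub, add_smul, mul_smul, one_smul, smul_comm l m, smul_comm l N]
      abel
    refine ⟨⟨t, ⟨_, ⟨l, rfl⟩⟩⟩, ?_⟩
    ext
    simp only [RingHom.algebraMap_toAlgebra, map_pow, awayMap_mk, val_mul, Away.val_mk, val_pow,
      Localization.mk_pow, Localization.mk_mul, t]
    rw [Localization.mk_eq_mk_iff, Localization.r_iff_exists]
    exact ⟨1, by simp [hx]; ring⟩
  · intro z w h
    obtain ⟨i, z, hz, rfl⟩ := Away.mk_surjective 𝒜 hf z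
    obtain ⟨j, w, hw, rfl⟩ := Away.mk_surjective 𝒜 hf w
    replace h := congr_arg val h
    simp only [RingHom.algebraMap_toAlgebra, awayMap_mk, Away.val_mk,
      Localization.mk_eq_mk_iff, Localization.r_iff_exists] at h
    obtain ⟨⟨_, k, rfl⟩, hc⟩ := h
    refine ⟨⟨_, k + i + j, rfl⟩, ?_⟩
    ext
    simp only [val_mul, val_pow, Away.val_mk, Localization.mk_pow,
      Localization.mk_eq_mk_iff, Localization.r_iff_exists, Submonoid.coe_mul, Localization.mk_mul,
      SubmonoidClass.coe_pow, Subtype.exists, exists_prop]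
    refine ⟨_, ⟨k, rfl⟩, ?_⟩
    subst hx
    simp only [mul_pow] at hc ⊢
    linear_combination ((f ^ m) ^ (k + i + j) * b ^ (k + i + j) * g ^ (N * (k + i + j))) * hc

lemma awayMap_comp {f g h gh x y : A} {e e' e'' : D} (hg : g ∈ 𝒜 e) (hh : h ∈ 𝒜 e')
    (hgh : gh ∈ 𝒜 e'') (hx : x = f * g) (hy : y = x * h) (hy' : y = f * gh) :
    (awayMap 𝒜 hh hy).comp (awayMap 𝒜 hg hx) = awayMap 𝒜 hgh hy' := by
  ext z
  simp only [RingHom.comp_apply, val_awayMap]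
  rw [← RingHom.comp_apply]
  refine DFunLike.congr_fun (IsLocalization.ringHom_ext (Submonoid.powers f) ?_) z.val
  ext a
  simp [Localization.awayLift]

end Relevant

section Proj

variable {A : Type u} {D : Type u} {σ : Type*} [CommRing A] [AddCommGroup D] [DecidableEq D]
  [SetLike σ A] [AddSubgroupClass σ A] (𝒜 : D → σ) [GradedRing 𝒜]

/-- The relevant elements, ordered in such a way that `f ≤ f'` if `f` is a homogeneous
multiple of `f'`. -/
structure Rel where
  /-- the underlying element -/
  val : A
  isRelevant : IsRelevant 𝒜 val

variable {𝒜}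

instance : Preorder (Rel 𝒜) where
  le f f' := ∃ (e : D) (g : A), g ∈ 𝒜 e ∧ f.val = f'.val * g
  le_refl f := ⟨0, 1, SetLike.GradedOne.one_mem, by simp⟩
  le_trans f g h := by
    rintro ⟨e, a, ha, h1⟩ ⟨e', b, hb, h2⟩
    exact ⟨e' + e, b * a, SetLike.mul_mem_graded hb ha, by rw [h1, h2, mul_assoc]⟩

/-- The canonical map `A_{(f')} → A_{(f)}` for `f` a multiple of `f'`. -/
noncomputable def Rel.awayMap {f f' : Rel 𝒜} (h : f ≤ f') : Away 𝒜 f'.val →+* Away 𝒜 f.val :=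
  HomogeneousLocalization.awayMap 𝒜 h.choose_spec.choose_spec.1 h.choose_spec.choose_spec.2

lemma Rel.awayMap_eq {f f' : Rel 𝒜} (h : f ≤ f') {e : D} {g : A} (hg : g ∈ 𝒜 e)
    (hx : f.val = f'.val * g) : Rel.awayMap h = HomogeneousLocalization.awayMap 𝒜 hg hx := by
  ext z
  rw [Rel.awayMap, val_awayMap, val_awayMap]

lemma Rel.awayMap_self (f : Rel 𝒜) : Rel.awayMap (le_refl f) = RingHom.id _ := by
  ext z
  rw [Rel.awayMap_eq le_rfl SetLike.GradedOne.one_mem (mul_one _).symm, val_awayMap]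
  refine DFunLike.congr_fun (g := RingHom.id _)
    (IsLocalization.ringHom_ext (Submonoid.powers f.val) ?_) z.val
  ext a
  simp [Localization.awayLift]

/-- The canonical morphism `Spec A_{(f)} ⟶ Spec A_{(f')}` for `f` a multiple of `f'`. -/
noncomputable def chartTrans {f f' : Rel 𝒜} (h : f ≤ f') :
    Spec (.of (Away 𝒜 f.val)) ⟶ Spec (.of (Away 𝒜 f'.val)) :=
  Spec.map (CommRingCat.ofHom (Rel.awayMap h))

variable (𝒜) in
/-- The diagram of the affine schemes `Spec A_{(f)}` for `f` relevant. -/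
noncomputable def chartFunctor : Rel 𝒜 ⥤ Scheme.{u} where
  obj f := Spec (.of (Away 𝒜 f.val))
  map h := chartTrans (leOfHom h)
  map_id f := by
    rw [chartTrans, ← Spec.map_id]
    congr 1
    ext z
    exact congrArg _ (DFunLike.congr_fun f.awayMap_self z)
  map_comp {f g h} i j := by
    rw [chartTrans, chartTrans, chartTrans, ← Spec.map_comp, ← CommRingCat.ofHom_comp]
    congr 2
    obtain ⟨e, a, ha, h1⟩ := leOfHom i
    obtain ⟨e', b, hb, h2⟩ := leOfHom j
    rw [Rel.awayMap_eq (leOfHom i) ha h1, Rel.awayMap_eq (leOfHom j) hb h2,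
      Rel.awayMap_eq (leOfHom (i ≫ j)) (SetLike.mul_mem_graded hb ha)
        (by rw [h1, h2, mul_assoc]), awayMap_comp]

/-- Multiplying a relevant element by a homogeneous one. -/
def Rel.mul (f : Rel 𝒜) {g : A} {e : D} (hg : g ∈ 𝒜 e) : Rel 𝒜 := ⟨f.val * g, f.isRelevant.mul hg⟩

lemma Rel.mul_le (f : Rel 𝒜) {g : A} {e : D} (hg : g ∈ 𝒜 e) : f.mul hg ≤ f := ⟨e, g, hg, rfl⟩

/-- The open subscheme of `Spec A_{(f)}` cut out by a homogeneous `g` is `Spec A_{(fg)}`,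
compatibly with passing to multiples of `f`. -/
lemma Rel.exists_isLocalization (f : Rel 𝒜) {g : A} {e : D} (hg : g ∈ 𝒜 e) :
    ∃ t : Away 𝒜 f.val, ∀ (f' f'' : Rel 𝒜) (h : f' ≤ f) (h' : f'' ≤ f'), f''.val = f'.val * g →
      @IsLocalization.Away _ _ (Rel.awayMap h t) (Away 𝒜 f''.val) _ (Rel.awayMap h').toAlgebra := by
  obtain ⟨d, N, n, m, a, b, hd, ha, hb, hab⟩ := f.isRelevant.exists_data e
  have hbg : b * g ^ (N + 1) ∈ 𝒜 (m • d) := by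
    convert SetLike.mul_mem_graded hb (SetLike.pow_mem_graded (N + 1) hg) using 2
    abel
  refine ⟨Away.mk 𝒜 hd m (b * g ^ (N + 1)) hbg, fun f' f'' h h' hf'' ↦ ?_⟩
  obtain ⟨c, u, hu, hf'⟩ := h
  have hd' : f'.val ∈ 𝒜 (d + c) := hf' ▸ SetLike.mul_mem_graded hd hu
  have ha' : a * u ^ n ∈ 𝒜 ((N + 1) • e + n • (d + c)) := by
    convert SetLike.mul_mem_graded ha (SetLike.pow_mem_graded n hu) using 2
    rw [smul_add, add_assoc]
  have hb' : b * u ^ m ∈ 𝒜 (m • (d + c) - (N + 1) • e) := by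
    convert SetLike.mul_mem_graded hb (SetLike.pow_mem_graded m hu) using 2
    rw [smul_add]; abel
  have hbg' : (b * u ^ m) * g ^ (N + 1) ∈ 𝒜 (m • (d + c)) := by
    convert SetLike.mul_mem_graded hb' (SetLike.pow_mem_graded (N + 1) hg) using 2
    abel
  have hab' : (a * u ^ n) * (b * u ^ m) = f'.val ^ (n + m) := by
    rw [hf', mul_mul_mul_comm, hab]; ring
  have key := isLocalization_awayMap hd' hg ha' hbg' hb' hab' hf''
  rw [Rel.awayMap_eq h' hg hf'', Rel.awayMap_eq _ hu hf', awayMap_mk]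
  convert key using 2
  ring

lemma isOpenImmersion_of_away {R S : Type u} [CommRing R] [CommRing S] (φ : R →+* S) (t : R)
    (h : @IsLocalization.Away _ _ t S _ φ.toAlgebra) :
    IsOpenImmersion (Spec.map (CommRingCat.ofHom φ)) ∧
      Set.range (Spec.map (CommRingCat.ofHom φ)) = {x : PrimeSpectrum R | t ∉ x.asIdeal} := by
  let _ := φ.toAlgebra
  exact ⟨IsOpenImmersion.of_isLocalization (S := S) t,
    PrimeSpectrum.localization_away_comap_range S t⟩

instance {f g : Rel 𝒜} (h : f ⟶ g) : IsOpenImmersion ((chartFunctor 𝒜).map h) := by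
  obtain ⟨e, a, ha, h1⟩ := leOfHom h
  obtain ⟨t, ht⟩ := g.exists_isLocalization ha
  exact (isOpenImmersion_of_away _ _ (ht g f le_rfl (leOfHom h) h1)).1

instance : (chartFunctor 𝒜 ⋙ Scheme.forget).IsLocallyDirected where
  cond {i j k} fi fj xi xj h := by
    obtain ⟨c, u, hu, hi⟩ := leOfHom fi
    obtain ⟨e, v, hv, hj⟩ := leOfHom fj
    obtain ⟨t, ht⟩ := k.exists_isLocalization hv
    let l : Rel 𝒜 := i.mul hv
    have hli : l ≤ i := i.mul_le hv
    have hlj : l ≤ j := ⟨c, u, hu, by change i.val * v = _; rw [hi, hj]; ring⟩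
    have h1 := (isOpenImmersion_of_away _ _ (ht k j le_rfl (leOfHom fj) hj)).2
    have h2 := (isOpenImmersion_of_away _ _ (ht i l (leOfHom fi) hli rfl)).2
    have h : (chartFunctor 𝒜).map fi xi = (chartFunctor 𝒜).map fj xj := h
    have h3 : xi ∈ Set.range ((chartFunctor 𝒜).map (homOfLE hli)) := by
      refine h2.ge ?_
      have h4 : (chartFunctor 𝒜).map fi xi ∈ Set.range ((chartFunctor 𝒜).map fj) := ⟨xj, h.symm⟩
      have h5 := h1.le h4
      rw [Rel.awayMap_self] at h5
      exact h5
    obtain ⟨x, hx⟩ := h3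
    refine ⟨l, homOfLE hli, homOfLE hlj, x, hx, ?_⟩
    apply ((chartFunctor 𝒜).map fj).isOpenEmbedding.injective
    change (chartFunctor 𝒜).map fj ((chartFunctor 𝒜).map (homOfLE hlj) x) = _
    rw [← h, ← hx, ← Scheme.Hom.comp_apply, ← Scheme.Hom.comp_apply, ← Functor.map_comp,
      ← Functor.map_comp, Subsingleton.elim (homOfLE hlj ≫ fj) (homOfLE hli ≫ fi)]

variable (𝒜) in
/-- The multigraded Proj of `A`: the gluing of the affine schemes `Spec A_{(f)}`, for `f` relevant,
where `Spec A_{(f)}` and `Spec A_{(g)}` are glued along `Spec A_{(fg)}`. -/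
noncomputable def proj : Scheme.{u} := colimit (chartFunctor 𝒜)

variable (𝒜) in
/-- The open immersion of the chart `Spec A_{(f)}`. -/
noncomputable def projι (f : Rel 𝒜) : Spec (.of (Away 𝒜 f.val)) ⟶ proj 𝒜 :=
  colimit.ι (chartFunctor 𝒜) f

lemma chartTrans_projι {f f' : Rel 𝒜} (h : f ≤ f') : chartTrans h ≫ projι 𝒜 f' = projι 𝒜 f :=
  colimit.w (chartFunctor 𝒜) (homOfLE h)

variable (𝒜) in
/-- The irrelevant ideal, generated by all relevant elements. -/
def irrelevantIdeal : Ideal A := Ideal.span {f | IsRelevant 𝒜 f}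

variable (𝒜) in
/-- The relevant locus `Spec A - V(A₊)`, an open subscheme of `Spec A`. -/
def relevantLocus : (Spec (.of A)).Opens :=
  ⟨(PrimeSpectrum.zeroLocus (irrelevantIdeal 𝒜 : Set A))ᶜ,
    (PrimeSpectrum.isClosed_zeroLocus _).isOpen_compl⟩

lemma mem_relevantLocus (x : PrimeSpectrum A) :
    x ∈ relevantLocus 𝒜 ↔ ∃ f : Rel 𝒜, f.val ∉ x.asIdeal := by
  change ¬ ((irrelevantIdeal 𝒜 : Set A) ⊆ x.asIdeal) ↔ _
  rw [irrelevantIdeal, SetLike.coe_subset_coe, Ideal.span_le, Set.not_subset]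
  exact ⟨fun ⟨f, hf, h⟩ ↦ ⟨⟨f, hf⟩, h⟩, fun ⟨f, h⟩ ↦ ⟨f.val, f.isRelevant, h⟩⟩

/-- The open immersion of `Spec A_f` in `Spec A`. -/
noncomputable def specAway (f : A) : Spec (.of (Localization.Away f)) ⟶ Spec (.of A) :=
  Spec.map (CommRingCat.ofHom (algebraMap A (Localization.Away f)))

instance (f : A) : IsOpenImmersion (specAway f) := by
  unfold specAway; infer_instance

lemma range_specAway (f : A) : Set.range (specAway f) = {x : PrimeSpectrum A | f ∉ x.asIdeal} :=
  PrimeSpectrum.localization_away_comap_range (Localization.Away f) f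

/-- The open immersion of `Spec A_f` in the relevant locus, for `f` relevant. -/
noncomputable def locusι (f : Rel 𝒜) :
    Spec (.of (Localization.Away f.val)) ⟶ (relevantLocus 𝒜).toScheme :=
  IsOpenImmersion.lift (relevantLocus 𝒜).ι (specAway f.val) <| by
    rw [range_specAway, Scheme.Opens.range_ι]
    exact fun x hx ↦ (mem_relevantLocus x).mpr ⟨f, hx⟩

lemma locusι_comp (f : Rel 𝒜) : locusι f ≫ (relevantLocus 𝒜).ι = specAway f.val :=
  IsOpenImmersion.lift_fac _ _ _

lemma locusι_comp_assoc (f : Rel 𝒜) {Z : Scheme.{u}} (h : Spec (.of A) ⟶ Z) :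
    locusι f ≫ (relevantLocus 𝒜).ι ≫ h = specAway f.val ≫ h := by
  rw [← Category.assoc, locusι_comp]

instance (f : Rel 𝒜) : IsOpenImmersion (locusι f) := by
  have : IsOpenImmersion (locusι f ≫ (relevantLocus 𝒜).ι) := by
    rw [locusι_comp]; infer_instance
  exact .of_comp _ (relevantLocus 𝒜).ι

variable (𝒜) in
/-- The open cover of the relevant locus by the `Spec A_f` with `f` relevant. -/
noncomputable def locusCover : (relevantLocus 𝒜).toScheme.OpenCover where
  I₀ := Rel 𝒜
  X f := Spec (.of (Localization.Away f.val))
  f f := locusι f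
  mem₀ := by
    rw [Scheme.presieve₀_mem_precoverage_iff]
    refine ⟨fun x ↦ ?_, inferInstance⟩
    obtain ⟨f, hf⟩ := (mem_relevantLocus _).mp x.2
    obtain ⟨y, hy⟩ := (range_specAway f.val).ge hf
    refine ⟨f, y, (relevantLocus 𝒜).ι.isOpenEmbedding.injective ?_⟩
    rw [← Scheme.Hom.comp_apply]
    change (locusι f ≫ _) y = _
    rw [locusι_comp]
    exact hy

/-- The canonical map `A_{f'} → A_f` for `f` a multiple of `f'`. -/
noncomputable def Rel.lift {f f' : Rel 𝒜} (h : f ≤ f') :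
    Localization.Away f'.val →+* Localization.Away f.val :=
  Localization.awayLift (algebraMap A _) _
    (isUnit_of_dvd_unit (map_dvd _ ⟨_, h.choose_spec.choose_spec.2⟩)
      (IsLocalization.Away.algebraMap_isUnit f.val))

lemma Rel.lift_comp {f f' : Rel 𝒜} (h : f ≤ f') :
    (Rel.lift h).comp (algebraMap A _) = algebraMap A _ := by
  ext a
  simp [Rel.lift, Localization.awayLift]

lemma Rel.val_awayMap {f f' : Rel 𝒜} (h : f ≤ f') (z : Away 𝒜 f'.val) :
    (Rel.awayMap h z).val = Rel.lift h z.val :=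
  HomogeneousLocalization.val_awayMap ..

/-- The open immersion `Spec A_f ⟶ Spec A_{f'}` for `f` a multiple of `f'`. -/
noncomputable def locusTrans {f f' : Rel 𝒜} (h : f ≤ f') :
    Spec (.of (Localization.Away f.val)) ⟶ Spec (.of (Localization.Away f'.val)) :=
  Spec.map (CommRingCat.ofHom (Rel.lift h))

lemma locusTrans_comp {f f' : Rel 𝒜} (h : f ≤ f') : locusTrans h ≫ locusι f' = locusι f := by
  rw [← cancel_mono (relevantLocus 𝒜).ι, Category.assoc, locusι_comp, locusι_comp, locusTrans,
    specAway, ← Spec.map_comp, ← CommRingCat.ofHom_comp, Rel.lift_comp]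
  rfl

instance {f f' : Rel 𝒜} (h : f ≤ f') : IsOpenImmersion (locusTrans h) := by
  have : IsOpenImmersion (locusTrans h ≫ locusι f') := by
    rw [locusTrans_comp]; infer_instance
  exact .of_comp _ (locusι f')

lemma isIso_locusTrans_lift {i j k : Rel 𝒜} (hki : k ≤ i) (hkj : k ≤ j)
    (hk : k.val = i.val * j.val) :
    IsIso (pullback.lift (f := locusι i) (g := locusι j) (locusTrans hki) (locusTrans hkj)
      (by rw [locusTrans_comp, locusTrans_comp])) := by
  set m := pullback.lift (f := locusι i) (g := locusι j) (locusTrans hki) (locusTrans hkj)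
      (by rw [locusTrans_comp, locusTrans_comp]) with hm
  have h1 : m ≫ pullback.fst _ _ = locusTrans hki := pullback.lift_fst _ _ _
  have h2 : IsOpenImmersion m := by
    have : IsOpenImmersion (m ≫ pullback.fst _ _) := by rw [h1]; infer_instance
    exact .of_comp _ (pullback.fst (locusι i) (locusι j))
  let q : pullback (locusι i) (locusι j) ⟶ Spec (.of A) :=
    (pullback.fst _ _ ≫ locusι i) ≫ (relevantLocus 𝒜).ι
  have hqi : q = pullback.fst _ _ ≫ specAway i.val := by
    rw [← locusι_comp, ← Category.assoc]
  have hqj : q = pullback.snd _ _ ≫ specAway j.val := by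
    rw [← locusι_comp, ← Category.assoc]; simp only [q, pullback.condition]
  have hq : m ≫ q = specAway k.val := by
    rw [← locusι_comp, ← locusTrans_comp hki, ← h1]; simp only [q, Category.assoc]
  have hs : Function.Surjective m := by
    intro x
    have hi : q x ∈ Set.range (specAway i.val) := by
      rw [hqi, Scheme.Hom.comp_apply]; exact ⟨_, rfl⟩
    have hj : q x ∈ Set.range (specAway j.val) := by
      rw [hqj, Scheme.Hom.comp_apply]; exact ⟨_, rfl⟩
    rw [range_specAway] at hi hj
    obtain ⟨y, hy⟩ : q x ∈ Set.range (specAway k.val) := by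
      rw [range_specAway, hk]
      exact fun h ↦ ((PrimeSpectrum.isPrime _).mem_or_mem h).elim hi hj
    refine ⟨y, q.isOpenEmbedding.injective ?_⟩
    rw [← Scheme.Hom.comp_apply, hq, hy]
  exact (isIso_iff_isOpenImmersion_and_surjective m).mpr ⟨h2, ⟨hs⟩⟩

/-- Compatible morphisms on the `Spec A_f` agree on overlaps. -/
lemma locus_compatible {Y : Scheme.{u}} (g : ∀ f : Rel 𝒜, Spec (.of (Localization.Away f.val)) ⟶ Y)
    (hg : ∀ (f f' : Rel 𝒜) (h : f ≤ f'), locusTrans h ≫ g f' = g f) (i j : Rel 𝒜) :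
    pullback.fst (locusι i) (locusι j) ≫ g i = pullback.snd (locusι i) (locusι j) ≫ g j := by
  obtain ⟨d, hd, -⟩ := j.isRelevant
  obtain ⟨d', hd', -⟩ := i.isRelevant
  have hki : i.mul hd ≤ i := i.mul_le hd
  have hkj : i.mul hd ≤ j := ⟨d', i.val, hd', mul_comm _ _⟩
  have := isIso_locusTrans_lift hki hkj rfl
  rw [← cancel_epi (pullback.lift (f := locusι i) (g := locusι j) (locusTrans hki) (locusTrans hkj)
      (by rw [locusTrans_comp, locusTrans_comp])), pullback.lift_fst_assoc, pullback.lift_snd_assoc,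
    hg, hg]

variable (𝒜) in
/-- The canonical morphism `Spec A_f ⟶ Spec A_{(f)}`. -/
noncomputable def awayToChart (f : Rel 𝒜) :
    Spec (.of (Localization.Away f.val)) ⟶ Spec (.of (Away 𝒜 f.val)) :=
  Spec.map (CommRingCat.ofHom (algebraMap (Away 𝒜 f.val) (Localization.Away f.val)))

lemma locusTrans_awayToChart {f f' : Rel 𝒜} (h : f ≤ f') :
    locusTrans h ≫ awayToChart 𝒜 f' = awayToChart 𝒜 f ≫ chartTrans h := by
  change Spec.map _ ≫ Spec.map _ = Spec.map _ ≫ Spec.map _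
  rw [← Spec.map_comp, ← Spec.map_comp, ← CommRingCat.ofHom_comp, ← CommRingCat.ofHom_comp]
  congr 2
  ext z
  exact (Rel.val_awayMap h z).symm

variable (𝒜) in
/-- The canonical morphism `Spec A - V(A₊) ⟶ Proj A`, given on `Spec A_f` by
`Spec A_f ⟶ Spec A_{(f)} ⊆ Proj A`. -/
noncomputable def toProj : (relevantLocus 𝒜).toScheme ⟶ proj 𝒜 :=
  (locusCover 𝒜).glueMorphisms (fun f ↦ awayToChart 𝒜 f ≫ projι 𝒜 f) <|
    locus_compatible (fun f ↦ awayToChart 𝒜 f ≫ projι 𝒜 f) fun f f' h ↦ by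
      rw [← Category.assoc, locusTrans_awayToChart, Category.assoc, chartTrans_projι]

lemma locusι_toProj (f : Rel 𝒜) : locusι f ≫ toProj 𝒜 = awayToChart 𝒜 f ≫ projι 𝒜 f :=
  (locusCover 𝒜).ι_glueMorphisms _ _ f

lemma locusι_toProj_assoc (f : Rel 𝒜) {Z : Scheme.{u}} (h : proj 𝒜 ⟶ Z) :
    locusι f ≫ toProj 𝒜 ≫ h = awayToChart 𝒜 f ≫ projι 𝒜 f ≫ h := by
  rw [← Category.assoc, locusι_toProj, Category.assoc]

lemma locus_hom_ext {Y : Scheme.{u}} {g g' : (relevantLocus 𝒜).toScheme ⟶ Y}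
    (h : ∀ f : Rel 𝒜, locusι f ≫ g = locusι f ≫ g') : g = g' :=
  (locusCover 𝒜).hom_ext _ _ h

variable (𝒜) in
/-- The structure morphism `Proj A ⟶ Spec A₀`. -/
noncomputable def projToSpecZero : proj 𝒜 ⟶ Spec (.of (𝒜 0)) :=
  colimit.desc (chartFunctor 𝒜)
    { pt := Spec (.of (𝒜 0))
      ι.app f := Spec.map (CommRingCat.ofHom (fromZeroRingHom 𝒜 _))
      ι.naturality f g h := by
        change Spec.map _ ≫ Spec.map _ = Spec.map _ ≫ 𝟙 _
        rw [Category.comp_id, ← Spec.map_comp, ← CommRingCat.ofHom_comp]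
        congr 2
        ext z
        exact congrArg _ (awayMap_fromZeroRingHom 𝒜 (leOfHom h).choose_spec.choose_spec.1
          (leOfHom h).choose_spec.choose_spec.2 z) }

variable (𝒜) in
/-- The structure morphism `Spec A - V(A₊) ⟶ Spec A₀`. -/
noncomputable def locusToSpecZero : (relevantLocus 𝒜).toScheme ⟶ Spec (.of (𝒜 0)) :=
  (relevantLocus 𝒜).ι ≫ Spec.map (CommRingCat.ofHom (algebraMap (𝒜 0) A))

lemma toProj_projToSpecZero : toProj 𝒜 ≫ projToSpecZero 𝒜 = locusToSpecZero 𝒜 := by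
  refine locus_hom_ext fun f ↦ ?_
  have h : projι 𝒜 f ≫ projToSpecZero 𝒜 =
      Spec.map (CommRingCat.ofHom (fromZeroRingHom 𝒜 (Submonoid.powers f.val))) :=
    colimit.ι_desc _ _
  rw [locusι_toProj_assoc, locusToSpecZero, locusι_comp_assoc, h, awayToChart, specAway,
    ← Spec.map_comp, ← Spec.map_comp, ← CommRingCat.ofHom_comp, ← CommRingCat.ofHom_comp]
  rfl

end Proj
section Act
open scoped TensorProduct MonObj ModObj
variable {A : Type u} {D : Type u} {σ : Type*} [CommRing A] [AddCommGroup D] [DecidableEq D]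
  [SetLike σ A] [AddSubgroupClass σ A] (𝒜 : D → σ) [GradedRing 𝒜]

/-- The degree zero part `A₀`. -/
abbrev zeroPart : CommRingCat.{u} := .of (𝒜 0)

/-- The group algebra `A₀[D]`. -/
noncomputable abbrev groupAlg : CommRingCat.{u} := .of (AddMonoidAlgebra (𝒜 0) D)

/-- The group scheme `G = Spec A₀[D]` over `Spec A₀`. -/
noncomputable abbrev groupScheme : Over (Spec (zeroPart 𝒜)) :=
  (Spec (.of (AddMonoidAlgebra (𝒜 0) D))).asOver (Spec (zeroPart 𝒜))

/-- `Spec A` as a scheme over `Spec A₀`. -/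
noncomputable abbrev specOver : Over (Spec (zeroPart 𝒜)) :=
  (Spec (.of A)).asOver (Spec (zeroPart 𝒜))

/-- The coaction `A → A₀[D] ⊗ A` as a ring homomorphism. -/
noncomputable def coactionRingHom : A →+* AddMonoidAlgebra (𝒜 0) D ⊗[𝒜 0] A :=
  (DirectSum.toSemiring (fun d ↦
      (TensorProduct.mk (𝒜 0) (AddMonoidAlgebra (𝒜 0) D) A
        (AddMonoidAlgebra.single d 1)).toAddMonoidHom.comp (AddSubmonoidClass.subtype (𝒜 d)))
      (by rw [Algebra.TensorProduct.one_def, AddMonoidAlgebra.one_def]; rfl)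
      (fun {i j} a b ↦ by simp [AddMonoidAlgebra.single_mul_single])).comp
    (DirectSum.decomposeRingEquiv 𝒜).toRingHom

lemma coactionRingHom_of_mem {d : D} {a : A} (ha : a ∈ 𝒜 d) :
    coactionRingHom 𝒜 a = AddMonoidAlgebra.single d 1 ⊗ₜ a := by
  lift a to 𝒜 d using ha
  have h : (DirectSum.decomposeRingEquiv 𝒜).toRingHom (a : A) = DirectSum.of (fun i ↦ 𝒜 i) d a :=
    DirectSum.decompose_coe 𝒜 a
  rw [coactionRingHom, RingHom.comp_apply, h]
  exact DirectSum.toSemiring_of ..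

/-- The coaction `A → A₀[D] ⊗ A`, sending `a` homogeneous of degree `d` to `χ ^ d ⊗ a`. -/
noncomputable def coaction : A →ₐ[𝒜 0] AddMonoidAlgebra (𝒜 0) D ⊗[𝒜 0] A where
  toRingHom := coactionRingHom 𝒜
  commutes' r := by
    have h : (algebraMap (𝒜 0) A r) ∈ 𝒜 0 := r.2
    refine (coactionRingHom_of_mem 𝒜 h).trans ?_
    rw [Algebra.TensorProduct.algebraMap_apply', ← AddMonoidAlgebra.one_def]

lemma coaction_of_mem {d : D} {a : A} (ha : a ∈ 𝒜 d) :
    coaction 𝒜 a = AddMonoidAlgebra.single d 1 ⊗ₜ a :=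
  coactionRingHom_of_mem 𝒜 ha

lemma graded_algHom_ext {B : Type*} [CommRing B] [Algebra (𝒜 0) B] {f g : A →ₐ[𝒜 0] B}
    (h : ∀ (d : D), ∀ a ∈ 𝒜 d, f a = g a) : f = g := by
  ext a
  induction a using DirectSum.Decomposition.inductionOn 𝒜 with
  | zero => simp
  | homogeneous a => exact h _ _ a.2
  | add a b ha hb => simp [ha, hb]

end Act

section Transport
variable {C E : Type*} [Category C] [Category E] [MonoidalCategory C] [MonoidalCategory E]
open scoped MonObj ModObj
/-- Image of a module object under a lax monoidal functor. -/
abbrev mapModObj (F : C ⥤ E) [F.LaxMonoidal] (M X : C) [MonObj M] [ModObj M X] :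
    letI := F.monObjObj M
    ModObj (F.obj M) (F.obj X) :=
  letI := F.monObjObj M
  { smul := Functor.LaxMonoidal.μ F M X ≫ F.map γ[M, X]
    one_smul := by
      change (Functor.LaxMonoidal.ε F ≫ F.map η) ▷ F.obj X ≫ Functor.LaxMonoidal.μ F M X ≫
        F.map γ[M, X] = (λ_ (F.obj X)).hom
      have h := congrArg F.map (ModObj.one_smul (M := M) X)
      rw [F.map_comp] at h
      change F.map (η ▷ X) ≫ _ = F.map (λ_ X).hom at h
      rw [comp_whiskerRight, Category.assoc, Functor.LaxMonoidal.μ_natural_left_assoc, h,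
        ← Functor.LaxMonoidal.left_unitality]
    mul_smul := by
      change (Functor.LaxMonoidal.μ F M M ≫ F.map μ) ▷ F.obj X ≫ Functor.LaxMonoidal.μ F M X ≫
        F.map γ[M, X] = (α_ (F.obj M) (F.obj M) (F.obj X)).hom ≫
          (F.obj M ◁ (Functor.LaxMonoidal.μ F M X ≫ F.map γ[M, X])) ≫
            Functor.LaxMonoidal.μ F M X ≫ F.map γ[M, X]
      have h := congrArg F.map (ModObj.mul_smul (M := M) X)
      rw [F.map_comp] at h
      change F.map (μ ▷ X) ≫ _ = F.map ((α_ M M X).hom ≫ M ◁ γ[M, X] ≫ γ[M, X]) at h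
      rw [comp_whiskerRight, Category.assoc, Functor.LaxMonoidal.μ_natural_left_assoc, h,
        MonoidalCategory.whiskerLeft_comp, Category.assoc,
        Functor.LaxMonoidal.μ_natural_right_assoc, F.map_comp, F.map_comp]
      simp }
end Transport

section Act2
open scoped TensorProduct MonObj ModObj
open Opposite
variable {A : Type u} {D : Type u} {σ : Type*} [CommRing A] [AddCommGroup D] [DecidableEq D]
  [SetLike σ A] [AddSubgroupClass σ A] (𝒜 : D → σ) [GradedRing 𝒜]

/-- The coaction as an action in the opposite category of algebras. -/
noncomputable abbrev opModObj : ModObj (op (CommAlgCat.of (𝒜 0) (AddMonoidAlgebra (𝒜 0) D)))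
    (op (CommAlgCat.of (𝒜 0) A)) where
  smul := (CommAlgCat.ofHom (coaction 𝒜)).op
  one_smul := by
    apply Quiver.Hom.unop_inj
    ext : 1
    refine graded_algHom_ext 𝒜 fun d a ha ↦ ?_
    change Algebra.TensorProduct.map (Bialgebra.counitAlgHom (𝒜 0) (AddMonoidAlgebra (𝒜 0) D))
      (AlgHom.id (𝒜 0) A) (coaction 𝒜 a) = (1 : 𝒜 0) ⊗ₜ[𝒜 0] a
    rw [coaction_of_mem 𝒜 ha, Algebra.TensorProduct.map_tmul]
    simp
  mul_smul := by
    apply Quiver.Hom.unop_inj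
    ext : 1
    refine graded_algHom_ext 𝒜 fun d a ha ↦ ?_
    change Algebra.TensorProduct.map (Bialgebra.comulAlgHom (𝒜 0) (AddMonoidAlgebra (𝒜 0) D))
      (AlgHom.id (𝒜 0) A) (coaction 𝒜 a) =
        (Algebra.TensorProduct.assoc (𝒜 0) (𝒜 0) (𝒜 0) _ _ _).symm
          (Algebra.TensorProduct.map (AlgHom.id (𝒜 0) _) (coaction 𝒜) (coaction 𝒜 a))
    rw [coaction_of_mem 𝒜 ha, Algebra.TensorProduct.map_tmul, Algebra.TensorProduct.map_tmul,
      coaction_of_mem 𝒜 ha]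
    simp

/-- The action of `G = Spec A₀[D]` on `Spec A` over `Spec A₀` corresponding to the grading. -/
noncomputable instance specModObj : ModObj (groupScheme 𝒜) (specOver 𝒜) :=
  letI := opModObj 𝒜
  letI : (algSpec (zeroPart 𝒜)).LaxMonoidal := (braidedAlgSpec (R := zeroPart 𝒜)).toLaxMonoidal
  mapModObj (algSpec (zeroPart 𝒜)) (op (CommAlgCat.of (𝒜 0) (AddMonoidAlgebra (𝒜 0) D)))
    (op (CommAlgCat.of (𝒜 0) A))
end Act2

section Restrict

open scoped TensorProduct MonObj ModObj
open Opposite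

/-- The tensor product of two algebras as an object of the category of commutative rings. -/
noncomputable abbrev tensorRing (R S T : Type u) [CommRing R] [CommRing S] [CommRing T]
    [Algebra R S] [Algebra R T] : CommRingCat.{u} := .of (S ⊗[R] T)

/-- The restriction of an action to a stable subobject. -/
noncomputable abbrev restrictModObj {C : Type*} [Category C] [MonoidalCategory C] {M X U : C}
    [MonObj M] [ModObj M X] (j : U ⟶ X) [Mono j] (a : M ⊗ U ⟶ U)
    (ha : a ≫ j = M ◁ j ≫ γ[M, X]) : ModObj M U where
  smul := a
  one_smul := by
    rw [← cancel_mono j]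
    change (η ▷ U ≫ a) ≫ j = (λ_ U).hom ≫ j
    have h : η ▷ X ≫ γ[M, X] = (λ_ X).hom := ModObj.one_smul (M := M) X
    rw [Category.assoc, ha, ← whisker_exchange_assoc, h]
    simp
  mul_smul := by
    rw [← cancel_mono j]
    change (μ ▷ U ≫ a) ≫ j = ((α_ M M U).hom ≫ M ◁ a ≫ a) ≫ j
    have h : μ ▷ X ≫ γ[M, X] = (α_ M M X).hom ≫ M ◁ γ[M, X] ≫ γ[M, X] :=
      ModObj.mul_smul (M := M) X
    rw [Category.assoc, ha, ← whisker_exchange_assoc, h]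
    simp only [Category.assoc, ha]
    rw [← MonoidalCategory.whiskerLeft_comp_assoc, ha]
    simp

variable {A : Type u} {D : Type u} {σ : Type*} [CommRing A] [AddCommGroup D] [DecidableEq D]
  [SetLike σ A] [AddSubgroupClass σ A] (𝒜 : D → σ) [GradedRing 𝒜]

lemma smul_left_spec : γ[groupScheme 𝒜, specOver 𝒜].left =
    (pullbackSpecIso (𝒜 0) (AddMonoidAlgebra (𝒜 0) D) A).hom ≫
      Spec.map (CommRingCat.ofHom (coaction 𝒜).toRingHom) := rfl

lemma snd_left_spec : (snd (groupScheme 𝒜) (specOver 𝒜)).left =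
    (pullbackSpecIso (𝒜 0) (AddMonoidAlgebra (𝒜 0) D) A).hom ≫
      Spec.map (CommRingCat.ofHom (Algebra.TensorProduct.includeRight :
        A →ₐ[𝒜 0] AddMonoidAlgebra (𝒜 0) D ⊗[𝒜 0] A).toRingHom) :=
  (pullbackSpecIso_hom_snd _ _ _).symm

lemma coaction_mem_relevantLocus
    (y : Spec (tensorRing (𝒜 0) (AddMonoidAlgebra (𝒜 0) D) A))
    (hy : Spec.map (CommRingCat.ofHom (Algebra.TensorProduct.includeRight :
      A →ₐ[𝒜 0] AddMonoidAlgebra (𝒜 0) D ⊗[𝒜 0] A).toRingHom) y ∈ relevantLocus 𝒜) :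
    Spec.map (CommRingCat.ofHom (coaction 𝒜).toRingHom) y ∈ relevantLocus 𝒜 := by
  obtain ⟨f, hf⟩ := (mem_relevantLocus _).mp hy
  refine (mem_relevantLocus _).mpr ⟨f, fun h ↦ hf ?_⟩
  obtain ⟨d, hd, -⟩ := f.isRelevant
  have h : coaction 𝒜 f.val ∈ y.asIdeal := h
  change (1 : AddMonoidAlgebra (𝒜 0) D) ⊗ₜ[𝒜 0] f.val ∈ y.asIdeal
  rw [coaction_of_mem 𝒜 hd] at h
  have := y.asIdeal.mul_mem_left
    ((AddMonoidAlgebra.single (-d) 1 : AddMonoidAlgebra (𝒜 0) D) ⊗ₜ[𝒜 0] (1 : A)) h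
  rwa [Algebra.TensorProduct.tmul_mul_tmul, AddMonoidAlgebra.single_mul_single, neg_add_cancel,
    one_mul, one_mul, ← AddMonoidAlgebra.one_def] at this

/-- The relevant locus is stable under the action. -/
lemma smul_mem_relevantLocus {Z : Over (Spec (zeroPart 𝒜))} (g : Z ⟶ groupScheme 𝒜 ⊗ specOver 𝒜)
    (h : Z.left ⟶ (relevantLocus 𝒜).toScheme)
    (hg : (g ≫ snd (groupScheme 𝒜) (specOver 𝒜)).left = h ≫ (relevantLocus 𝒜).ι) :
    Set.range (α := Spec (.of A)) (g ≫ γ[groupScheme 𝒜, specOver 𝒜]).left ⊆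
      Set.range (relevantLocus 𝒜).ι := by
  rw [Scheme.Opens.range_ι]
  rintro _ ⟨x, rfl⟩
  let y : Z.left ⟶ Spec (tensorRing (𝒜 0) (AddMonoidAlgebra (𝒜 0) D) A) :=
    g.left ≫ (pullbackSpecIso (𝒜 0) (AddMonoidAlgebra (𝒜 0) D) A).hom
  refine coaction_mem_relevantLocus 𝒜 (y x) ?_
  have h1 : y ≫ Spec.map (CommRingCat.ofHom (Algebra.TensorProduct.includeRight :
        A →ₐ[𝒜 0] AddMonoidAlgebra (𝒜 0) D ⊗[𝒜 0] A).toRingHom) = h ≫ (relevantLocus 𝒜).ι := by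
    rw [← hg]
    exact (Category.assoc _ _ _).trans (congrArg _ (snd_left_spec 𝒜).symm)
  have h2 : (h ≫ (relevantLocus 𝒜).ι) x ∈ relevantLocus 𝒜 := (h x).2
  rw [← h1] at h2
  exact h2

/-- The relevant locus as a scheme over `Spec A₀`. -/
noncomputable abbrev locusOver : Over (Spec (zeroPart 𝒜)) := Over.mk (locusToSpecZero 𝒜)

/-- The inclusion of the relevant locus as a morphism over `Spec A₀`. -/
noncomputable def locusIncl : locusOver 𝒜 ⟶ specOver 𝒜 := Over.homMk (relevantLocus 𝒜).ι rfl

instance : Mono (locusIncl 𝒜).left := inferInstanceAs (Mono (relevantLocus 𝒜).ι)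

instance : Mono (locusIncl 𝒜) := Over.mono_of_mono_left _

/-- The action map `G × (Spec A - V(A₊)) ⟶ Spec A - V(A₊)`. -/
noncomputable def locusAct : groupScheme 𝒜 ⊗ locusOver 𝒜 ⟶ locusOver 𝒜 :=
  Over.homMk (IsOpenImmersion.lift (relevantLocus 𝒜).ι
    (groupScheme 𝒜 ◁ locusIncl 𝒜 ≫ γ[groupScheme 𝒜, specOver 𝒜]).left
    (smul_mem_relevantLocus 𝒜 _ (snd (groupScheme 𝒜) (locusOver 𝒜)).left (by
      exact congrArg (fun f ↦ f.left) (whiskerLeft_snd (groupScheme 𝒜) (locusIncl 𝒜))))) (by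
    have h := Over.w (groupScheme 𝒜 ◁ locusIncl 𝒜 ≫ γ[groupScheme 𝒜, specOver 𝒜])
    rw [← h]
    exact IsOpenImmersion.lift_fac_assoc _ _ _ _)

lemma locusAct_comp : locusAct 𝒜 ≫ locusIncl 𝒜 =
    groupScheme 𝒜 ◁ locusIncl 𝒜 ≫ γ[groupScheme 𝒜, specOver 𝒜] := by
  apply Over.OverMorphism.ext
  exact IsOpenImmersion.lift_fac (relevantLocus 𝒜).ι _ _

/-- The action of `G = Spec A₀[D]` on the relevant locus. -/
noncomputable instance locusModObj : ModObj (groupScheme 𝒜) (locusOver 𝒜) :=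
  restrictModObj (locusIncl 𝒜) (locusAct 𝒜) (locusAct_comp 𝒜)

end Restrict

section Prequotient

open scoped MonObj ModObj

variable {B : Scheme.{u}} (G X : Over B) [MonObj G] [ModObj G X]

/-- A morphism of schemes `f : X ⟶ Z` is `G`-invariant if `f (g x) = f x`, i.e. if the action map and
the projection `G × X ⟶ X` have the same composition with `f`. -/
def IsInvariant {Z : Scheme.{u}} (f : X.left ⟶ Z) : Prop :=
  γ[G, X].left ≫ f = (snd G X).left ≫ f

/-- The `G`-invariant sections over a (`G`-stable) open subset `U` of `X`: those with the same
pullback along the action map and the projection `G × X ⟶ X`. -/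
def invariantSections (U : X.left.Opens) : Set Γ(X.left, U) :=
  {s | γ[G, X].left.appLE U (γ[G, X].left ⁻¹ᵁ U ⊓ (snd G X).left ⁻¹ᵁ U) inf_le_left s =
    (snd G X).left.appLE U (γ[G, X].left ⁻¹ᵁ U ⊓ (snd G X).left ⁻¹ᵁ U) inf_le_right s}

/-- A prevariety over an (algebraically closed) field `k`: a reduced scheme of finite type over `k`,
not necessarily separated. -/
structure IsPrevariety {k : Type u} [Field k] (X : Over (Spec (.of k))) : Prop where
  isReduced : IsReduced X.left
  locallyOfFiniteType : LocallyOfFiniteType X.hom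
  quasiCompact : QuasiCompact X.hom

/-- Good prequotients for the action of a group scheme `G` over `B` on `X`, where `B` lies over the
base field `k`: a `G`-invariant surjective affine morphism `p : X ⟶ Y` of prevarieties
such that `O_Y(V) = O_X(p⁻¹(V))^G` for all open `V` in `Y`. -/
structure IsGoodPrequotient {k : Type u} [Field k] (b : B ⟶ Spec (.of k)) (Y : Over (Spec (.of k)))
    (p : (Over.map b).obj X ⟶ Y) : Prop where
  isPrevariety_source : IsPrevariety ((Over.map b).obj X)
  isPrevariety_target : IsPrevariety Y
  isInvariant : IsInvariant G X p.left
  surjective : Surjective p.left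
  isAffineHom : IsAffineHom p.left
  injective_app (V : Y.left.Opens) : Function.Injective (p.left.app V)
  range_app (V : Y.left.Opens) : Set.range (p.left.app V) = invariantSections G X (p.left ⁻¹ᵁ V)

end Prequotient

section Toric

open scoped MonObj ModObj

variable (k : Type u) [Field k]

/-- The standard torus of rank `m` over `k`, i.e. `Spec k[ℤᵐ]` with its group structure. -/
noncomputable abbrev torus (m : ℕ) : Over (Spec (.of k)) :=
  (Spec (.of (AddMonoidAlgebra k (Fin m → ℤ)))).asOver (Spec (.of k))

variable {k}

/-- The data of a toric prevariety on `X` with a torus of rank `m`: the action of the torus and an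
equivariant open immersion of the torus in `X` (the orbit map of a base point). -/
structure ToricStructure (m : ℕ) (X : Over (Spec (.of k))) where
  /-- the action of the torus -/
  action : ModObj (torus k m) X
  /-- the inclusion of the torus -/
  embed : torus k m ⟶ X
  isOpenImmersion : IsOpenImmersion embed.left
  equivariant : μ[torus k m] ≫ embed = torus k m ◁ embed ≫ γ[torus k m, X]

/-- A prevariety underlying a toric prevariety is normal and irreducible. -/
structure IsNormalPrevariety (X : Over (Spec (.of k))) : Prop extends IsPrevariety X where
  isIntegral : IsIntegral X.left
  isIntegrallyClosed (x : X.left) : IsIntegrallyClosed (X.left.presheaf.stalk x)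

/-- Toric morphisms: they restrict to a homomorphism of tori and are equivariant with respect to
this homomorphism. -/
def IsToricHom {m m' : ℕ} {X Y : Over (Spec (.of k))} (tX : ToricStructure m X)
    (tY : ToricStructure m' Y) (f : X ⟶ Y) : Prop :=
  letI := tX.action
  letI := tY.action
  ∃ φ : torus k m ⟶ torus k m', IsMonHom φ ∧ tX.embed ≫ f = φ ≫ tY.embed ∧
    γ[torus k m, X] ≫ f = (φ ⊗ₘ f) ≫ γ[torus k m', Y]

/-- Toric prequotients for the action of a group scheme `G` over `B` on `X`, where `B` lies over the
base field `k`: a `G`-invariant toric morphism `p : X ⟶ Y` of toric prevarieties such that every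
`G`-invariant toric morphism from `X` to a toric prevariety factors uniquely through a toric
morphism from `Y`. -/
structure IsToricPrequotient {B : Scheme.{u}} (G X : Over B) [MonObj G] [ModObj G X]
    (b : B ⟶ Spec (.of k)) (Y : Over (Spec (.of k))) {m m' : ℕ}
    (tX : ToricStructure m ((Over.map b).obj X)) (tY : ToricStructure m' Y)
    (p : (Over.map b).obj X ⟶ Y) : Prop where
  isNormalPrevariety_source : IsNormalPrevariety ((Over.map b).obj X)
  isNormalPrevariety_target : IsNormalPrevariety Y
  isToricHom : IsToricHom tX tY p
  isInvariant : IsInvariant G X p.left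
  existsUnique_factorization (Z : Over (Spec (.of k))) (l : ℕ)
    (tZ : ToricStructure l Z) (hZ : IsNormalPrevariety Z) (f : (Over.map b).obj X ⟶ Z)
    (hf : IsToricHom tX tZ f) (hinv : IsInvariant G X f.left) :
    ∃! g : Y ⟶ Z, IsToricHom tY tZ g ∧ p ≫ g = f

end Toric

section Polynomial

variable (k : Type u) [Field k] {D : Type u} [AddCommGroup D] [DecidableEq D] {n : ℕ}
  (w : Fin n → D)

/-- The `D`-grading of `k[T₁,…,Tₙ]` with `deg Tᵢ = wᵢ`. -/
noncomputable abbrev polyGrading : D → Submodule k (MvPolynomial (Fin n) k) :=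
  MvPolynomial.weightedHomogeneousSubmodule k w

noncomputable instance : GradedAlgebra (polyGrading k w) := MvPolynomial.weightedGradedAlgebra k w

/-- The structure morphism `Spec S₀ ⟶ Spec k`. -/
noncomputable def specZeroToBase : Spec (.of (polyGrading k w 0)) ⟶ Spec (.of k) :=
  Spec.map (CommRingCat.ofHom (algebraMap k (polyGrading k w 0)))

/-- The multigraded Proj of `S = k[T₁,…,Tₙ]` as a scheme over `k`. -/
noncomputable def projOver : Over (Spec (.of k)) :=
  Over.mk (projToSpecZero (polyGrading k w) ≫ specZeroToBase k w)

/-- The canonical morphism `Spec S - V(S₊) ⟶ Proj S` over `k`. -/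
noncomputable def toProjOver :
    (Over.map (specZeroToBase k w)).obj (locusOver (polyGrading k w)) ⟶ projOver k w :=
  Over.homMk (toProj (polyGrading k w)) (by
    change toProj _ ≫ projToSpecZero _ ≫ _ = _
    rw [← Category.assoc, toProj_projToSpecZero]
    rfl)

/-- The inclusion of the standard torus in affine space. -/
noncomputable def torusToAffine :
    Spec (.of (AddMonoidAlgebra k (Fin n → ℤ))) ⟶ Spec (.of (MvPolynomial (Fin n) k)) :=
  Spec.map (CommRingCat.ofHom (MvPolynomial.aeval (R := k) fun i : Fin n ↦
    (AddMonoidAlgebra.single (Pi.single i 1) 1 : AddMonoidAlgebra k (Fin n → ℤ))).toRingHom)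

end Polynomial
end MultiProj

open MultiProj

/-!
Let `A` be a ring graded by an abelian group `D`, let `X` be the relevant locus in `Spec A` and let
`p : X ⟶ Proj A` be the canonical morphism, glued from the morphisms `Spec A_f ⟶ Spec A_(f)`.

**Good prequotient.** For `f` relevant, the coaction of `A` extends to `A_f`, and `A_(f)` is the
ring of invariant elements of `A_f`. Taking the degree zero part is an `A_(f)`-linear retraction of
the inclusion `A_(f) ⊆ A_f`. The existence of such a retraction (`HasRetraction`) gives at once that
`Spec A_f ⟶ Spec A_(f)` is surjective and an epimorphism of schemes, that products over a base of
such morphisms are again epimorphisms, and that `A_(f)` is integrally closed if `A_f` is. Since `f`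
is relevant, `A_f` has units of so many degrees that the preimage of `Spec A_(f)` under `p` is
`Spec A_f` (`toProj_mem_range_projι`); moreover, the charts form a basis of the topology of `Proj A`
(`exists_projι_range_le`). Hence `p` is affine and surjective, and the description of `O(V)` by
invariant sections follows from the affine case by gluing (`toProj_app_injective`,
`range_toProj_app`).

**Factorization.** Any invariant morphism `f : X ⟶ Z` to any scheme factors through `p`
(`exists_toProj_comp_eq`). The point is that the preimage of an affine open subset `W` of `Z` is an
open subset whose complement is stable under the action, so that it is a union of sets `D(a)` with
`a` homogeneous (`exists_homogeneous_of_isInvariant`). The product of such an `a` with a relevant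
element is relevant, so locally `f` is an invariant morphism `Spec A_h ⟶ W` with `h` relevant, which
factors through `Spec A_(h)` as `A_(h)` is the ring of invariants. As `p` is an epimorphism, these
factorizations glue, and the result is unique.

**Toric structures.** Let `A` be a polynomial ring over `k` with homogeneous variables. The relevant
locus is covered by the sets `D(T ^ e)` for relevant monomials `T ^ e` (`exists_relExp`), the
product of all variables being one of them. The ring `A_f` for `f = T ^ e` is the monoid algebra of
a submonoid `C` of `ℤⁿ`, and `A_(f)` is that of the submonoid of elements of degree zero in `C`, in
the group `M ≅ ℤᵐ` of characters of degree zero. A scheme glued from such charts has an action of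
the torus and an equivariant embedding of it (`ToricAtlas`), and `p` is toric since it is given on
charts by the inclusion `M ⊆ ℤⁿ`. Finite generation of the monoids (`fg_awayMonoid_inf_mker`) and
the retractions above give that both schemes are normal prevarieties.

**Toric factorization.** If `p ≫ g` is toric, so is `g` (`isToricHom_of_comp`): the homomorphism of
tori `T ⟶ T'` given by `M ⊆ ℤⁿ` is surjective, so `g` maps `T'` to the torus of the target, and the
required identities of morphisms hold since they hold after composition with the epimorphisms
`T × T ⟶ T' × T'` and `T × X ⟶ T' × Proj A`.
-/

set_option linter.unusedSectionVars false

namespace MultiProj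

/-! ### Degree zero parts of localizations -/

section Components

open scoped TensorProduct

variable {A : Type u} {D : Type u} {σ : Type*} [CommRing A] [AddCommGroup D] [DecidableEq D]
  [SetLike σ A] [AddSubgroupClass σ A] {𝒜 : D → σ} [GradedRing 𝒜]
  (R : Type u) [CommRing R] [Algebra R A] (B : Type u) [CommRing B] [Algebra R B]

/-- The map `R[D] ⊗ B → B` that picks out the coefficient of `χ ^ e`. -/
noncomputable def coeffTensor (e : D) : AddMonoidAlgebra R D ⊗[R] B →ₗ[R] B :=
  TensorProduct.lift ((LinearMap.lsmul R B : R →ₗ[R] B →ₗ[R] B).comp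
    ((Finsupp.lapply e : (D →₀ R) →ₗ[R] R).comp
      (AddMonoidAlgebra.coeffLinearEquiv R).toLinearMap))

variable {R B}

lemma coeffTensor_tmul (e : D) (x : AddMonoidAlgebra R D) (b : B) :
    coeffTensor R B e (x ⊗ₜ b) = x.coeff e • b := by
  simp [coeffTensor]

lemma coeffTensor_single (e d : D) (b : B) :
    coeffTensor R B e (AddMonoidAlgebra.single d 1 ⊗ₜ b) = if d = e then b else 0 := by
  rw [coeffTensor_tmul, AddMonoidAlgebra.coeff_single, Finsupp.single_apply]
  split_ifs <;> simp

lemma coeffTensor_mul_tmul (e : D) (x : AddMonoidAlgebra R D ⊗[R] B) (b : B) :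
    coeffTensor R B e (x * 1 ⊗ₜ b) = coeffTensor R B e x * b := by
  induction x with
  | zero => simp
  | tmul y c => simp [coeffTensor_tmul]
  | add x y hx hy => simp [add_mul, hx, hy]

lemma single_tmul_mul (d e : D) (a b : B) :
    ((AddMonoidAlgebra.single d 1 : AddMonoidAlgebra R D) ⊗ₜ[R] a) *
      (AddMonoidAlgebra.single e 1 ⊗ₜ b) = AddMonoidAlgebra.single (d + e) 1 ⊗ₜ (a * b) := by
  rw [Algebra.TensorProduct.tmul_mul_tmul, AddMonoidAlgebra.single_mul_single, one_mul]

variable (𝒜) in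
/-- A homomorphism `A → R[D] ⊗ A` that sends `a` homogeneous of degree `d` to `χ ^ d ⊗ a`. -/
def IsGradingCoaction (ρ : A →ₐ[R] AddMonoidAlgebra R D ⊗[R] A) : Prop :=
  ∀ ⦃d : D⦄ ⦃a : A⦄, a ∈ 𝒜 d → ρ a = AddMonoidAlgebra.single d 1 ⊗ₜ a

variable {ρ : A →ₐ[R] AddMonoidAlgebra R D ⊗[R] A} (hρ : IsGradingCoaction 𝒜 ρ)

include hρ

lemma coeffTensor_coaction (e : D) (a : A) :
    coeffTensor R A e (ρ a) = (DirectSum.decompose 𝒜 a e : 𝒜 e) := by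
  induction a using DirectSum.Decomposition.inductionOn 𝒜 with
  | zero => simp
  | @homogeneous i a =>
    rw [hρ a.2, coeffTensor_single, DirectSum.decompose_coe, DirectSum.coe_of_apply]
    split_ifs <;> rfl
  | add a b ha hb => simp [ha, hb]

omit hρ in
variable (ρ) in
/-- The coaction followed by `R[D] ⊗ A → R[D] ⊗ A_f`. -/
noncomputable def coactionToAway (f : A) :
    A →ₐ[R] AddMonoidAlgebra R D ⊗[R] Localization.Away f :=
  (Algebra.TensorProduct.map (AlgHom.id R (AddMonoidAlgebra R D))
    (IsScalarTower.toAlgHom R A (Localization.Away f))).comp ρ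

lemma coactionToAway_of_mem (f : A) {d : D} {a : A} (ha : a ∈ 𝒜 d) :
    coactionToAway ρ f a = AddMonoidAlgebra.single d 1 ⊗ₜ algebraMap A _ a := by
  simp [coactionToAway, hρ ha]

lemma isUnit_coactionToAway {f : A} {d : D} (hf : f ∈ 𝒜 d) :
    IsUnit (coactionToAway ρ f f) := by
  obtain ⟨v, hv⟩ :=
    (IsLocalization.Away.algebraMap_isUnit (S := Localization.Away f) f).exists_right_inv
  refine IsUnit.of_mul_eq_one (AddMonoidAlgebra.single (-d) 1 ⊗ₜ v) ?_
  rw [coactionToAway_of_mem hρ f hf, single_tmul_mul, hv, add_neg_cancel]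
  rfl

/-- The coaction `A_f → R[D] ⊗ A_f`, for `f` homogeneous. -/
noncomputable def awayCoaction {f : A} {d : D} (hf : f ∈ 𝒜 d) :
    Localization.Away f →+* AddMonoidAlgebra R D ⊗[R] Localization.Away f :=
  Localization.awayLift (coactionToAway ρ f).toRingHom f (isUnit_coactionToAway hρ hf)

lemma awayCoaction_algebraMap {f : A} {d : D} (hf : f ∈ 𝒜 d) (a : A) :
    awayCoaction hρ hf (algebraMap A _ a) = coactionToAway ρ f a :=
  IsLocalization.Away.lift_eq f (isUnit_coactionToAway hρ hf) a

omit hρ in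
lemma mk_mul_algebraMap (f a : A) (n : ℕ) :
    (Localization.mk a ⟨f ^ n, n, rfl⟩ : Localization.Away f) * algebraMap A _ (f ^ n) =
      algebraMap A _ a := by
  rw [← Localization.mk_one_eq_algebraMap, ← Localization.mk_one_eq_algebraMap,
    Localization.mk_mul, Localization.mk_eq_mk_iff, Localization.r_iff_exists]
  exact ⟨1, by simp; ring⟩

omit hρ in
lemma exists_eq_mk {f : A} (r : Localization.Away f) :
    ∃ (a : A) (n : ℕ),
    r = Localization.mk a (⟨f ^ n, n, rfl⟩ : Submonoid.powers f) := by
  induction r using Localization.induction_on with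
  | H x => obtain ⟨a, ⟨_, n, rfl⟩⟩ := x; exact ⟨a, n, rfl⟩

lemma awayCoaction_mk {f : A} {d e : D} (hf : f ∈ 𝒜 d) {n : ℕ} {a : A} (ha : a ∈ 𝒜 (e + n • d)) :
    awayCoaction hρ hf (Localization.mk a ⟨f ^ n, n, rfl⟩) =
      AddMonoidAlgebra.single e 1 ⊗ₜ Localization.mk a (⟨f ^ n, n, rfl⟩ : Submonoid.powers f) := by
  have h : IsUnit (awayCoaction hρ hf (algebraMap A _ (f ^ n))) := by
    rw [map_pow]
    exact ((IsLocalization.Away.algebraMap_isUnit f).pow n).map (awayCoaction hρ hf)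
  rw [← h.mul_left_inj, ← map_mul]
  refine (congrArg _ (mk_mul_algebraMap f a n)).trans ?_
  rw [awayCoaction_algebraMap, awayCoaction_algebraMap, coactionToAway_of_mem hρ f ha,
    coactionToAway_of_mem hρ f (SetLike.pow_mem_graded n hf), single_tmul_mul, mk_mul_algebraMap]

/-- The degree zero part of an element of `A_f`, as an element of `A_f`. -/
noncomputable def awayZeroComp {f : A} {d : D} (hf : f ∈ 𝒜 d) (r : Localization.Away f) :
    Localization.Away f :=
  coeffTensor R _ 0 (awayCoaction hρ hf r)

lemma awayZeroComp_add {f : A} {d : D} (hf : f ∈ 𝒜 d) (r s : Localization.Away f) :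
    awayZeroComp hρ hf (r + s) = awayZeroComp hρ hf r + awayZeroComp hρ hf s := by
  simp [awayZeroComp]

lemma awayCoaction_val {f : A} {d : D} (hf : f ∈ 𝒜 d) (z : Away 𝒜 f) :
    awayCoaction hρ hf z.val = 1 ⊗ₜ z.val := by
  obtain ⟨n, a, ha, rfl⟩ := Away.mk_surjective 𝒜 hf z
  rw [Away.val_mk, awayCoaction_mk hρ hf (e := 0) (by simpa using ha)]
  rfl

lemma awayZeroComp_mul_val {f : A} {d : D} (hf : f ∈ 𝒜 d) (r : Localization.Away f)
    (z : Away 𝒜 f) : awayZeroComp hρ hf (r * z.val) = awayZeroComp hρ hf r * z.val := by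
  rw [awayZeroComp, map_mul, awayCoaction_val, coeffTensor_mul_tmul, awayZeroComp]

lemma awayZeroComp_mem {f : A} {d : D} (hf : f ∈ 𝒜 d) (r : Localization.Away f) :
    ∃ z : Away 𝒜 f, z.val = awayZeroComp hρ hf r := by
  obtain ⟨a, n, rfl⟩ := exists_eq_mk r
  induction a using DirectSum.Decomposition.inductionOn 𝒜 with
  | zero => exact ⟨0, by simp [awayZeroComp, Localization.mk_zero]⟩
  | @homogeneous i a =>
    have ha : (a : A) ∈ 𝒜 ((i - n • d) + n • d) := by simp
    rw [awayZeroComp, awayCoaction_mk hρ hf ha, coeffTensor_single]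
    split_ifs with h
    · exact ⟨Away.mk 𝒜 hf n a (by rw [← sub_eq_zero.mp h]; exact a.2), Away.val_mk ..⟩
    · exact ⟨0, val_zero⟩
  | add a b ha hb =>
    obtain ⟨z, hz⟩ := ha
    obtain ⟨w, hw⟩ := hb
    exact ⟨z + w, by rw [val_add, hz, hw, ← awayZeroComp_add, Localization.add_mk_self]⟩

omit hρ in
lemma coeffTensor_zero_one_tmul (b : B) : coeffTensor (D := D) R B 0 (1 ⊗ₜ b) = b := by
  simp [coeffTensor_tmul, AddMonoidAlgebra.one_def]

/-- The elements of `A_(f)` are the invariant elements of `A_f`. -/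
lemma exists_val_eq_of_awayCoaction {f : A} {d : D} (hf : f ∈ 𝒜 d) {r : Localization.Away f}
    (hr : awayCoaction hρ hf r = 1 ⊗ₜ r) : ∃ z : Away 𝒜 f, z.val = r := by
  obtain ⟨z, hz⟩ := awayZeroComp_mem hρ hf r
  exact ⟨z, hz.trans (by rw [awayZeroComp, hr, coeffTensor_zero_one_tmul])⟩

/-- A ring homomorphism `φ : R → S` has a retraction if it has a left inverse `π` that is linear
over `R`. By linearity, it suffices to require `π 1 = 1` for `π` to be a left inverse. -/
def HasRetraction {R S : Type*} [CommRing R] [CommRing S] (φ : R →+* S) : Prop :=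
  ∃ π : S →+ R, π 1 = 1 ∧ ∀ r s, π (φ r * s) = r * π s

/-- The retraction takes the degree zero part. -/
lemma hasRetraction_away {f : A} {d : D} (hf : f ∈ 𝒜 d) :
    HasRetraction (algebraMap (Away 𝒜 f) (Localization.Away f)) := by
  choose π hπ using awayZeroComp_mem hρ hf
  refine ⟨⟨⟨π, ?_⟩, fun r s ↦ ?_⟩, ?_, fun r s ↦ ?_⟩
  · apply val_injective; simp [hπ, awayZeroComp]
  · apply val_injective; simp [hπ, awayZeroComp_add]
  · apply val_injective
    refine (hπ 1).trans ?_
    rw [awayZeroComp, map_one, Algebra.TensorProduct.one_def, coeffTensor_zero_one_tmul, val_one]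
  · apply val_injective
    refine (hπ _).trans ?_
    rw [val_mul, mul_comm, HomogeneousLocalization.algebraMap_apply, awayZeroComp_mul_val, mul_comm]
    exact congrArg _ (hπ s).symm

end Components

/-! ### Ring homomorphisms with a retraction -/

section Retraction

variable {R S : Type u} [CommRing R] [CommRing S] {φ : R →+* S}

lemma HasRetraction.injective (h : HasRetraction φ) : Function.Injective φ := by
  obtain ⟨π, h1, h⟩ := h
  have key (r) : π (φ r) = r := by simpa [h1] using h r 1
  exact fun a b hab ↦ by rw [← key a, hab, key]

/-- If `I` is an ideal of `R`, the retraction maps `I S` to `I`, so `I` is the preimage of `I S`. -/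
lemma HasRetraction.comap_surjective (h : HasRetraction φ) :
    Function.Surjective (PrimeSpectrum.comap φ) := by
  obtain ⟨π, h1, h⟩ := h
  intro x
  rw [← Set.mem_range, PrimeSpectrum.mem_range_comap_iff]
  refine le_antisymm (fun r hr ↦ ?_) Ideal.le_comap_map
  have key (s) (hs : s ∈ x.asIdeal.map φ) : ∀ t, π (s * t) ∈ x.asIdeal := by
    induction hs using Submodule.span_induction with
    | mem s hs =>
      obtain ⟨r, hr, rfl⟩ := hs
      exact fun t ↦ by rw [h]; exact x.asIdeal.mul_mem_right _ hr
    | zero => simp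
    | add s s' _ _ hs hs' => exact fun t ↦ by rw [add_mul, map_add]; exact add_mem (hs t) (hs' t)
    | smul a s _ hs => exact fun t ↦ by rw [smul_eq_mul, mul_comm a, mul_assoc]; exact hs _
  have := key _ hr 1
  rwa [h, h1, mul_one] at this

open scoped TensorProduct in
lemma HasRetraction.tensor {k : Type u} [CommRing k] {S₁ S₂ T₁ T₂ : Type u} [CommRing S₁]
    [CommRing S₂] [CommRing T₁] [CommRing T₂] [Algebra k S₁] [Algebra k S₂] [Algebra k T₁]
    [Algebra k T₂] {φ : S₁ →ₐ[k] T₁} {ψ : S₂ →ₐ[k] T₂} (hφ : HasRetraction φ.toRingHom)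
    (hψ : HasRetraction ψ.toRingHom) :
    HasRetraction (Algebra.TensorProduct.map φ ψ).toRingHom := by
  obtain ⟨π, h1, h⟩ := hφ
  obtain ⟨ϖ, h1', h'⟩ := hψ
  let π' : T₁ →ₗ[k] S₁ := { π with
    map_smul' c s := by
      change π (c • s) = c • π s
      rw [Algebra.smul_def, Algebra.smul_def, ← h]
      simp }
  let ϖ' : T₂ →ₗ[k] S₂ := { ϖ with
    map_smul' c s := by
      change ϖ (c • s) = c • ϖ s
      rw [Algebra.smul_def, Algebra.smul_def, ← h']
      simp }
  refine ⟨(TensorProduct.map π' ϖ').toAddMonoidHom, ?_, fun r s ↦ ?_⟩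
  · change TensorProduct.map π' ϖ' (1 ⊗ₜ 1) = 1 ⊗ₜ 1
    rw [TensorProduct.map_tmul]
    exact congrArg₂ _ h1 h1'
  · change TensorProduct.map π' ϖ' (Algebra.TensorProduct.map φ ψ r * s) =
      r * TensorProduct.map π' ϖ' s
    induction r with
    | zero => simp
    | add x y hx hy => simp [add_mul, hx, hy]
    | tmul a b =>
      induction s with
      | zero => simp
      | add x y hx hy => rw [mul_add, map_add, hx, hy, map_add, mul_add]
      | tmul c d =>
        rw [Algebra.TensorProduct.map_tmul, Algebra.TensorProduct.tmul_mul_tmul,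
          TensorProduct.map_tmul, TensorProduct.map_tmul, Algebra.TensorProduct.tmul_mul_tmul]
        exact congrArg₂ _ (h a c) (h' b d)

/-- If `a / b` in the fraction field of `R` is integral over `R`, it is an element `s` of `S`, and
applying the retraction to `φ b * s = φ a` shows that `a / b` is in `R`. -/
lemma HasRetraction.isIntegrallyClosed [IsDomain R] [IsDomain S] [IsIntegrallyClosed S]
    (h : HasRetraction φ) : IsIntegrallyClosed R := by
  have hinj := h.injective
  obtain ⟨π, h1, h⟩ := h
  rw [isIntegrallyClosed_iff (FractionRing R)]
  intro x hx
  obtain ⟨a, b, hb, rfl⟩ := IsFractionRing.div_surjective (A := R) x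
  have hb0 : b ≠ 0 := nonZeroDivisors.ne_zero hb
  let ψ : FractionRing R →+* FractionRing S := IsFractionRing.map hinj
  have hψ (r : R) : ψ (algebraMap R _ r) = algebraMap S _ (φ r) := IsLocalization.map_eq _ r
  have hint : IsIntegral S (ψ (algebraMap R _ a / algebraMap R _ b)) := by
    obtain ⟨p, hp, hp'⟩ := hx
    refine ⟨p.map φ, hp.map φ, ?_⟩
    rw [Polynomial.eval₂_map, ← show ψ.comp (algebraMap R _) = (algebraMap S _).comp φ from
      RingHom.ext hψ, ← Polynomial.hom_eval₂, hp', map_zero]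
  obtain ⟨s, hs⟩ := IsIntegrallyClosed.isIntegral_iff.mp hint
  have hb0' : algebraMap S (FractionRing S) (φ b) ≠ 0 := by
    simpa [map_eq_zero_iff φ hinj] using hb0
  rw [map_div₀, hψ, hψ, eq_div_iff hb0', ← map_mul] at hs
  have hs' : φ b * s = φ a := by rw [mul_comm]; exact IsFractionRing.injective S _ hs
  refine ⟨π s, ?_⟩
  rw [eq_div_iff (by simpa using hb0), ← map_mul, mul_comm, ← h, hs']
  congr 1
  simpa [h1] using h a 1

end Retraction

/-! ### Epimorphisms of schemes -/

section Epi

lemma isSchemeTheoreticallyDominant_SpecMap {R S : CommRingCat.{u}} (φ : R ⟶ S)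
    (h : Function.Injective φ.hom) : IsSchemeTheoreticallyDominant (Spec.map φ) := by
  refine ⟨Scheme.IdealSheafData.ext_of_isAffine ?_⟩
  rw [Scheme.Hom.ker_apply]
  refine (RingHom.injective_iff_ker_eq_bot _).mp ?_
  have h2 := Scheme.ΓSpecIso_inv_naturality φ
  have h3 : (Spec.map φ).appTop = (Scheme.ΓSpecIso R).hom ≫ φ ≫ (Scheme.ΓSpecIso S).inv := by
    rw [h2]; simp
  change Function.Injective (Spec.map φ).appTop
  rw [h3]
  exact (((Scheme.ΓSpecIso S).symm.commRingCatIsoToRingEquiv.injective).comp h).comp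
    (Scheme.ΓSpecIso R).commRingCatIsoToRingEquiv.injective

/-- Surjectivity determines the map on points, and injectivity on sections determines the rest. -/
lemma epi_of_surjective_of_isSchemeTheoreticallyDominant {X Y : Scheme.{u}} (p : X ⟶ Y)
    [Surjective p] [QuasiCompact p] [IsSchemeTheoreticallyDominant p] : Epi p := by
  refine ⟨fun {Z} a b h ↦ ?_⟩
  have hb : a.base = b.base := by
    ext y
    obtain ⟨x, rfl⟩ := p.surjective y
    have := congrArg (fun q : X ⟶ Z ↦ q x) h
    exact this
  refine Scheme.Hom.ext hb fun U ↦ ?_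
  have h1 (e e') : (p ≫ a).appLE U (p ⁻¹ᵁ b ⁻¹ᵁ U) e = (p ≫ b).appLE U (p ⁻¹ᵁ b ⁻¹ᵁ U) e' := by
    congr 1
  have h2 : (a.app U ≫ Y.presheaf.map
      (eqToHom congr((TopologicalSpace.Opens.map $hb.symm).obj U)).op) ≫ p.app (b ⁻¹ᵁ U) =
      b.app U ≫ p.app (b ⁻¹ᵁ U) := by
    rw [Category.assoc, p.app_eq_appLE, Scheme.Hom.map_appLE]
    exact (Scheme.Hom.comp_appLE p a U _ _).symm.trans
      ((h1 _ le_rfl).trans (Scheme.Hom.comp_appLE p b U _ _))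
  ext s
  exact p.app_injective _ (ConcreteCategory.congr_hom h2 s)

lemma epi_SpecMap_of_hasRetraction {R S : Type u} [CommRing R] [CommRing S] {φ : R →+* S}
    (h : HasRetraction φ) : Epi (Spec.map (CommRingCat.ofHom φ)) := by
  have := isSchemeTheoreticallyDominant_SpecMap (CommRingCat.ofHom φ) h.injective
  have : Surjective (Spec.map (CommRingCat.ofHom φ)) := ⟨h.comap_surjective⟩
  exact epi_of_surjective_of_isSchemeTheoreticallyDominant _

/-- The intersection of two open subschemes as their fibre product. -/
lemma isPullback_of_range_eq {U V W Y : Scheme.{u}} {u : W ⟶ U} {v : W ⟶ V} {a : U ⟶ Y} {b : V ⟶ Y}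
    [IsOpenImmersion a] [IsOpenImmersion b] [IsOpenImmersion u] (w : u ≫ a = v ≫ b)
    (h : Set.range a ∩ Set.range b ⊆ Set.range (u ≫ a)) : IsPullback u v a b := by
  have : IsOpenImmersion v := by
    have : IsOpenImmersion (v ≫ b) := by rw [← w]; infer_instance
    exact .of_comp _ b
  refine (IsOpenImmersion.isPullback v u b a w ?_).flip
  ext x
  refine ⟨fun hx ↦ ?_, ?_⟩
  · obtain ⟨z, hz⟩ := h ⟨⟨x, rfl⟩, hx⟩
    exact ⟨z, a.isOpenEmbedding.injective hz⟩
  · rintro ⟨z, rfl⟩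
    exact ⟨v z, by rw [← Scheme.Hom.comp_apply, ← w]; rfl⟩

end Epi

/-! ### Charts of the relevant locus and of Proj -/

section Geometry

variable {A : Type u} {D : Type u} {σ : Type*} [CommRing A] [AddCommGroup D] [DecidableEq D]
  [SetLike σ A] [AddSubgroupClass σ A] {𝒜 : D → σ} [GradedRing 𝒜]

lemma Rel.mem (f : Rel 𝒜) : f.val ∈ 𝒜 f.isRelevant.choose := f.isRelevant.choose_spec.1

/-- The product of two relevant elements. -/
noncomputable def Rel.prod (f g : Rel 𝒜) : Rel 𝒜 := f.mul g.mem

lemma Rel.prod_le_left (f g : Rel 𝒜) : f.prod g ≤ f := f.mul_le _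

lemma Rel.prod_le_right (f g : Rel 𝒜) : f.prod g ≤ g := ⟨_, f.val, f.mem, mul_comm _ _⟩

instance (f : Rel 𝒜) : IsOpenImmersion (projι 𝒜 f) :=
  inferInstanceAs (IsOpenImmersion (colimit.ι (chartFunctor 𝒜) f))

variable (𝒜) in
/-- The open cover of `Proj A` by the `Spec A_(f)` with `f` relevant. -/
noncomputable def projCover : (proj 𝒜).OpenCover :=
  Scheme.IsLocallyDirected.openCover (chartFunctor 𝒜)

lemma exists_projι_eq (y : proj 𝒜) : ∃ (f : Rel 𝒜) (z : Spec (.of (Away 𝒜 f.val))),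
    projι 𝒜 f z = y :=
  Scheme.IsLocallyDirected.ι_jointly_surjective (chartFunctor 𝒜) y

lemma isGradingCoaction_coaction : IsGradingCoaction (R := 𝒜 0) 𝒜 (coaction 𝒜) :=
  fun _ _ ha ↦ coaction_of_mem 𝒜 ha

lemma Rel.hasRetraction (f : Rel 𝒜) :
    HasRetraction (algebraMap (Away 𝒜 f.val) (Localization.Away f.val)) :=
  hasRetraction_away isGradingCoaction_coaction f.mem

lemma awayToChart_surjective (f : Rel 𝒜) : Function.Surjective (awayToChart 𝒜 f) :=
  f.hasRetraction.comap_surjective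

lemma toProj_locusι (f : Rel 𝒜) (x : Spec (.of (Localization.Away f.val))) :
    toProj 𝒜 (locusι f x) = projι 𝒜 f (awayToChart 𝒜 f x) := by
  rw [← Scheme.Hom.comp_apply, locusι_toProj, Scheme.Hom.comp_apply]

lemma toProj_surjective : Function.Surjective (toProj 𝒜) := fun y ↦ by
  obtain ⟨f, z, rfl⟩ := exists_projι_eq y
  obtain ⟨x, rfl⟩ := awayToChart_surjective f z
  exact ⟨_, toProj_locusι f x⟩

lemma mem_range_locusι {f : Rel 𝒜} {x : (relevantLocus 𝒜).toScheme} :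
    x ∈ Set.range (locusι f) ↔ f.val ∉ PrimeSpectrum.asIdeal ((relevantLocus 𝒜).ι x) := by
  have h : (relevantLocus 𝒜).ι x ∈ Set.range (specAway f.val) ↔ _ :=
    Set.ext_iff.mp (range_specAway f.val) _
  refine Iff.trans ?_ h
  rw [← locusι_comp]
  constructor
  · rintro ⟨z, rfl⟩
    exact ⟨z, rfl⟩
  · rintro ⟨z, hz⟩
    exact ⟨z, (relevantLocus 𝒜).ι.isOpenEmbedding.injective hz⟩

lemma exists_locusι_eq (x : (relevantLocus 𝒜).toScheme) :
    ∃ (f : Rel 𝒜) (z : Spec (.of (Localization.Away f.val))), locusι f z = x := by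
  obtain ⟨f, hf⟩ := (mem_relevantLocus _).mp x.2
  exact ⟨f, mem_range_locusι.mpr hf⟩

/-- If `f = f' * g`, the open subscheme `Spec A_(f)` of `Spec A_(f')` is the locus where
`b * g ^ (N + 1) / f' ^ m` does not vanish, for some unit `b / f' ^ m` of `A_f'`. The points of
`Spec A_f'` over it are thus in `Spec A_f`. -/
lemma mem_range_locusι_of_chartTrans {f f' : Rel 𝒜} (h : f ≤ f')
    {x : Spec (.of (Localization.Away f'.val))}
    (hx : awayToChart 𝒜 f' x ∈ Set.range (chartTrans h)) : locusι f' x ∈ Set.range (locusι f) := by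
  have hx' := h
  obtain ⟨e, g, hg, hfg⟩ := hx'
  obtain ⟨d, N, n, m, a, b, hd, ha, hb, hab⟩ := f'.isRelevant.exists_data e
  have hbg : b * g ^ (N + 1) ∈ 𝒜 (m • d) := by
    convert SetLike.mul_mem_graded hb (SetLike.pow_mem_graded (N + 1) hg) using 2
    abel
  have key := isLocalization_awayMap hd hg ha hbg hb hab hfg
  rw [← Rel.awayMap_eq h hg hfg] at key
  have h1 := (isOpenImmersion_of_away _ _ key).2
  have h2 : awayToChart 𝒜 f' x ∈ _ := h1.le hx
  have h3 : (Away.mk 𝒜 hd m (b * g ^ (N + 1)) hbg).val ∉ PrimeSpectrum.asIdeal x := h2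
  rw [mem_range_locusι, ← Scheme.Hom.comp_apply, locusι_comp]
  change algebraMap A _ f.val ∉ PrimeSpectrum.asIdeal x
  intro h4
  rw [hfg, map_mul] at h4
  have h5 := ((PrimeSpectrum.isPrime x).mem_or_mem h4).resolve_left fun h ↦
    (PrimeSpectrum.isPrime x).ne_top (Ideal.eq_top_of_isUnit_mem _ h
      (IsLocalization.Away.algebraMap_isUnit f'.val))
  apply h3
  rw [Away.val_mk, pow_succ, ← mul_assoc, ← mul_one (⟨f'.val ^ m, _⟩ : Submonoid.powers f'.val),
    ← Localization.mk_mul]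
  exact Ideal.mul_mem_left _ _ h5

/-- The preimage of the chart `Spec A_(f)` under the canonical morphism is `Spec A_f`. -/
lemma toProj_mem_range_projι {f : Rel 𝒜} {x : (relevantLocus 𝒜).toScheme} :
    toProj 𝒜 x ∈ Set.range (projι 𝒜 f) ↔ x ∈ Set.range (locusι f) := by
  constructor
  · rintro ⟨z, hz⟩
    obtain ⟨g, x, rfl⟩ := exists_locusι_eq x
    rw [toProj_locusι] at hz
    obtain ⟨k, hf, hg, y, h1, h2⟩ :=
      (Scheme.IsLocallyDirected.ι_eq_ι_iff (chartFunctor 𝒜)).mp hz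
    obtain ⟨t, ht⟩ := mem_range_locusι_of_chartTrans (leOfHom hg) ⟨y, h2⟩
    rw [← ht, ← locusTrans_comp (leOfHom hf)]
    exact ⟨_, rfl⟩
  · rintro ⟨z, rfl⟩
    exact ⟨_, (toProj_locusι f z).symm⟩

lemma preimage_opensRange_projι (f : Rel 𝒜) :
    toProj 𝒜 ⁻¹ᵁ (projι 𝒜 f).opensRange = (locusι f).opensRange := by
  ext x
  exact toProj_mem_range_projι

instance {f g : Rel 𝒜} (h : f ≤ g) : IsOpenImmersion (chartTrans h) :=
  inferInstanceAs (IsOpenImmersion ((chartFunctor 𝒜).map (homOfLE h)))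

lemma isPullback_chartTrans {f g h : Rel 𝒜} (hf : h ≤ f) (hg : h ≤ g)
    (hh : h.val = f.val * g.val) :
    IsPullback (chartTrans hf) (chartTrans hg) (projι 𝒜 f) (projι 𝒜 g) := by
  refine isPullback_of_range_eq (by rw [chartTrans_projι, chartTrans_projι]) ?_
  rw [chartTrans_projι]
  rintro y ⟨hf, hg⟩
  obtain ⟨x, rfl⟩ := toProj_surjective y
  rw [toProj_mem_range_projι, mem_range_locusι] at *
  rw [hh]
  exact fun h ↦ ((PrimeSpectrum.isPrime ((relevantLocus 𝒜).ι x)).mem_or_mem h).elim hf hg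

/-- The points of `Spec A_f` in `Spec A_(f * a)` are those over the locus in the chart where
`a / f ^ n` does not vanish. -/
lemma locusι_mem_range_mul {f : Rel 𝒜} {d : D} (hf : f.val ∈ 𝒜 d) {n : ℕ} {a : A}
    (ha : a ∈ 𝒜 (n • d)) (x : Spec (.of (Localization.Away f.val))) :
    locusι f x ∈ Set.range (locusι (f.mul ha)) ↔
      Away.mk 𝒜 hf n a ha ∉ PrimeSpectrum.asIdeal (awayToChart 𝒜 f x) := by
  have hu : ∀ {z}, IsUnit z → z ∉ PrimeSpectrum.asIdeal x := fun hz h ↦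
    (PrimeSpectrum.isPrime x).ne_top (Ideal.eq_top_of_isUnit_mem _ h hz)
  have hf' := IsLocalization.Away.algebraMap_isUnit (S := Localization.Away f.val) f.val
  rw [mem_range_locusι, ← Scheme.Hom.comp_apply, locusι_comp]
  change algebraMap A _ (f.val * a) ∉ PrimeSpectrum.asIdeal x ↔
    (Away.mk 𝒜 hf n a ha).val ∉ PrimeSpectrum.asIdeal x
  rw [Away.val_mk, map_mul, ← mk_mul_algebraMap f.val a n, not_iff_not,
    (PrimeSpectrum.isPrime x).mul_mem_iff_mem_or_mem,
    (PrimeSpectrum.isPrime x).mul_mem_iff_mem_or_mem]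
  have h1 := hu hf'
  have h2 := hu (hf'.pow n)
  rw [← map_pow] at h2
  tauto

/-- The charts form a basis of the topology: the basic open subset of `Spec A_(f)` where
`a / f ^ n` does not vanish is `Spec A_(f * a)`. -/
lemma exists_projι_range_le {y : proj 𝒜} {V : (proj 𝒜).Opens} (hy : y ∈ V) :
    ∃ h : Rel 𝒜, y ∈ Set.range (projι 𝒜 h) ∧ (projι 𝒜 h).opensRange ≤ V := by
  obtain ⟨f, z, rfl⟩ := exists_projι_eq y
  obtain ⟨_, ⟨_, ⟨t, rfl⟩, rfl⟩, hzt, htV⟩ :=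
    PrimeSpectrum.isBasis_basic_opens.exists_subset_of_mem_open
      (show z ∈ (projι 𝒜 f ⁻¹ᵁ V : Set _) from hy) (projι 𝒜 f ⁻¹ᵁ V).2
  obtain ⟨n, a, ha, rfl⟩ := Away.mk_surjective 𝒜 f.mem t
  refine ⟨f.mul ha, ?_, ?_⟩
  · obtain ⟨x, rfl⟩ := awayToChart_surjective f z
    rw [← toProj_locusι, toProj_mem_range_projι]
    exact (locusι_mem_range_mul f.mem ha x).mpr hzt
  · intro y hy
    obtain ⟨x, rfl⟩ := toProj_surjective y
    have hx := toProj_mem_range_projι.mp hy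
    have hx' := hx
    obtain ⟨w, rfl⟩ := hx
    rw [← locusTrans_comp (f.mul_le ha), Scheme.Hom.comp_apply, toProj_locusι]
    refine htV ((locusι_mem_range_mul f.mem ha _).mp ?_)
    rwa [← Scheme.Hom.comp_apply, locusTrans_comp]

instance : Surjective (toProj 𝒜) := ⟨toProj_surjective⟩

instance : IsAffineHom (toProj 𝒜) := by
  refine isAffineHom_of_forall_exists_isAffineOpen _ fun y ↦ ?_
  obtain ⟨f, z, rfl⟩ := exists_projι_eq y
  refine ⟨(projι 𝒜 f).opensRange, ⟨z, rfl⟩, isAffineOpen_opensRange _, ?_⟩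
  rw [preimage_opensRange_projι]
  exact isAffineOpen_opensRange _

lemma epi_awayToChart (f : Rel 𝒜) : Epi (awayToChart 𝒜 f) :=
  epi_SpecMap_of_hasRetraction f.hasRetraction

lemma proj_hom_ext {Y : Scheme.{u}} {a b : proj 𝒜 ⟶ Y}
    (h : ∀ f : Rel 𝒜, projι 𝒜 f ≫ a = projι 𝒜 f ≫ b) : a = b :=
  (projCover 𝒜).hom_ext _ _ h

lemma epi_toProj : Epi (toProj 𝒜) := by
  refine ⟨fun a b h ↦ proj_hom_ext fun f ↦ ?_⟩
  have := epi_awayToChart f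
  rw [← cancel_epi (awayToChart 𝒜 f), ← locusι_toProj_assoc, ← locusι_toProj_assoc, h]

end Geometry

/-! ### Products with an open cover -/

section OverCover

variable {B : Scheme.{u}}

lemma isPullback_whiskerLeft (G : Over B) {X U : Over B} (j : U ⟶ X) :
    IsPullback (G ◁ j).left (snd G U).left (snd G X).left j.left := by
  refine IsPullback.mk ⟨?_⟩ ⟨PullbackCone.IsLimit.mk _
    (fun s ↦ pullback.lift (s.fst ≫ pullback.fst _ _) s.snd ?_) (fun s ↦ ?_) (fun s ↦ ?_)
    fun s m h1 h2 ↦ ?_⟩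
  · exact Over.whiskerLeft_left_snd j
  · rw [Category.assoc, pullback.condition, ← Over.w j, ← Category.assoc, ← Category.assoc]
    exact congrArg (· ≫ X.hom) s.condition
  · apply pullback.hom_ext
    · exact (Category.assoc _ _ _).trans ((congrArg _ (Over.whiskerLeft_left_fst j)).trans
        (pullback.lift_fst _ _ _))
    · exact (Category.assoc _ _ _).trans ((congrArg _ (Over.whiskerLeft_left_snd j)).trans
        (((Category.assoc _ _ _).symm.trans (congrArg (· ≫ j.left)
          (pullback.lift_snd _ _ _))).trans s.condition.symm))
  · exact pullback.lift_snd _ _ _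
  · apply pullback.hom_ext
    · rw [pullback.lift_fst, ← h1, Category.assoc]
      exact congrArg (m ≫ ·) (Over.whiskerLeft_left_fst j).symm
    · rw [pullback.lift_snd, ← h2]
      rfl

instance (G : Over B) {X U : Over B} (j : U ⟶ X) [IsOpenImmersion j.left] :
    IsOpenImmersion (G ◁ j).left :=
  MorphismProperty.of_isPullback (isPullback_whiskerLeft G j).flip inferInstance

/-- An open cover of `X`, given by morphisms over the base. -/
noncomputable abbrev overCover {X : Over B} {I : Type*} (U : I → Over B) (j : ∀ i, U i ⟶ X)
    [∀ i, IsOpenImmersion (j i).left] (hj : ∀ x : X.left, ∃ i, x ∈ Set.range (j i).left) :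
    X.left.OpenCover where
  I₀ := I
  X i := (U i).left
  f i := (j i).left
  mem₀ := by
    rw [Scheme.presieve₀_mem_precoverage_iff]
    exact ⟨hj, inferInstance⟩

/-- If the `Uᵢ` cover `X`, the `G × Uᵢ` cover `G × X`. -/
lemma exists_mem_range_whiskerLeft (G : Over B) {X : Over B} {I : Type*} (U : I → Over B)
    (j : ∀ i, U i ⟶ X) [∀ i, IsOpenImmersion (j i).left]
    (hj : ∀ x : X.left, ∃ i, x ∈ Set.range (j i).left) (x : (G ⊗ X).left) :
    ∃ i, x ∈ Set.range (G ◁ j i).left := by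
  obtain ⟨i, y, hy⟩ := hj ((snd G X).left x)
  obtain ⟨z, hz, -⟩ := Scheme.exists_preimage_of_isPullback
    (isPullback_whiskerLeft G (j i)) x y hy.symm
  exact ⟨i, z, hz⟩

lemma whiskerLeft_hom_ext (G : Over B) {X : Over B} {I : Type*} (U : I → Over B)
    (j : ∀ i, U i ⟶ X) [∀ i, IsOpenImmersion (j i).left]
    (hj : ∀ x : X.left, ∃ i, x ∈ Set.range (j i).left) {Z : Scheme.{u}} {a b : (G ⊗ X).left ⟶ Z}
    (h : ∀ i, (G ◁ j i).left ≫ a = (G ◁ j i).left ≫ b) : a = b :=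
  (overCover (fun i ↦ G ⊗ U i) (fun i ↦ G ◁ j i)
    (exists_mem_range_whiskerLeft G U j hj)).hom_ext _ _ h

end OverCover

/-! ### Morphisms from products of affine schemes -/

section AffineAction

open scoped TensorProduct MonObj ModObj
open Opposite

variable {R : CommRingCat.{u}} {H B C : Type u} [CommRing H] [CommRing B] [CommRing C] [Algebra R H]
  [Algebra R B] [Algebra R C]

variable (R B) in
/-- The spectrum of an `R`-algebra as a scheme over `Spec R`. -/
noncomputable abbrev algOver : Over (Spec R) := (algSpec R).obj (op (CommAlgCat.of R B))

/-- The morphism over `Spec R` given by a homomorphism of algebras. -/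
noncomputable abbrev algMap (φ : B →ₐ[R] C) : algOver R C ⟶ algOver R B :=
  (algSpec R).map (CommAlgCat.ofHom φ).op

/-- The morphism `Spec H × Spec B ⟶ Spec C` over `Spec R` given by a homomorphism of algebras
`C → H ⊗ B`. -/
noncomputable def coactMap (φ : C →ₐ[R] H ⊗[R] B) : algOver R H ⊗ algOver R B ⟶ algOver R C :=
  Functor.LaxMonoidal.μ (algSpec R) (op (CommAlgCat.of R H)) (op (CommAlgCat.of R B)) ≫
    (algSpec R).map (X := op (CommAlgCat.of R H) ⊗ op (CommAlgCat.of R B)) (CommAlgCat.ofHom φ).op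

lemma coactMap_comp_algMap {E : Type u} [CommRing E] [Algebra R E] (φ : C →ₐ[R] H ⊗[R] B)
    (ψ : E →ₐ[R] C) : coactMap φ ≫ algMap ψ = coactMap (φ.comp ψ) :=
  (Category.assoc _ _ _).trans (congrArg _ ((algSpec R).map_comp _ _).symm)

lemma tensorHom_coactMap {H' B' : Type u} [CommRing H'] [CommRing B'] [Algebra R H'] [Algebra R B']
    (φ : C →ₐ[R] H ⊗[R] B) (α : H →ₐ[R] H') (β : B →ₐ[R] B') :
    (algMap α ⊗ₘ algMap β) ≫ coactMap φ =
      coactMap ((Algebra.TensorProduct.map α β).comp φ) := by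
  rw [coactMap, ← Category.assoc]
  erw [Functor.LaxMonoidal.μ_natural]
  rw [Category.assoc, ← Functor.map_comp]
  rfl

lemma whiskerLeft_coactMap {B' : Type u} [CommRing B'] [Algebra R B']
    (φ : C →ₐ[R] H ⊗[R] B) (β : B →ₐ[R] B') :
    (algOver R H ◁ algMap β) ≫ coactMap φ =
      coactMap ((Algebra.TensorProduct.map (AlgHom.id R H) β).comp φ) := by
  rw [← tensorHom_coactMap, ← id_tensorHom]
  have h : algMap (AlgHom.id R H) = 𝟙 (algOver R H) := (algSpec R).map_id _
  rw [h]

end AffineAction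

/-! ### Invariance of the canonical morphism -/

section Equivariance

open scoped TensorProduct MonObj ModObj

variable {A : Type u} {D : Type u} {σ : Type*} [CommRing A] [AddCommGroup D] [DecidableEq D]
  [SetLike σ A] [AddSubgroupClass σ A] {𝒜 : D → σ} [GradedRing 𝒜]

section Algebra

variable {R : Type u} [CommRing R] [Algebra R A]
  {ρ : A →ₐ[R] AddMonoidAlgebra R D ⊗[R] A} (hρ : IsGradingCoaction 𝒜 ρ)

/-- `awayCoaction` as a homomorphism of algebras. -/
noncomputable def awayCoactionAlg {f : A} {d : D} (hf : f ∈ 𝒜 d) :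
    Localization.Away f →ₐ[R] AddMonoidAlgebra R D ⊗[R] Localization.Away f where
  toRingHom := awayCoaction hρ hf
  commutes' r := by
    change awayCoaction hρ hf (algebraMap R (Localization.Away f) r) = _
    rw [IsScalarTower.algebraMap_apply R A (Localization.Away f), awayCoaction_algebraMap,
      AlgHom.commutes]

lemma awayCoactionAlg_comp {f : A} {d : D} (hf : f ∈ 𝒜 d) :
    (awayCoactionAlg hρ hf).comp (IsScalarTower.toAlgHom R A (Localization.Away f)) =
      (Algebra.TensorProduct.map (AlgHom.id R (AddMonoidAlgebra R D))
        (IsScalarTower.toAlgHom R A (Localization.Away f))).comp ρ :=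
  AlgHom.ext fun a ↦ awayCoaction_algebraMap hρ hf a

lemma coactMap_awayCoactionAlg_comp {f : A} {d : D} (hf : f ∈ 𝒜 d) :
    coactMap (R := .of R) (awayCoactionAlg hρ hf) ≫
      algMap (IsScalarTower.toAlgHom R A (Localization.Away f)) =
    algOver (.of R) (AddMonoidAlgebra R D) ◁
      algMap (IsScalarTower.toAlgHom R A (Localization.Away f)) ≫ coactMap ρ := by
  rw [coactMap_comp_algMap, whiskerLeft_coactMap, awayCoactionAlg_comp]

end Algebra

/-- `Spec A_f` as a scheme over `Spec A₀`. -/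
noncomputable abbrev awayOver (f : Rel 𝒜) : Over (Spec (zeroPart 𝒜)) :=
  algOver (zeroPart 𝒜) (Localization.Away f.val)

/-- The inclusion of `Spec A_f` in the relevant locus, over `Spec A₀`. -/
noncomputable def locusιOver (f : Rel 𝒜) : awayOver f ⟶ locusOver 𝒜 :=
  Over.homMk (locusι f) (by
    change locusι f ≫ (relevantLocus 𝒜).ι ≫ _ = Spec.map (CommRingCat.ofHom _)
    rw [locusι_comp_assoc, specAway, ← Spec.map_comp, ← CommRingCat.ofHom_comp,
      ← IsScalarTower.algebraMap_eq])

instance (f : Rel 𝒜) : IsOpenImmersion (locusιOver f).left :=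
  inferInstanceAs (IsOpenImmersion (locusι f))

lemma locusιOver_comp (f : Rel 𝒜) : locusιOver f ≫ locusIncl 𝒜 =
    algMap (IsScalarTower.toAlgHom (𝒜 0) A (Localization.Away f.val)) :=
  Over.OverMorphism.ext (locusι_comp f)

/-- The action of `G` on `Spec A_f`. -/
noncomputable def awayAct (f : Rel 𝒜) : groupScheme 𝒜 ⊗ awayOver f ⟶ awayOver f :=
  coactMap (awayCoactionAlg isGradingCoaction_coaction f.mem)

lemma awayAct_comp (f : Rel 𝒜) :
    awayAct f ≫ locusιOver f = groupScheme 𝒜 ◁ locusιOver f ≫ γ[groupScheme 𝒜, locusOver 𝒜] := by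
  rw [← cancel_mono (locusIncl 𝒜), Category.assoc, Category.assoc]
  refine Eq.trans ?_ (congrArg (_ ≫ ·) (locusAct_comp 𝒜)).symm
  rw [← MonoidalCategory.whiskerLeft_comp_assoc, locusιOver_comp]
  exact coactMap_awayCoactionAlg_comp isGradingCoaction_coaction f.mem

/-- The coaction `A_f → A₀[D] ⊗ A_f`. -/
noncomputable def awaySmulHom (f : Rel 𝒜) : CommRingCat.of (Localization.Away f.val) ⟶
    tensorRing (𝒜 0) (AddMonoidAlgebra (𝒜 0) D) (Localization.Away f.val) :=
  CommRingCat.ofHom (awayCoactionAlg isGradingCoaction_coaction f.mem).toRingHom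

/-- The inclusion `A_f → A₀[D] ⊗ A_f`, which corresponds to the projection
`G × Spec A_f ⟶ Spec A_f`. -/
noncomputable def awaySndHom (f : Rel 𝒜) : CommRingCat.of (Localization.Away f.val) ⟶
    tensorRing (𝒜 0) (AddMonoidAlgebra (𝒜 0) D) (Localization.Away f.val) :=
  CommRingCat.ofHom (Algebra.TensorProduct.includeRight :
      _ →ₐ[𝒜 0] AddMonoidAlgebra (𝒜 0) D ⊗[𝒜 0] Localization.Away f.val).toRingHom

/-- `G × Spec A_f` as an affine scheme. -/
noncomputable def prodAway (f : Rel 𝒜) :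
    Spec (tensorRing (𝒜 0) (AddMonoidAlgebra (𝒜 0) D) (Localization.Away f.val)) ⟶
      (groupScheme 𝒜 ⊗ locusOver 𝒜).left :=
  (pullbackSpecIso (𝒜 0) (AddMonoidAlgebra (𝒜 0) D) (Localization.Away f.val)).inv ≫
    (groupScheme 𝒜 ◁ locusιOver f).left

lemma prodAway_smul (f : Rel 𝒜) : prodAway f ≫ γ[groupScheme 𝒜, locusOver 𝒜].left =
    Spec.map (awaySmulHom f) ≫ locusι f := by
  have h := congrArg (fun f ↦ f.left) (awayAct_comp f)
  refine (Category.assoc _ _ _).trans ((congrArg _ h.symm).trans ?_)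
  refine (Iso.inv_comp_eq _).mpr ?_
  rw [← Category.assoc]
  rfl

lemma prodAway_snd (f : Rel 𝒜) : prodAway f ≫ (snd (groupScheme 𝒜) (locusOver 𝒜)).left =
    Spec.map (awaySndHom f) ≫ locusι f := by
  have h : (groupScheme 𝒜 ◁ locusιOver f).left ≫ (snd (groupScheme 𝒜) (locusOver 𝒜)).left = _ :=
    congrArg (fun f ↦ f.left) (whiskerLeft_snd (groupScheme 𝒜) (locusιOver f))
  refine (Category.assoc _ _ _).trans ((congrArg _ h).trans ?_)
  refine (Iso.inv_comp_eq _).mpr ?_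
  rw [← Category.assoc]
  exact congrArg (· ≫ _) (pullbackSpecIso_hom_snd _ _ _).symm

lemma prodAway_hom_ext {Z : Scheme.{u}} {a b : (groupScheme 𝒜 ⊗ locusOver 𝒜).left ⟶ Z}
    (h : ∀ f : Rel 𝒜, prodAway f ≫ a = prodAway f ≫ b) : a = b := by
  refine whiskerLeft_hom_ext (groupScheme 𝒜) awayOver locusιOver (fun x ↦ ?_) fun f ↦ ?_
  · obtain ⟨f, z, h⟩ := exists_locusι_eq x
    exact ⟨f, z, h⟩
  · exact (cancel_epi (pullbackSpecIso (𝒜 0) (AddMonoidAlgebra (𝒜 0) D)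
      (Localization.Away f.val)).inv).mp
      ((Category.assoc _ _ _).symm.trans ((h f).trans (Category.assoc _ _ _)))

/-- On `Spec A_f`, this says that the elements of degree zero of `A_f` are invariant. -/
lemma isInvariant_toProj : IsInvariant (groupScheme 𝒜) (locusOver 𝒜) (toProj 𝒜) := by
  refine prodAway_hom_ext fun f ↦ ?_
  rw [← Category.assoc, ← Category.assoc, prodAway_smul, prodAway_snd, Category.assoc,
    Category.assoc, locusι_toProj, ← Category.assoc, ← Category.assoc, awayToChart,
    ← Spec.map_comp, ← Spec.map_comp]
  congr 2
  ext z
  exact awayCoaction_val isGradingCoaction_coaction f.mem z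

end Equivariance

/-! ### Invariant sections -/

section Sections

lemma bijective_appLE_of_eq_opensRange {U Y : Scheme.{u}} (j : U ⟶ Y) [IsOpenImmersion j]
    {V : Y.Opens} (hV : V = j.opensRange) (e : ⊤ ≤ j ⁻¹ᵁ V) :
    Function.Bijective (j.appLE V ⊤ e) := by
  have h : IsIso (j.appLE V ⊤ e) := by
    have := j.isIso_app V hV.le
    have h1 : j ⁻¹ᵁ V = ⊤ := top_le_iff.mp e
    have h2 : homOfLE e = eqToHom h1.symm := rfl
    rw [Scheme.Hom.appLE, h2]
    infer_instance
  exact ConcreteCategory.bijective_of_isIso _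

lemma appLE_map_apply {X Y : Scheme.{u}} (f : X ⟶ Y) {V V' : Y.Opens} {W : X.Opens} (i : V' ≤ V)
    (e : W ≤ f ⁻¹ᵁ V') (s : Γ(Y, V)) :
    f.appLE V' W e (Y.presheaf.map (homOfLE i).op s) =
      f.appLE V W (e.trans (f.preimage_mono i)) s :=
  ConcreteCategory.congr_hom (f.map_appLE e (homOfLE i).op) s

lemma comp_appLE_apply {X Y Z : Scheme.{u}} (f : X ⟶ Y) (g : Y ⟶ Z) {U : Z.Opens} {V : Y.Opens}
    {W : X.Opens} (e₁ : V ≤ g ⁻¹ᵁ U) (e₂ : W ≤ f ⁻¹ᵁ V) (s : Γ(Z, U)) :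
    f.appLE V W e₂ (g.appLE U V e₁ s) =
      (f ≫ g).appLE U W (e₂.trans (f.preimage_mono e₁)) s :=
  ConcreteCategory.congr_hom (Scheme.Hom.appLE_comp_appLE f g U V W e₁ e₂) s

open scoped TensorProduct MonObj ModObj

variable {A : Type u} {D : Type u} {σ : Type*} [CommRing A] [AddCommGroup D] [DecidableEq D]
  [SetLike σ A] [AddSubgroupClass σ A] {𝒜 : D → σ} [GradedRing 𝒜]

lemma le_iSup_opensRange (V : (proj 𝒜).Opens) :
    V ≤ ⨆ h : {h : Rel 𝒜 // (projι 𝒜 h).opensRange ≤ V}, (projι 𝒜 h.1).opensRange := by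
  intro y hy
  obtain ⟨h, h1, h2⟩ := exists_projι_range_le hy
  exact TopologicalSpace.Opens.mem_iSup.mpr ⟨⟨h, h2⟩, h1⟩

instance (h : Rel 𝒜) : IsSchemeTheoreticallyDominant (awayToChart 𝒜 h) :=
  isSchemeTheoreticallyDominant_SpecMap _ h.hasRetraction.injective

instance (h : Rel 𝒜) : QuasiCompact (awayToChart 𝒜 h) :=
  inferInstanceAs (QuasiCompact (Spec.map _))

/-- Locally, this is the injectivity of `A_(h) → A_h`. -/
lemma toProj_app_injective (V : (proj 𝒜).Opens) : Function.Injective ((toProj 𝒜).app V) := by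
  intro s t hst
  refine (proj 𝒜).sheaf.eq_of_locally_eq' _ V (fun h ↦ homOfLE h.2) (le_iSup_opensRange V) s t ?_
  rintro ⟨h, hV⟩
  have e : ⊤ ≤ projι 𝒜 h ⁻¹ᵁ (projι 𝒜 h).opensRange := fun x _ ↦ ⟨x, rfl⟩
  have e' := e.trans ((projι 𝒜 h).preimage_mono hV)
  refine (bijective_appLE_of_eq_opensRange (projι 𝒜 h) rfl e).1 ?_
  refine (appLE_map_apply _ hV _ _).trans (Eq.trans ?_ (appLE_map_apply _ hV _ _).symm)
  refine (Scheme.Hom.app_injective (awayToChart 𝒜 h) ⊤) ?_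
  have key (s) : (awayToChart 𝒜 h).app ⊤ ((projι 𝒜 h).appLE V ⊤ e' s) =
      (locusι h).appLE (toProj 𝒜 ⁻¹ᵁ V) ⊤ (fun x _ ↦ by
        change toProj 𝒜 (locusι h x) ∈ V
        rw [toProj_locusι]
        exact hV ⟨_, rfl⟩) ((toProj 𝒜).app V s) := by
    rw [Scheme.Hom.app_eq_appLE, Scheme.Hom.app_eq_appLE]
    refine (comp_appLE_apply _ _ _ _ s).trans (Eq.trans ?_ (comp_appLE_apply _ _ _ _ s).symm)
    congr 3
    exact (locusι_toProj h).symm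
  exact (key s).trans ((congrArg _ hst).trans (key t).symm)

/-- The restriction of an invariant section to a chart `Spec A_h` is an invariant element of `A_h`,
thus an element of `A_(h)`. -/
lemma exists_toProj_app_eq_map {V : (proj 𝒜).Opens} {h : Rel 𝒜}
    (hV : (projι 𝒜 h).opensRange ≤ V) {s : Γ((relevantLocus 𝒜).toScheme, toProj 𝒜 ⁻¹ᵁ V)}
    (hs : s ∈ invariantSections (groupScheme 𝒜) (locusOver 𝒜) (toProj 𝒜 ⁻¹ᵁ V)) :
    ∃ t : Γ(proj 𝒜, (projι 𝒜 h).opensRange), (toProj 𝒜).app _ t =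
      (relevantLocus 𝒜).toScheme.presheaf.map (homOfLE ((toProj 𝒜).preimage_mono hV)).op s := by
  have e0 : ⊤ ≤ projι 𝒜 h ⁻¹ᵁ (projι 𝒜 h).opensRange := fun x _ ↦ ⟨x, rfl⟩
  have e1 : ⊤ ≤ locusι h ⁻¹ᵁ toProj 𝒜 ⁻¹ᵁ (projι 𝒜 h).opensRange := fun x _ ↦ by
    change toProj 𝒜 (locusι h x) ∈ (projι 𝒜 h).opensRange
    rw [toProj_locusι]
    exact ⟨_, rfl⟩
  have e2 : ⊤ ≤ locusι h ⁻¹ᵁ toProj 𝒜 ⁻¹ᵁ V :=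
    e1.trans ((locusι h).preimage_mono ((toProj 𝒜).preimage_mono hV))
  -- the restriction of `s` to `Spec A_h`, which is invariant under the coaction of `A_h`
  let r := (locusι h).appLE _ ⊤ e2 s
  have hr : (Spec.map (awaySmulHom h)).appTop r =
      (Spec.map (awaySndHom h)).appTop r := by
    have h1 : (Spec.map (awaySmulHom h) ≫ locusι h).appLE _ ⊤ (fun x _ ↦ e2 trivial) s =
        (Spec.map (awaySndHom h) ≫ locusι h).appLE _ ⊤ (fun x _ ↦ e2 trivial) s := by
      have e3 : ⊤ ≤ prodAway h ⁻¹ᵁ (γ[groupScheme 𝒜, locusOver 𝒜].left ⁻¹ᵁ toProj 𝒜 ⁻¹ᵁ V ⊓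
          (snd (groupScheme 𝒜) (locusOver 𝒜)).left ⁻¹ᵁ toProj 𝒜 ⁻¹ᵁ V) := by
        intro x _
        constructor
        · have h2 := congrArg (fun f ↦ f x) (prodAway_smul h)
          change (prodAway h ≫ γ[groupScheme 𝒜, locusOver 𝒜].left) x ∈ toProj 𝒜 ⁻¹ᵁ V
          exact h2 ▸ e2 trivial
        · have h2 := congrArg (fun f ↦ f x) (prodAway_snd h)
          change (prodAway h ≫ (snd (groupScheme 𝒜) (locusOver 𝒜)).left) x ∈ toProj 𝒜 ⁻¹ᵁ V
          exact h2 ▸ e2 trivial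
      have h3 := congrArg ((prodAway h).appLE _ ⊤ e3) hs
      have h4 := (comp_appLE_apply _ _ _ _ s).symm.trans (h3.trans (comp_appLE_apply _ _ _ _ s))
      refine Eq.trans ?_ (h4.trans ?_)
      · congr 3
        exact (prodAway_smul h).symm
      · congr 3
        exact prodAway_snd h
    rw [Scheme.Hom.appTop, Scheme.Hom.appTop, Scheme.Hom.app_eq_appLE, Scheme.Hom.app_eq_appLE]
    exact (comp_appLE_apply _ _ _ _ s).trans (h1.trans (comp_appLE_apply _ _ _ _ s).symm)
  obtain ⟨z, hz⟩ := exists_val_eq_of_awayCoaction isGradingCoaction_coaction h.mem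
    (r := (Scheme.ΓSpecIso (.of (Localization.Away h.val))).hom r) (by
      have h1 := congrArg (Scheme.ΓSpecIso _).hom hr
      have h2 := ConcreteCategory.congr_hom (Scheme.ΓSpecIso_naturality (awaySmulHom h)) r
      have h3 := ConcreteCategory.congr_hom (Scheme.ΓSpecIso_naturality (awaySndHom h)) r
      exact h2.symm.trans (h1.trans h3))
  obtain ⟨t, ht⟩ := (bijective_appLE_of_eq_opensRange (projι 𝒜 h) rfl e0).2
    ((Scheme.ΓSpecIso (.of (Away 𝒜 h.val))).inv z)
  refine ⟨t, (bijective_appLE_of_eq_opensRange (locusι h) (preimage_opensRange_projι h) e1).1 ?_⟩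
  refine Eq.trans ?_ (appLE_map_apply (locusι h) ((toProj 𝒜).preimage_mono hV) e1 s).symm
  have h1 : (awayToChart 𝒜 h).appTop ((projι 𝒜 h).appLE _ ⊤ e0 t) = r := by
    rw [ht]
    have h2 := ConcreteCategory.congr_hom (Scheme.ΓSpecIso_inv_naturality
      (CommRingCat.ofHom (algebraMap (Away 𝒜 h.val) (Localization.Away h.val)))) z
    refine h2.symm.trans ?_
    change (Scheme.ΓSpecIso (.of (Localization.Away h.val))).inv z.val = r
    rw [hz]
    exact ConcreteCategory.congr_hom (Scheme.ΓSpecIso _).hom_inv_id r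
  refine Eq.trans ?_ h1
  rw [Scheme.Hom.appTop, Scheme.Hom.app_eq_appLE, Scheme.Hom.app_eq_appLE]
  refine (comp_appLE_apply _ _ _ _ t).trans (Eq.trans ?_ (comp_appLE_apply _ _ _ _ t).symm)
  congr 3
  exact locusι_toProj h

lemma range_toProj_app (V : (proj 𝒜).Opens) : Set.range ((toProj 𝒜).app V) =
    invariantSections (groupScheme 𝒜) (locusOver 𝒜) (toProj 𝒜 ⁻¹ᵁ V) := by
  apply subset_antisymm
  · rintro _ ⟨t, rfl⟩
    change γ[groupScheme 𝒜, locusOver 𝒜].left.appLE _ _ _ _ =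
      (snd (groupScheme 𝒜) (locusOver 𝒜)).left.appLE _ _ _ _
    rw [Scheme.Hom.app_eq_appLE]
    refine (comp_appLE_apply _ _ _ _ t).trans (Eq.trans ?_ (comp_appLE_apply _ _ _ _ t).symm)
    congr 3
    exact isInvariant_toProj
  · intro s hs
    let I := {h : Rel 𝒜 // (projι 𝒜 h).opensRange ≤ V}
    choose t ht using fun h : I ↦ exists_toProj_app_eq_map h.2 hs
    obtain ⟨t', ht', -⟩ := (proj 𝒜).sheaf.existsUnique_gluing'
      (fun h : I ↦ (projι 𝒜 h.1).opensRange) V (fun h ↦ homOfLE h.2) (le_iSup_opensRange V) t <| by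
      intro i j
      apply toProj_app_injective
      have key (l : I) (U : (proj 𝒜).Opens) (hU : U ≤ (projι 𝒜 l.1).opensRange) :
          (toProj 𝒜).app U ((proj 𝒜).presheaf.map (homOfLE hU).op (t l)) =
          (relevantLocus 𝒜).toScheme.presheaf.map
            (homOfLE ((toProj 𝒜).preimage_mono (hU.trans l.2))).op s := by
        have h1 := ConcreteCategory.congr_hom ((toProj 𝒜).naturality (homOfLE hU).op) (t l)
        refine h1.trans ((congrArg ((relevantLocus 𝒜).toScheme.presheaf.map
          (homOfLE ((toProj 𝒜).preimage_mono hU)).op) (ht l)).trans ?_)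
        exact (ConcreteCategory.congr_hom ((relevantLocus 𝒜).toScheme.presheaf.map_comp
          (homOfLE ((toProj 𝒜).preimage_mono l.2)).op
          (homOfLE ((toProj 𝒜).preimage_mono hU)).op) s).symm
      exact (key i _ inf_le_left).trans (key j _ inf_le_right).symm
    refine ⟨t', ?_⟩
    refine (relevantLocus 𝒜).toScheme.sheaf.eq_of_locally_eq'
      (fun h : I ↦ toProj 𝒜 ⁻¹ᵁ (projι 𝒜 h.1).opensRange) (toProj 𝒜 ⁻¹ᵁ V)
      (fun h ↦ homOfLE ((toProj 𝒜).preimage_mono h.2)) (fun x hx ↦ ?_) _ _ fun h ↦ ?_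
    · obtain ⟨h, h1⟩ := TopologicalSpace.Opens.mem_iSup.mp (le_iSup_opensRange V hx)
      exact TopologicalSpace.Opens.mem_iSup.mpr ⟨h, h1⟩
    · have h1 := ConcreteCategory.congr_hom ((toProj 𝒜).naturality (homOfLE h.2).op) t'
      exact h1.symm.trans ((congrArg _ (ht' h)).trans (ht h))

end Sections

/-! ### Factorization of invariant morphisms -/

section Categorical

open scoped TensorProduct MonObj ModObj

variable {A : Type u} {D : Type u} {σ : Type*} [CommRing A] [AddCommGroup D] [DecidableEq D]
  [SetLike σ A] [AddSubgroupClass σ A] {𝒜 : D → σ} [GradedRing 𝒜]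

section Algebra

variable {R : Type u} [CommRing R] [Algebra R A]

/-- The components of an element of `R[D] ⊗ J` are in `J`. -/
lemma coeffTensor_mem {B : Type u} [CommRing B] [Algebra R B] (J : Ideal B)
    {x : AddMonoidAlgebra R D ⊗[R] B}
    (hx : x ∈ J.map (Algebra.TensorProduct.includeRight :
      B →ₐ[R] AddMonoidAlgebra R D ⊗[R] B).toRingHom) (e : D) :
    coeffTensor R B e x ∈ J := by
  have key (s) (hs : s ∈ J.map (Algebra.TensorProduct.includeRight :
      B →ₐ[R] AddMonoidAlgebra R D ⊗[R] B).toRingHom) : ∀ t, coeffTensor R B e (t * s) ∈ J := by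
    induction hs using Submodule.span_induction with
    | mem s hs =>
      obtain ⟨r, hr, rfl⟩ := hs
      intro t
      refine (congrArg (· ∈ J) (coeffTensor_mul_tmul e t r)).mpr (J.mul_mem_left _ hr)
    | zero => simp
    | add s s' _ _ hs hs' => exact fun t ↦ by rw [mul_add, map_add]; exact add_mem (hs t) (hs' t)
    | smul a s _ hs => exact fun t ↦ by rw [smul_eq_mul, ← mul_assoc]; exact hs _
  simpa using key x hx 1

/-- If all primes of `R[D] ⊗ A` over `V(J)` are sent to `V(b)` by the action, the components of a
power of `b` are in `J`. -/
lemma exists_decompose_pow_mem {ρ : A →ₐ[R] AddMonoidAlgebra R D ⊗[R] A}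
    (hρ : IsGradingCoaction 𝒜 ρ) (J : Ideal A) (b : A)
    (h : ∀ Q : Ideal (AddMonoidAlgebra R D ⊗[R] A), Q.IsPrime →
      J ≤ Q.comap (Algebra.TensorProduct.includeRight :
        A →ₐ[R] AddMonoidAlgebra R D ⊗[R] A).toRingHom → ρ b ∈ Q) :
    ∃ N : ℕ, ∀ e : D, (DirectSum.decompose 𝒜 (b ^ N) e : A) ∈ J := by
  have h1 : ρ b ∈ (J.map (Algebra.TensorProduct.includeRight :
        A →ₐ[R] AddMonoidAlgebra R D ⊗[R] A).toRingHom).radical := by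
    rw [Ideal.radical_eq_sInf, Submodule.mem_sInf]
    exact fun Q hQ ↦ h Q hQ.2 (Ideal.map_le_iff_le_comap.mp hQ.1)
  obtain ⟨N, hN⟩ := h1
  refine ⟨N, fun e ↦ ?_⟩
  rw [← coeffTensor_coaction hρ]
  refine coeffTensor_mem J ?_ e
  rwa [map_pow]

end Algebra

/-- An invariant morphism has the same value at the two images in the relevant locus of a point of
`G × Spec A`, under the action and under the projection. -/
lemma exists_eq_of_isInvariant {Z : Scheme.{u}} {f : (relevantLocus 𝒜).toScheme ⟶ Z}
    (hf : IsInvariant (groupScheme 𝒜) (locusOver 𝒜) f)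
    (Q : Spec (tensorRing (𝒜 0) (AddMonoidAlgebra (𝒜 0) D) A))
    (hQ : Spec.map (CommRingCat.ofHom (Algebra.TensorProduct.includeRight :
        A →ₐ[𝒜 0] AddMonoidAlgebra (𝒜 0) D ⊗[𝒜 0] A).toRingHom) Q ∈ relevantLocus 𝒜) :
    ∃ x y : (relevantLocus 𝒜).toScheme, f x = f y ∧
      (relevantLocus 𝒜).ι x = Spec.map (CommRingCat.ofHom (coaction 𝒜).toRingHom) Q ∧
      (relevantLocus 𝒜).ι y = Spec.map (CommRingCat.ofHom (Algebra.TensorProduct.includeRight :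
        A →ₐ[𝒜 0] AddMonoidAlgebra (𝒜 0) D ⊗[𝒜 0] A).toRingHom) Q := by
  let q : (groupScheme 𝒜 ⊗ specOver 𝒜).left :=
    (pullbackSpecIso (𝒜 0) (AddMonoidAlgebra (𝒜 0) D) A).inv Q
  have h0 : (pullbackSpecIso (𝒜 0) (AddMonoidAlgebra (𝒜 0) D) A).hom q = Q :=
    congrArg (fun f ↦ f Q) (pullbackSpecIso (𝒜 0) (AddMonoidAlgebra (𝒜 0) D) A).inv_hom_id
  have h1 : γ[groupScheme 𝒜, specOver 𝒜].left q =
      Spec.map (CommRingCat.ofHom (coaction 𝒜).toRingHom) Q :=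
    (congrArg (fun f ↦ f q) (smul_left_spec 𝒜)).trans
      (congrArg (Spec.map (CommRingCat.ofHom (coaction 𝒜).toRingHom)) h0)
  have h2 : (snd (groupScheme 𝒜) (specOver 𝒜)).left q =
      Spec.map (CommRingCat.ofHom (Algebra.TensorProduct.includeRight :
      A →ₐ[𝒜 0] AddMonoidAlgebra (𝒜 0) D ⊗[𝒜 0] A).toRingHom) Q :=
    (congrArg (fun f ↦ f q) (snd_left_spec 𝒜)).trans
      (congrArg (Spec.map (CommRingCat.ofHom (Algebra.TensorProduct.includeRight :
        A →ₐ[𝒜 0] AddMonoidAlgebra (𝒜 0) D ⊗[𝒜 0] A).toRingHom)) h0)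
  obtain ⟨q', h3, h4⟩ := Scheme.exists_preimage_of_isPullback
    (isPullback_whiskerLeft (groupScheme 𝒜) (locusIncl 𝒜)) q ⟨_, hQ⟩ h2
  refine ⟨γ[groupScheme 𝒜, locusOver 𝒜].left q', (snd (groupScheme 𝒜) (locusOver 𝒜)).left q',
    congrArg (fun f ↦ f q') hf, ?_, ?_⟩
  · refine (congrArg (fun f ↦ f.left q') (locusAct_comp 𝒜)).trans ?_
    exact (congrArg γ[groupScheme 𝒜, specOver 𝒜].left h3).trans h1
  · exact congrArg (relevantLocus 𝒜).ι h4

/-- A version of `exists_eq_of_isInvariant` for prime ideals of `A₀[D] ⊗ A`, where the point `x` is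
the image under the action and `y` the image under the projection. -/
lemma exists_eq_of_isInvariant_of_isPrime {Z : Scheme.{u}} {f : (relevantLocus 𝒜).toScheme ⟶ Z}
    (hf : IsInvariant (groupScheme 𝒜) (locusOver 𝒜) f)
    (Q : Ideal (AddMonoidAlgebra (𝒜 0) D ⊗[𝒜 0] A)) [hQ : Q.IsPrime] (g : Rel 𝒜)
    (hg : coaction 𝒜 g.val ∉ Q) :
    ∃ x y : (relevantLocus 𝒜).toScheme, f x = f y ∧
      (∀ a : A, a ∈ PrimeSpectrum.asIdeal ((relevantLocus 𝒜).ι x) ↔ coaction 𝒜 a ∈ Q) ∧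
      Q.comap (Algebra.TensorProduct.includeRight :
        A →ₐ[𝒜 0] AddMonoidAlgebra (𝒜 0) D ⊗[𝒜 0] A).toRingHom ≤
          PrimeSpectrum.asIdeal ((relevantLocus 𝒜).ι y) := by
  obtain ⟨x, y, h1, h2, h3⟩ := exists_eq_of_isInvariant hf
    (show Spec (tensorRing (𝒜 0) (AddMonoidAlgebra (𝒜 0) D) A) from ⟨Q, hQ⟩) <| by
      refine (mem_relevantLocus _).mpr ⟨g, fun h ↦ hg ?_⟩
      have h' : (1 : AddMonoidAlgebra (𝒜 0) D) ⊗ₜ[𝒜 0] g.val ∈ Q := h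
      have := Q.mul_mem_left
        ((AddMonoidAlgebra.single g.isRelevant.choose 1 : AddMonoidAlgebra (𝒜 0) D) ⊗ₜ[𝒜 0] 1) h'
      rw [coaction_of_mem 𝒜 g.mem]
      rwa [Algebra.TensorProduct.tmul_mul_tmul, mul_one, one_mul] at this
  refine ⟨x, y, h1, fun a ↦ ?_, ?_⟩
  · rw [h2]
    exact Iff.rfl
  · rw [h3]
    exact le_rfl

/-- The preimage of an open subset under an invariant morphism is an invariant open subset,
hence it is a union of sets `D(a)` with `a` homogeneous. -/
lemma exists_homogeneous_of_isInvariant {Z : Scheme.{u}} {f : (relevantLocus 𝒜).toScheme ⟶ Z}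
    (hf : IsInvariant (groupScheme 𝒜) (locusOver 𝒜) f) (W : Z.Opens)
    (x : (relevantLocus 𝒜).toScheme) (hx : f x ∈ W) :
    ∃ (d : D) (a : A), a ∈ 𝒜 d ∧ a ∉ PrimeSpectrum.asIdeal ((relevantLocus 𝒜).ι x) ∧
      ∀ y : (relevantLocus 𝒜).toScheme,
        a ∉ PrimeSpectrum.asIdeal ((relevantLocus 𝒜).ι y) → f y ∈ W := by
  -- `J` is the ideal of the complement of the preimage `U` of `W`
  let U : Set (PrimeSpectrum A) := (relevantLocus 𝒜).ι '' (f ⁻¹ᵁ W)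
  have hU : IsOpen U := (relevantLocus 𝒜).ι.isOpenEmbedding.isOpenMap _ (f ⁻¹ᵁ W).2
  have hUf (y) (hy : (relevantLocus 𝒜).ι y ∈ U) : f y ∈ W := by
    obtain ⟨y', h1, h2⟩ := hy
    rwa [← (relevantLocus 𝒜).ι.isOpenEmbedding.injective h2]
  let J : Ideal A := PrimeSpectrum.vanishingIdeal Uᶜ
  have hJ (a : A) (ha : a ∈ J) (y : PrimeSpectrum A) (hy : a ∉ y.asIdeal) : y ∈ U := by
    by_contra h
    exact hy ((PrimeSpectrum.mem_vanishingIdeal _ _).mp ha y h)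
  have hJ' (y : PrimeSpectrum A) (hy : y ∈ U) : ∃ b ∈ J, b ∉ y.asIdeal := by
    by_contra! h
    have h1 : y ∈ PrimeSpectrum.zeroLocus (J : Set A) := h
    rw [PrimeSpectrum.zeroLocus_vanishingIdeal_eq_closure, hU.isClosed_compl.closure_eq] at h1
    exact h1 hy
  obtain ⟨b, hb, hbx⟩ := hJ' ((relevantLocus 𝒜).ι x) ⟨x, hx, rfl⟩
  obtain ⟨N, hN⟩ := exists_decompose_pow_mem (𝒜 := 𝒜) isGradingCoaction_coaction J b <| by
    -- if the action maps the point `Q` to `D(b) ⊆ U`, its projection is in `U` as well, by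
    -- invariance, thus not in `V(J)`
    intro Q hQ hJQ
    by_contra hbQ
    obtain ⟨g, hg⟩ : ∃ g : Rel 𝒜, coaction 𝒜 g.val ∉ Q := by
      obtain ⟨x', -, hx'⟩ :
          (⟨Q.comap (coaction 𝒜).toRingHom, inferInstance⟩ : PrimeSpectrum A) ∈ U := hJ b hb _ hbQ
      obtain ⟨g, hg⟩ := (mem_relevantLocus _).mp x'.2
      refine ⟨g, ?_⟩
      have h3 : g.val ∉ PrimeSpectrum.asIdeal ((relevantLocus 𝒜).ι x') := hg
      rwa [hx'] at h3
    obtain ⟨y₁, y₀, h3, h4, h5⟩ := exists_eq_of_isInvariant_of_isPrime hf Q g hg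
    have h6 : f y₁ ∈ W := hUf _ (hJ b hb _ fun h ↦ hbQ ((h4 b).mp h))
    obtain ⟨b', hb', hby⟩ := hJ' ((relevantLocus 𝒜).ι y₀) ⟨y₀, by change f y₀ ∈ W; rwa [← h3], rfl⟩
    exact hby (h5 (hJQ hb'))
  classical
  by_contra! hcon
  have h3 : b ^ N ∈ PrimeSpectrum.asIdeal ((relevantLocus 𝒜).ι x) := by
    rw [← DirectSum.sum_support_decompose 𝒜 (b ^ N)]
    refine sum_mem fun e _ ↦ ?_
    by_contra h
    obtain ⟨y, hy, hy'⟩ := hcon e _ (SetLike.coe_mem _) h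
    exact hy' (hUf y (hJ _ (hN e) _ hy))
  exact hbx ((PrimeSpectrum.isPrime _).mem_of_pow_mem _ h3)

/-- An invariant morphism from `Spec A_h` to an affine scheme factors through `Spec A_(h)`. -/
lemma exists_comp_eq_of_affine (h : Rel 𝒜) {B : CommRingCat.{u}}
    (f : Spec (.of (Localization.Away h.val)) ⟶ Spec B)
    (hf : Spec.map (awaySmulHom h) ≫ f = Spec.map (awaySndHom h) ≫ f) :
    ∃ g : Spec (.of (Away 𝒜 h.val)) ⟶ Spec B, awayToChart 𝒜 h ≫ g = f := by
  obtain ⟨φ, rfl⟩ := Spec.map_surjective f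
  rw [← Spec.map_comp, ← Spec.map_comp] at hf
  have hf' := Spec.map_injective hf
  have h1 (b : B) : ∃ z : Away 𝒜 h.val, z.val = φ.hom b :=
    exists_val_eq_of_awayCoaction isGradingCoaction_coaction h.mem
      (ConcreteCategory.congr_hom hf' b)
  choose ψ hψ using h1
  let ψ' : B →+* Away 𝒜 h.val :=
    { toFun := ψ
      map_one' := val_injective _ (by rw [hψ, map_one, val_one])
      map_mul' := fun x y ↦ val_injective _ (by rw [hψ, map_mul, val_mul, hψ, hψ])
      map_zero' := val_injective _ (by rw [hψ, map_zero, val_zero])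
      map_add' := fun x y ↦ val_injective _ (by rw [hψ, map_add, val_add, hψ, hψ]) }
  refine ⟨Spec.map (CommRingCat.ofHom ψ'), ?_⟩
  rw [awayToChart, ← Spec.map_comp]
  congr 1
  ext b
  exact hψ b

/-- Near any point, an invariant morphism maps some `Spec A_h` to an affine open subset, and it
factors through `Spec A_(h)` there. -/
lemma exists_local_factorization {Z : Scheme.{u}} {f : (relevantLocus 𝒜).toScheme ⟶ Z}
    (hf : IsInvariant (groupScheme 𝒜) (locusOver 𝒜) f) (x : (relevantLocus 𝒜).toScheme) :
    ∃ h : Rel 𝒜, x ∈ Set.range (locusι h) ∧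
      ∃ g : Spec (.of (Away 𝒜 h.val)) ⟶ Z, awayToChart 𝒜 h ≫ g = locusι h ≫ f := by
  obtain ⟨_, ⟨W, hW, rfl⟩, hxW, -⟩ :=
    Z.isBasis_affineOpens.exists_subset_of_mem_open (Set.mem_univ (f x)) isOpen_univ
  replace hW : IsAffineOpen W := hW
  obtain ⟨d, a, ha, hax, hy⟩ := exists_homogeneous_of_isInvariant hf W x hxW
  obtain ⟨g, hg⟩ := (mem_relevantLocus _).mp x.2
  let h : Rel 𝒜 := g.mul ha
  refine ⟨h, mem_range_locusι.mpr fun h1 ↦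
    ((PrimeSpectrum.isPrime _).mem_or_mem h1).elim hg hax, ?_⟩
  have hr : Set.range (locusι h ≫ f) ⊆ Set.range hW.fromSpec := by
    rw [hW.range_fromSpec]
    rintro _ ⟨z, rfl⟩
    refine hy _ fun h1 ↦ ?_
    have h2 : locusι h z ∈ Set.range (locusι h) := ⟨z, rfl⟩
    rw [mem_range_locusι] at h2
    exact h2 (Ideal.mul_mem_left _ _ h1)
  have hfac := IsOpenImmersion.lift_fac hW.fromSpec (locusι h ≫ f) hr
  obtain ⟨g', hg'⟩ := exists_comp_eq_of_affine h
    (IsOpenImmersion.lift hW.fromSpec (locusι h ≫ f) hr) <| by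
      rw [← cancel_mono hW.fromSpec, Category.assoc, Category.assoc, hfac,
        ← Category.assoc, ← Category.assoc, ← prodAway_smul, ← prodAway_snd, Category.assoc,
        Category.assoc]
      exact congrArg _ hf
  exact ⟨g' ≫ hW.fromSpec, by rw [← Category.assoc, hg', hfac]⟩

/-- The existence part of the universal property of `Proj A` as a categorical quotient in the
category of all schemes; uniqueness is `epi_toProj`. -/
lemma exists_toProj_comp_eq {Z : Scheme.{u}} {f : (relevantLocus 𝒜).toScheme ⟶ Z}
    (hf : IsInvariant (groupScheme 𝒜) (locusOver 𝒜) f) :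
    ∃ g : proj 𝒜 ⟶ Z, toProj 𝒜 ≫ g = f := by
  let I := {h : Rel 𝒜 // ∃ g : Spec (.of (Away 𝒜 h.val)) ⟶ Z, awayToChart 𝒜 h ≫ g = locusι h ≫ f}
  choose g hg using fun h : I ↦ h.2
  let 𝒰 : (proj 𝒜).OpenCover :=
    { I₀ := I
      X h := Spec (.of (Away 𝒜 h.1.val))
      f h := projι 𝒜 h.1
      mem₀ := by
        rw [Scheme.presieve₀_mem_precoverage_iff]
        refine ⟨fun y ↦ ?_, inferInstance⟩
        obtain ⟨x, rfl⟩ := toProj_surjective y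
        obtain ⟨h, hx, hh⟩ := exists_local_factorization hf x
        exact ⟨⟨h, hh⟩, toProj_mem_range_projι.mpr hx⟩ }
  let 𝒱 : (relevantLocus 𝒜).toScheme.OpenCover :=
    { I₀ := I
      X h := Spec (.of (Localization.Away h.1.val))
      f h := locusι h.1
      mem₀ := by
        rw [Scheme.presieve₀_mem_precoverage_iff]
        refine ⟨fun x ↦ ?_, inferInstance⟩
        obtain ⟨h, hx, hh⟩ := exists_local_factorization hf x
        exact ⟨⟨h, hh⟩, hx⟩ }
  have hcompat (i j : I) : pullback.fst (projι 𝒜 i.1) (projι 𝒜 j.1) ≫ g i =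
      pullback.snd (projι 𝒜 i.1) (projι 𝒜 j.1) ≫ g j := by
    let l := i.1.prod j.1
    have hp := isPullback_chartTrans (i.1.prod_le_left j.1) (i.1.prod_le_right j.1) rfl
    rw [← cancel_epi hp.isoPullback.hom, hp.isoPullback_hom_fst_assoc, hp.isoPullback_hom_snd_assoc]
    have := epi_awayToChart l
    have key (m : I) (hm : l ≤ m.1) : awayToChart 𝒜 l ≫ chartTrans hm ≫ g m = locusι l ≫ f := by
      rw [← Category.assoc, ← locusTrans_awayToChart, Category.assoc, hg, ← Category.assoc,
        locusTrans_comp]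
    exact (cancel_epi (awayToChart 𝒜 l)).mp ((key i _).trans (key j _).symm)
  refine ⟨𝒰.glueMorphisms g hcompat, 𝒱.hom_ext _ _ fun h ↦ ?_⟩
  change locusι h.1 ≫ toProj 𝒜 ≫ _ = locusι h.1 ≫ f
  rw [locusι_toProj_assoc]
  exact (congrArg _ (𝒰.ι_glueMorphisms g hcompat h)).trans (hg h)

end Categorical

/-! ### Spectra of monoid algebras -/

section MonoidCoaction

open scoped TensorProduct MonObj ModObj
open Opposite

variable (k : Type u) [Field k] {M C C' : Type} [AddCommGroup M] [AddCommMonoid C]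
  [AddCommMonoid C']

/-- The homomorphism of monoid algebras given by a homomorphism of monoids. -/
noncomputable abbrev monoidAlgMap (φ : C →+ C') :
    AddMonoidAlgebra k C →ₐ[k] AddMonoidAlgebra k C' :=
  AddMonoidAlgebra.mapDomainAlgHom k k φ

lemma monoidAlgMap_single (φ : C →+ C') (c : C) (r : k) :
    monoidAlgMap k φ (AddMonoidAlgebra.single c r) = AddMonoidAlgebra.single (φ c) r := by
  simp [monoidAlgMap]

/-- The coaction `k[C] → k[M] ⊗ k[C]` given by the grading of `k[C]` by `M`. -/
noncomputable def monoidCoaction (φ : C →+ M) :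
    AddMonoidAlgebra k C →ₐ[k] AddMonoidAlgebra k M ⊗[k] AddMonoidAlgebra k C :=
  AddMonoidAlgebra.lift k _ C
    { toFun c := AddMonoidAlgebra.single (φ c.toAdd) 1 ⊗ₜ AddMonoidAlgebra.single c.toAdd 1
      map_one' := by simp [Algebra.TensorProduct.one_def, AddMonoidAlgebra.one_def]
      map_mul' := fun a b ↦ by
        simp [Algebra.TensorProduct.tmul_mul_tmul, AddMonoidAlgebra.single_mul_single] }

lemma monoidCoaction_single (φ : C →+ M) (c : C) :
    monoidCoaction k φ (AddMonoidAlgebra.single c 1) =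
      AddMonoidAlgebra.single (φ c) 1 ⊗ₜ AddMonoidAlgebra.single c 1 := by
  simp [monoidCoaction, AddMonoidAlgebra.lift_single]

variable {k} in
lemma monoidAlg_algHom_ext {B : Type u} [CommRing B] [Algebra k B]
    {f g : AddMonoidAlgebra k C →ₐ[k] B}
    (h : ∀ c, f (AddMonoidAlgebra.single c 1) = g (AddMonoidAlgebra.single c 1)) : f = g :=
  AddMonoidAlgebra.algHom_ext h (by ext)

/-- The coaction as an action in the opposite category of algebras. -/
noncomputable abbrev monoidOpModObj (φ : C →+ M) :
    ModObj (op (CommAlgCat.of k (AddMonoidAlgebra k M)))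
    (op (CommAlgCat.of k (AddMonoidAlgebra k C))) where
  smul := (CommAlgCat.ofHom (monoidCoaction k φ)).op
  one_smul := by
    apply Quiver.Hom.unop_inj
    ext : 1
    refine monoidAlg_algHom_ext fun c ↦ ?_
    change Algebra.TensorProduct.map (Bialgebra.counitAlgHom k (AddMonoidAlgebra k M))
      (AlgHom.id k (AddMonoidAlgebra k C)) (monoidCoaction k φ _) = (1 : k) ⊗ₜ[k] _
    rw [monoidCoaction_single, Algebra.TensorProduct.map_tmul]
    simp
  mul_smul := by
    apply Quiver.Hom.unop_inj
    ext : 1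
    refine monoidAlg_algHom_ext fun c ↦ ?_
    change Algebra.TensorProduct.map (Bialgebra.comulAlgHom k (AddMonoidAlgebra k M))
      (AlgHom.id k (AddMonoidAlgebra k C)) (monoidCoaction k φ _) =
        (Algebra.TensorProduct.assoc k k k _ _ _).symm
          (Algebra.TensorProduct.map (AlgHom.id k _) (monoidCoaction k φ) (monoidCoaction k φ _))
    rw [monoidCoaction_single, Algebra.TensorProduct.map_tmul, Algebra.TensorProduct.map_tmul,
      monoidCoaction_single]
    simp

/-- The action of the torus with character group `ℤᵐ` on `Spec k[C]` for a monoid `C` over `ℤᵐ`. -/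
noncomputable abbrev monoidModObj {m : ℕ} (φ : C →+ (Fin m → ℤ)) :
    ModObj (torus k m) (algOver (.of k) (AddMonoidAlgebra k C)) :=
  letI := monoidOpModObj k φ
  letI : (algSpec (.of k)).LaxMonoidal := (braidedAlgSpec (R := .of k)).toLaxMonoidal
  mapModObj (algSpec (.of k)) (op (CommAlgCat.of k (AddMonoidAlgebra k (Fin m → ℤ))))
    (op (CommAlgCat.of k (AddMonoidAlgebra k C)))

/-- The action map of the torus on `Spec k[C]`. -/
noncomputable def monoidAct {m : ℕ} (φ : C →+ (Fin m → ℤ)) :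
    torus k m ⊗ algOver (.of k) (AddMonoidAlgebra k C) ⟶ algOver (.of k) (AddMonoidAlgebra k C) :=
  coactMap (R := .of k) (monoidCoaction k φ)

lemma monoidAct_one {m : ℕ} (φ : C →+ (Fin m → ℤ)) :
    η[torus k m] ▷ algOver (.of k) (AddMonoidAlgebra k C) ≫ monoidAct k φ =
      (λ_ (algOver (.of k) (AddMonoidAlgebra k C))).hom :=
  (monoidModObj k φ).one_smul

lemma monoidAct_mul {m : ℕ} (φ : C →+ (Fin m → ℤ)) :
    μ[torus k m] ▷ algOver (.of k) (AddMonoidAlgebra k C) ≫ monoidAct k φ =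
      (α_ (torus k m) (torus k m) (algOver (.of k) (AddMonoidAlgebra k C))).hom ≫
        torus k m ◁ monoidAct k φ ≫ monoidAct k φ :=
  (monoidModObj k φ).mul_smul

/-- The multiplication of the torus is its action on itself. -/
lemma torus_mul_eq {m : ℕ} : μ[torus k m] = monoidAct k (AddMonoidHom.id (Fin m → ℤ)) := by
  change coactMap (R := .of k) (Bialgebra.comulAlgHom k (AddMonoidAlgebra k (Fin m → ℤ))) =
    coactMap (R := .of k) _
  congr 1
  exact monoidAlg_algHom_ext fun c ↦ by simp [monoidCoaction_single]

/-- The morphism of spectra of monoid algebras. -/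
noncomputable abbrev monoidSpecMap (φ : C →+ C') : algOver (.of k) (AddMonoidAlgebra k C') ⟶
    algOver (.of k) (AddMonoidAlgebra k C) :=
  algMap (R := .of k) (monoidAlgMap k φ)

lemma monoidSpecMap_id : monoidSpecMap k (AddMonoidHom.id C) = 𝟙 _ := by
  refine Eq.trans ?_ ((algSpec (.of k)).map_id (op (CommAlgCat.of k _)))
  refine congrArg (fun f ↦ (algSpec (.of k)).map (CommAlgCat.ofHom f).op) ?_
  exact monoidAlg_algHom_ext fun c ↦ by simp

lemma monoidSpecMap_comp {C'' : Type} [AddCommMonoid C''] (φ : C →+ C') (ψ : C' →+ C'') :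
    monoidSpecMap k ψ ≫ monoidSpecMap k φ = monoidSpecMap k (ψ.comp φ) := by
  refine ((algSpec (.of k)).map_comp _ _).symm.trans ?_
  refine congrArg (fun f ↦ (algSpec (.of k)).map (CommAlgCat.ofHom f).op)
    (?_ : (monoidAlgMap k ψ).comp (monoidAlgMap k φ) = monoidAlgMap k (ψ.comp φ))
  exact monoidAlg_algHom_ext fun c ↦ by simp

lemma isIso_monoidSpecMap (e : C ≃+ C') : IsIso (monoidSpecMap k e.toAddMonoidHom) :=
  ⟨monoidSpecMap k e.symm.toAddMonoidHom, by
    rw [monoidSpecMap_comp, ← monoidSpecMap_id]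
    exact congrArg _ (AddMonoidHom.ext e.apply_symm_apply), by
    rw [monoidSpecMap_comp, ← monoidSpecMap_id]
    exact congrArg _ (AddMonoidHom.ext e.symm_apply_apply)⟩

lemma monoidAct_naturality {m m' : ℕ} {φ : C →+ (Fin m → ℤ)} {φ' : C' →+ (Fin m' → ℤ)}
    {α : (Fin m → ℤ) →+ (Fin m' → ℤ)} {β : C →+ C'} (h : φ'.comp β = α.comp φ) :
    ((monoidSpecMap k α : torus k m' ⟶ torus k m) ⊗ₘ monoidSpecMap k β) ≫ monoidAct k φ =
      monoidAct k φ' ≫ monoidSpecMap k β := by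
  refine (tensorHom_coactMap (R := .of k) (monoidCoaction k φ) (monoidAlgMap k α)
    (monoidAlgMap k β)).trans (Eq.trans ?_ (coactMap_comp_algMap (R := .of k) _ _).symm)
  congr 1
  refine monoidAlg_algHom_ext fun c ↦ ?_
  rw [AlgHom.comp_apply, AlgHom.comp_apply, monoidCoaction_single, Algebra.TensorProduct.map_tmul,
    monoidAlgMap_single, monoidAlgMap_single, monoidCoaction_single]
  congr 2
  exact (DFunLike.congr_fun h c).symm

lemma whiskerLeft_monoidAct {m : ℕ} {φ : C →+ (Fin m → ℤ)} {φ' : C' →+ (Fin m → ℤ)}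
    {β : C →+ C'} (h : φ'.comp β = φ) :
    (torus k m ◁ monoidSpecMap k β) ≫ monoidAct k φ = monoidAct k φ' ≫ monoidSpecMap k β := by
  rw [← monoidAct_naturality k (α := AddMonoidHom.id _) (show φ'.comp β = _ from h),
    ← id_tensorHom]
  have h1 : monoidSpecMap k (AddMonoidHom.id (Fin m → ℤ)) = 𝟙 (torus k m) := monoidSpecMap_id k
  exact congrArg (fun f ↦ (f ⊗ₘ _) ≫ _) h1.symm

end MonoidCoaction

/-! ### Toric atlases -/

section Atlas

open scoped MonObj ModObj

variable (k : Type u) [Field k] {m : ℕ}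

/-- The affine toric scheme `Spec k[C]` for a submonoid `C` of `ℤᵐ`. -/
noncomputable abbrev toricChart (C : AddSubmonoid (Fin m → ℤ)) : Over (Spec (.of k)) :=
  algOver (.of k) (AddMonoidAlgebra k C)

/-- The morphism `Spec k[C'] ⟶ Spec k[C]` for submonoids `C ≤ C'`. -/
noncomputable abbrev toricChartTrans {C C' : AddSubmonoid (Fin m → ℤ)} (h : C ≤ C') :
    toricChart k C' ⟶ toricChart k C :=
  monoidSpecMap k (AddSubmonoid.inclusion h)

/-- The morphism from the torus to `Spec k[C]`. -/
noncomputable abbrev torusToChart (C : AddSubmonoid (Fin m → ℤ)) : torus k m ⟶ toricChart k C :=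
  monoidSpecMap k C.subtype

/-- The action of the torus on `Spec k[C]`. -/
noncomputable abbrev toricChartAct (C : AddSubmonoid (Fin m → ℤ)) :
    torus k m ⊗ toricChart k C ⟶ toricChart k C :=
  monoidAct k C.subtype

lemma whiskerLeft_toricChartTrans {C C' : AddSubmonoid (Fin m → ℤ)} (h : C ≤ C') :
    torus k m ◁ toricChartTrans k h ≫ toricChartAct k C =
      toricChartAct k C' ≫ toricChartTrans k h :=
  whiskerLeft_monoidAct k (β := AddSubmonoid.inclusion h) (φ' := C'.subtype) rfl

lemma whiskerLeft_torusToChart (C : AddSubmonoid (Fin m → ℤ)) :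
    torus k m ◁ torusToChart k C ≫ toricChartAct k C = μ[torus k m] ≫ torusToChart k C := by
  rw [torus_mul_eq]
  exact whiskerLeft_monoidAct k (β := C.subtype) (φ' := AddMonoidHom.id _) rfl

/-- An atlas of a scheme `Y` over `k` by affine toric schemes `Spec k[Cᵢ]` with `Cᵢ` in the
character group `ℤᵐ`, one of which is the torus itself: any two charts intersect in a third one, in
a way that is compatible with the inclusions of submonoids. -/
structure ToricAtlas (m : ℕ) (Y : Over (Spec (.of k))) where
  /-- the index set -/
  I : Type
  /-- the monoids of characters that extend to the charts -/
  C : I → AddSubmonoid (Fin m → ℤ)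
  /-- the charts -/
  chart (i : I) : toricChart k (C i) ⟶ Y
  isOpenImmersion (i : I) : IsOpenImmersion (chart i).left
  covers (y : Y.left) : ∃ i, y ∈ Set.range (chart i).left
  overlap (i j : I) : ∃ (l : I) (hi : C i ≤ C l) (hj : C j ≤ C l),
    toricChartTrans k hi ≫ chart i = chart l ∧ toricChartTrans k hj ≫ chart j = chart l ∧
      Set.range (chart i).left ∩ Set.range (chart j).left ⊆ Set.range (chart l).left
  /-- the chart given by the torus -/
  base : I
  base_eq_top : C base = ⊤

variable {k} {Y : Over (Spec (.of k))} (𝒯 : ToricAtlas k m Y)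

namespace ToricAtlas

instance (i : 𝒯.I) : IsOpenImmersion (𝒯.chart i).left := 𝒯.isOpenImmersion i

lemma whiskerLeft_hom_ext (G : Over (Spec (.of k))) {Z : Over (Spec (.of k))} {a b : G ⊗ Y ⟶ Z}
    (h : ∀ i, G ◁ 𝒯.chart i ≫ a = G ◁ 𝒯.chart i ≫ b) : a = b :=
  Over.OverMorphism.ext (MultiProj.whiskerLeft_hom_ext G _ 𝒯.chart 𝒯.covers
    fun i ↦ congrArg (fun f ↦ f.left) (h i))

/-- The open cover of `T × Y` given by the charts of `Y`. -/
noncomputable def prodCover : (torus k m ⊗ Y).left.OpenCover :=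
  overCover (fun i ↦ torus k m ⊗ toricChart k (𝒯.C i)) (fun i ↦ torus k m ◁ 𝒯.chart i)
    (exists_mem_range_whiskerLeft _ _ 𝒯.chart 𝒯.covers)

/-- The actions on two charts agree on their intersection, where both are the action on a third
chart. -/
lemma act_compatible (i j : 𝒯.I) :
    pullback.fst (torus k m ◁ 𝒯.chart i).left (torus k m ◁ 𝒯.chart j).left ≫
        (toricChartAct k (𝒯.C i) ≫ 𝒯.chart i).left =
      pullback.snd (torus k m ◁ 𝒯.chart i).left (torus k m ◁ 𝒯.chart j).left ≫
        (toricChartAct k (𝒯.C j) ≫ 𝒯.chart j).left := by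
  obtain ⟨l, hi, hj, h1, h2, h3⟩ := 𝒯.overlap i j
  have hmem (l : 𝒯.I) (x : (torus k m ⊗ Y).left) : x ∈ Set.range (torus k m ◁ 𝒯.chart l).left ↔
      (snd (torus k m) Y).left x ∈ Set.range (𝒯.chart l).left := by
    constructor
    · rintro ⟨z, rfl⟩
      exact ⟨(snd (torus k m) _).left z, (congrArg (fun f ↦ f.left z)
        (whiskerLeft_snd (torus k m) (𝒯.chart l))).symm⟩
    · rintro ⟨z, hz⟩
      obtain ⟨y, hy, -⟩ := Scheme.exists_preimage_of_isPullback
        (isPullback_whiskerLeft (torus k m) (𝒯.chart l)) x z hz.symm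
      exact ⟨y, hy⟩
  have hw (i : 𝒯.I) (hi : 𝒯.C i ≤ 𝒯.C l) (h : toricChartTrans k hi ≫ 𝒯.chart i = 𝒯.chart l) :
      torus k m ◁ toricChartTrans k hi ≫ torus k m ◁ 𝒯.chart i = torus k m ◁ 𝒯.chart l := by
    rw [← MonoidalCategory.whiskerLeft_comp, h]
  have hwi : (torus k m ◁ toricChartTrans k hi).left ≫ (torus k m ◁ 𝒯.chart i).left = _ :=
    congrArg (fun f ↦ f.left) (hw i hi h1)
  have hwj : (torus k m ◁ toricChartTrans k hj).left ≫ (torus k m ◁ 𝒯.chart j).left = _ :=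
    congrArg (fun f ↦ f.left) (hw j hj h2)
  have : IsOpenImmersion (torus k m ◁ toricChartTrans k hi).left := by
    have : IsOpenImmersion ((torus k m ◁ toricChartTrans k hi).left ≫
        (torus k m ◁ 𝒯.chart i).left) := by rw [hwi]; infer_instance
    exact .of_comp _ (torus k m ◁ 𝒯.chart i).left
  have hp : IsPullback (torus k m ◁ toricChartTrans k hi).left
      (torus k m ◁ toricChartTrans k hj).left (torus k m ◁ 𝒯.chart i).left
      (torus k m ◁ 𝒯.chart j).left := by
    refine isPullback_of_range_eq (hwi.trans hwj.symm) ?_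
    rw [hwi]
    rintro x ⟨hxi, hxj⟩
    rw [hmem] at *
    exact h3 ⟨hxi, hxj⟩
  rw [← cancel_epi hp.isoPullback.hom, hp.isoPullback_hom_fst_assoc, hp.isoPullback_hom_snd_assoc]
  have key (i : 𝒯.I) (hi : 𝒯.C i ≤ 𝒯.C l) (h : toricChartTrans k hi ≫ 𝒯.chart i = 𝒯.chart l) :
      torus k m ◁ toricChartTrans k hi ≫ toricChartAct k (𝒯.C i) ≫ 𝒯.chart i =
        toricChartAct k (𝒯.C l) ≫ 𝒯.chart l := by
    rw [← Category.assoc, whiskerLeft_toricChartTrans, Category.assoc, h]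
  exact (congrArg (fun f ↦ f.left) (key i hi h1)).trans
    (congrArg (fun f ↦ f.left) (key j hj h2)).symm

lemma prodCover_hom_ext {Z : Scheme.{u}} {a b : (torus k m ⊗ Y).left ⟶ Z}
    (h : ∀ i, (torus k m ◁ 𝒯.chart i).left ≫ a = (torus k m ◁ 𝒯.chart i).left ≫ b) : a = b :=
  𝒯.prodCover.hom_ext _ _ h

/-- The action of the torus, glued from the actions on the charts. -/
noncomputable def actLeft : (torus k m ⊗ Y).left ⟶ Y.left :=
  𝒯.prodCover.glueMorphisms (fun i ↦ (toricChartAct k (𝒯.C i) ≫ 𝒯.chart i).left) 𝒯.act_compatible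

lemma chart_actLeft (i : 𝒯.I) : (torus k m ◁ 𝒯.chart i).left ≫ 𝒯.actLeft =
    (toricChartAct k (𝒯.C i) ≫ 𝒯.chart i).left :=
  𝒯.prodCover.ι_glueMorphisms _ 𝒯.act_compatible i

/-- The action map of the torus on `Y`. -/
noncomputable def act : torus k m ⊗ Y ⟶ Y :=
  Over.homMk 𝒯.actLeft (𝒯.prodCover_hom_ext fun i ↦ by
    rw [← Category.assoc, chart_actLeft]
    exact (Over.w _).trans (Over.w _).symm)

lemma chart_act (i : 𝒯.I) :
    torus k m ◁ 𝒯.chart i ≫ 𝒯.act = toricChartAct k (𝒯.C i) ≫ 𝒯.chart i :=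
  Over.OverMorphism.ext (𝒯.chart_actLeft i)

/-- The action of the torus on a scheme with a toric atlas. -/
noncomputable abbrev modObj : ModObj (torus k m) Y where
  smul := 𝒯.act
  one_smul := by
    refine 𝒯.whiskerLeft_hom_ext _ fun i ↦ ?_
    change _ ◁ 𝒯.chart i ≫ η[torus k m] ▷ Y ≫ 𝒯.act = _ ◁ 𝒯.chart i ≫ (λ_ Y).hom
    rw [whisker_exchange_assoc, chart_act, ← Category.assoc, monoidAct_one,
      leftUnitor_naturality]
  mul_smul := by
    refine 𝒯.whiskerLeft_hom_ext _ fun i ↦ ?_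
    change _ ◁ 𝒯.chart i ≫ μ[torus k m] ▷ Y ≫ 𝒯.act =
      _ ◁ 𝒯.chart i ≫ (α_ _ _ Y).hom ≫ torus k m ◁ 𝒯.act ≫ 𝒯.act
    rw [whisker_exchange_assoc, chart_act, ← Category.assoc, monoidAct_mul,
      associator_naturality_right_assoc, ← MonoidalCategory.whiskerLeft_comp_assoc, chart_act,
      MonoidalCategory.whiskerLeft_comp_assoc, chart_act]
    simp only [Category.assoc]

/-- The inclusion of the torus. -/
noncomputable def embed : torus k m ⟶ Y := torusToChart k (𝒯.C 𝒯.base) ≫ 𝒯.chart 𝒯.base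

lemma isOpenImmersion_embed : IsOpenImmersion 𝒯.embed.left := by
  have h : IsIso (torusToChart k (𝒯.C 𝒯.base)) := by
    exact isIso_monoidSpecMap k (AddEquiv.ofBijective (𝒯.C 𝒯.base).subtype
      ⟨Subtype.val_injective, fun x ↦ ⟨⟨x, by rw [𝒯.base_eq_top]; trivial⟩, rfl⟩⟩)
  have : IsIso (torusToChart k (𝒯.C 𝒯.base)).left :=
    inferInstanceAs (IsIso ((Over.forget _).map (torusToChart k (𝒯.C 𝒯.base))))
  exact MorphismProperty.comp_mem @IsOpenImmersion _ _
    (inferInstanceAs (IsOpenImmersion (torusToChart k (𝒯.C 𝒯.base)).left))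
    (𝒯.isOpenImmersion 𝒯.base)

/-- The toric structure given by an atlas. -/
noncomputable def toricStructure : ToricStructure m Y where
  action := 𝒯.modObj
  embed := 𝒯.embed
  isOpenImmersion := 𝒯.isOpenImmersion_embed
  equivariant := by
    change _ = torus k m ◁ (torusToChart k (𝒯.C 𝒯.base) ≫ 𝒯.chart 𝒯.base) ≫ 𝒯.act
    rw [MonoidalCategory.whiskerLeft_comp_assoc, chart_act, ← Category.assoc,
      whiskerLeft_torusToChart, embed, Category.assoc]

end ToricAtlas

end Atlas

/-! ### Toric morphisms -/

section ToricHom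

open scoped MonObj ModObj
open Opposite

section General

variable {𝒞 : Type*} [Category 𝒞] [CartesianMonoidalCategory 𝒞]
  {S T U X Y Z : 𝒞} [MonObj S] [MonObj T] [MonObj U] [ModObj S X] [ModObj T Y] [ModObj U Z]

/-- If a homomorphism factors through `φ` with `φ ⊗ φ` an epimorphism, the second factor is a
homomorphism. -/
lemma isMonHom_of_comp (φ : S ⟶ T) [IsMonHom φ] (ψ : T ⟶ U) [IsMonHom (φ ≫ ψ)] [Epi (φ ⊗ₘ φ)] :
    IsMonHom ψ where
  one_hom := by
    have h : η ≫ φ ≫ ψ = η := IsMonHom.one_hom (φ ≫ ψ)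
    rwa [← Category.assoc, IsMonHom.one_hom] at h
  mul_hom := by
    rw [← cancel_epi (φ ⊗ₘ φ)]
    have h : μ ≫ φ ≫ ψ = ((φ ≫ ψ) ⊗ₘ (φ ≫ ψ)) ≫ μ := IsMonHom.mul_hom (φ ≫ ψ)
    rw [← Category.assoc, IsMonHom.mul_hom, Category.assoc] at h
    rw [h, ← tensorHom_comp_tensorHom, Category.assoc]

lemma equivariant_of_comp {φ : S ⟶ T} {ψ : T ⟶ U} {p : X ⟶ Y} {g : Y ⟶ Z} [Epi (φ ⊗ₘ p)]
    (h₁ : γ[S, X] ≫ p = (φ ⊗ₘ p) ≫ γ[T, Y])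
    (h₂ : γ[S, X] ≫ p ≫ g = ((φ ≫ ψ) ⊗ₘ (p ≫ g)) ≫ γ[U, Z]) :
    γ[T, Y] ≫ g = (ψ ⊗ₘ g) ≫ γ[U, Z] := by
  rw [← cancel_epi (φ ⊗ₘ p), ← Category.assoc, ← h₁, Category.assoc, h₂,
    ← tensorHom_comp_tensorHom, Category.assoc]

end General

variable {k : Type u} [Field k]

/-- The factors of a toric morphism through a toric morphism `p` that is an epimorphism,
in a strong sense, are toric morphisms. -/
lemma isToricHom_of_comp {l m m' : ℕ} {X Y Z : Over (Spec (.of k))} {tX : ToricStructure m X}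
    {tY : ToricStructure m' Y} {tZ : ToricStructure l Z} {p : X ⟶ Y} {g : Y ⟶ Z}
    (φ : torus k m ⟶ torus k m') [IsMonHom φ] [Surjective φ.left] [Epi (φ ⊗ₘ φ)] [Epi (φ ⊗ₘ p)]
    (hφ : tX.embed ≫ p = φ ≫ tY.embed)
    (hp : letI := tX.action; letI := tY.action; γ[torus k m, X] ≫ p = (φ ⊗ₘ p) ≫ γ[torus k m', Y])
    (hf : IsToricHom tX tZ (p ≫ g)) : IsToricHom tY tZ g := by
  let _ := tX.action
  let _ := tY.action
  let _ := tZ.action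
  have := tZ.isOpenImmersion
  obtain ⟨χ, hχ, h1, h2⟩ := hf
  -- the restriction of `g` to the torus has image in the torus of `Z`, since `φ` is surjective
  have hr : Set.range (tY.embed ≫ g).left ⊆ Set.range tZ.embed.left := by
    rintro _ ⟨y, rfl⟩
    obtain ⟨x, rfl⟩ := φ.left.surjective y
    have h3 : φ ≫ tY.embed ≫ g = χ ≫ tZ.embed := by
      rw [← h1, ← Category.assoc, ← hφ, Category.assoc]
    exact ⟨χ.left x, (congrArg (fun f ↦ f.left x) h3).symm⟩
  have hfac := IsOpenImmersion.lift_fac tZ.embed.left (tY.embed ≫ g).left hr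
  let ψ : torus k m' ⟶ torus k l := Over.homMk (IsOpenImmersion.lift tZ.embed.left _ hr) <| by
    rw [← Over.w tZ.embed, ← Category.assoc, hfac]
    exact Over.w _
  have hψ : ψ ≫ tZ.embed = tY.embed ≫ g := Over.OverMorphism.ext hfac
  have : Mono tZ.embed := Over.mono_of_mono_left _
  have hφψ : φ ≫ ψ = χ := by
    rw [← cancel_mono tZ.embed, ← h1, Category.assoc, hψ, ← Category.assoc, ← Category.assoc, hφ]
  subst hφψ
  exact ⟨ψ, isMonHom_of_comp φ ψ, hψ.symm, equivariant_of_comp hp (by rw [h2])⟩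

/-- The homomorphism of tori that is dual to a homomorphism of character groups. -/
noncomputable def torusMap {m m' : ℕ} (α : (Fin m' → ℤ) →+ (Fin m → ℤ)) :
    torus k m ⟶ torus k m' :=
  monoidSpecMap k α

lemma torusMap_act {m m' : ℕ} {α : (Fin m' → ℤ) →+ (Fin m → ℤ)} {C : AddSubmonoid (Fin m → ℤ)}
    {C' : AddSubmonoid (Fin m' → ℤ)} {β : C' →+ C} (h : C.subtype.comp β = α.comp C'.subtype) :
    toricChartAct k C ≫ monoidSpecMap k β =
      (torusMap α ⊗ₘ monoidSpecMap k β) ≫ toricChartAct k C' :=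
  (monoidAct_naturality k h).symm

lemma torusToChart_comp {m m' : ℕ} {α : (Fin m' → ℤ) →+ (Fin m → ℤ)} {C : AddSubmonoid (Fin m → ℤ)}
    {C' : AddSubmonoid (Fin m' → ℤ)} {β : C' →+ C} (h : C.subtype.comp β = α.comp C'.subtype) :
    torusToChart k C ≫ monoidSpecMap k β = torusMap α ≫ torusToChart k C' :=
  (monoidSpecMap_comp k β C.subtype).trans
    ((congrArg _ h).trans (monoidSpecMap_comp k C'.subtype α).symm)

lemma torusToChart_trans {m : ℕ} {C C' : AddSubmonoid (Fin m → ℤ)} (h : C ≤ C') :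
    torusToChart k C' ≫ toricChartTrans k h = torusToChart k C :=
  monoidSpecMap_comp k (AddSubmonoid.inclusion h) C'.subtype

lemma isMonHom_torusMap {m m' : ℕ} (α : (Fin m' → ℤ) →+ (Fin m → ℤ)) :
    IsMonHom (torusMap (k := k) α) where
  one_hom := by
    let _ : (algSpec (.of k)).LaxMonoidal := (braidedAlgSpec (R := .of k)).toLaxMonoidal
    change (Functor.LaxMonoidal.ε (algSpec (.of k)) ≫ (algSpec (.of k)).map
      η[op (CommAlgCat.of k (AddMonoidAlgebra k (Fin m → ℤ)))]) ≫ (algSpec (.of k)).map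
        (CommAlgCat.ofHom (monoidAlgMap k α)).op = Functor.LaxMonoidal.ε (algSpec (.of k)) ≫
          (algSpec (.of k)).map η[op (CommAlgCat.of k (AddMonoidAlgebra k (Fin m' → ℤ)))]
    refine (Category.assoc _ _ _).trans (congrArg _ ?_)
    rw [← Functor.map_comp]
    congr 1
    apply Quiver.Hom.unop_inj
    ext : 1
    exact monoidAlg_algHom_ext fun c ↦ by
      change Bialgebra.counitAlgHom k (AddMonoidAlgebra k (Fin m → ℤ)) (monoidAlgMap k α _) =
        Bialgebra.counitAlgHom k (AddMonoidAlgebra k (Fin m' → ℤ)) _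
      rw [monoidAlgMap_single]
      simp
  mul_hom := by
    rw [torus_mul_eq, torus_mul_eq]
    exact (monoidAct_naturality k (α := α) (β := α) rfl).symm

namespace ToricAtlas

variable {m m' : ℕ} {X Y : Over (Spec (.of k))} (𝒯 : ToricAtlas k m X) (𝒯' : ToricAtlas k m' Y)

lemma torusToChart_chart (i : 𝒯.I) : torusToChart k (𝒯.C i) ≫ 𝒯.chart i = 𝒯.embed := by
  obtain ⟨l, hi, hj, h1, h2, -⟩ := 𝒯.overlap i 𝒯.base
  have key (i : 𝒯.I) (hi : 𝒯.C i ≤ 𝒯.C l) (h : toricChartTrans k hi ≫ 𝒯.chart i = 𝒯.chart l) :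
      torusToChart k (𝒯.C i) ≫ 𝒯.chart i = torusToChart k (𝒯.C l) ≫ 𝒯.chart l := by
    rw [← h, ← Category.assoc, torusToChart_trans]
  exact (key i hi h1).trans (key _ hj h2).symm

variable {𝒯 𝒯'} {p : X ⟶ Y} {α : (Fin m' → ℤ) →+ (Fin m → ℤ)}
  (h : ∀ i, ∃ (j : 𝒯'.I) (β : 𝒯'.C j →+ 𝒯.C i), (𝒯.C i).subtype.comp β = α.comp (𝒯'.C j).subtype ∧
    𝒯.chart i ≫ p = monoidSpecMap k β ≫ 𝒯'.chart j)

include h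

lemma embed_comp : 𝒯.embed ≫ p = torusMap α ≫ 𝒯'.embed := by
  obtain ⟨j, β, hβ, hp⟩ := h 𝒯.base
  rw [embed, Category.assoc, hp, ← Category.assoc, torusToChart_comp hβ, Category.assoc,
    𝒯'.torusToChart_chart]

/-- The equivariance can be checked on charts, where it is the compatibility of the gradings of the
monoid algebras. -/
lemma act_comp :
    𝒯.act ≫ p = (torusMap α ⊗ₘ p) ≫ 𝒯'.act := by
  refine 𝒯.whiskerLeft_hom_ext _ fun i ↦ ?_
  obtain ⟨j, β, hβ, hp⟩ := h i
  rw [← Category.assoc, chart_act, Category.assoc, hp, ← Category.assoc,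
    torusMap_act hβ, Category.assoc, ← chart_act, ← Category.assoc, ← Category.assoc,
    ← id_tensorHom, ← id_tensorHom, tensorHom_comp_tensorHom, tensorHom_comp_tensorHom, hp,
    Category.id_comp, Category.comp_id]

lemma isToricHom : IsToricHom 𝒯.toricStructure 𝒯'.toricStructure p :=
  ⟨torusMap α, isMonHom_torusMap α, embed_comp h, act_comp h⟩

end ToricAtlas

end ToricHom

/-! ### Relevant monomials -/

section RelevantMonomials

open MvPolynomial

variable (k : Type u) [Field k] {D : Type u} [AddCommGroup D] [DecidableEq D] {n : ℕ}
  (w : Fin n → D)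

lemma monomial_mem_polyGrading (u : Fin n →₀ ℕ) (r : k) :
    monomial u r ∈ polyGrading k w (Finsupp.weight w u) :=
  isWeightedHomogeneous_monomial w u r rfl

variable {k w}

lemma weight_eq_of_mem_support {d : D} {a : MvPolynomial (Fin n) k} (ha : a ∈ polyGrading k w d)
    {u : Fin n →₀ ℕ} (hu : u ∈ a.support) : Finsupp.weight w u = d :=
  ha (mem_support_iff.mp hu)

lemma weight_mem_closure (u : Fin n →₀ ℕ) :
    Finsupp.weight w u ∈ AddSubgroup.closure (Set.range w) := by
  rw [Finsupp.weight_apply]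
  exact sum_mem fun i _ ↦ nsmul_mem (AddSubgroup.subset_closure (Set.mem_range_self i)) _

/-- If the support of `k[T₁,…,Tₙ]` generates the grading group, so do the degrees of the
variables. -/
lemma closure_range_eq_top (hw : AddSubgroup.closure {d : D | polyGrading k w d ≠ ⊥} = ⊤) :
    AddSubgroup.closure (Set.range w) = ⊤ := by
  rw [eq_top_iff, ← hw, AddSubgroup.closure_le]
  intro d hd
  obtain ⟨a, ha, ha0⟩ := Submodule.exists_mem_ne_zero_of_ne_bot hd
  obtain ⟨u, hu⟩ := support_nonempty.mpr ha0
  rw [← weight_eq_of_mem_support ha hu]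
  exact weight_mem_closure u

lemma finiteIndex_of_nsmul_mem (hw : AddSubgroup.closure (Set.range w) = ⊤) {K : AddSubgroup D}
    (hK : ∀ i, ∃ N : ℕ, 0 < N ∧ N • w i ∈ K) : K.FiniteIndex := by
  have : AddGroup.FG D := ⟨⟨(Set.finite_range w).toFinset, by simpa using hw⟩⟩
  have : AddGroup.FG (D ⧸ K) := QuotientAddGroup.fg K
  have ht : IsAddTorsion (D ⧸ K) := by
    intro x
    obtain ⟨d, rfl⟩ := QuotientAddGroup.mk_surjective x
    have hd : d ∈ AddSubgroup.closure (Set.range w) := by rw [hw]; trivial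
    induction hd using AddSubgroup.closure_induction with
    | mem x hx =>
      obtain ⟨i, rfl⟩ := hx
      obtain ⟨N, hN, hN'⟩ := hK i
      rw [isOfFinAddOrder_iff_nsmul_eq_zero]
      exact ⟨N, hN, (QuotientAddGroup.eq_zero_iff _).mpr hN'⟩
    | zero => exact IsOfFinAddOrder.zero
    | add x y _ _ hx hy => exact hx.add hy
    | neg x _ hx => exact hx.neg
  have : Finite (D ⧸ K) := AddCommGroup.finite_of_fg_isAddTorsion _ ht
  exact AddSubgroup.finiteIndex_of_finite_quotient

/-- The degrees of all monomials that divide some power of `T ^ e` are degrees of units. -/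
lemma weight_mem_unitDegrees {e u : Fin n →₀ ℕ} {N : ℕ} (h : u ≤ N • e) :
    Finsupp.weight w u ∈
      unitDegrees (polyGrading k w) (monomial e (1 : k)) (Finsupp.weight w e) := by
  refine mem_unitDegrees_of_mul (n := 0) (m := N) (a := monomial u 1) (b := monomial (N • e - u) 1)
    ?_ ?_
  · simpa using monomial_mem_polyGrading k w u 1
  · rw [monomial_mul, add_tsub_cancel_of_le h, monomial_pow]
    simp

variable (k w) in
/-- The exponents of relevant monomials. -/
abbrev RelExp : Type := {e : Fin n →₀ ℕ // IsRelevant (polyGrading k w) (monomial e (1 : k))}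

/-- The relevant element given by a relevant monomial. -/
noncomputable def RelExp.rel (e : RelExp k w) : Rel (polyGrading k w) := ⟨monomial e.1 1, e.2⟩

/-- The product of two relevant monomials. -/
noncomputable def RelExp.add (e e' : RelExp k w) : RelExp k w :=
  ⟨e.1 + e'.1, by
    have := e.2.mul (monomial_mem_polyGrading k w e'.1 1)
    rwa [monomial_mul, one_mul] at this⟩

lemma RelExp.add_val (e e' : RelExp k w) : (e.add e').rel.val = e.rel.val * e'.rel.val := by
  change monomial (e.1 + e'.1) (1 : k) = monomial e.1 1 * monomial e'.1 1
  rw [monomial_mul, one_mul]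

lemma RelExp.add_le_left (e e' : RelExp k w) : (e.add e').rel ≤ e.rel :=
  ⟨_, _, monomial_mem_polyGrading k w e'.1 1, e.add_val e'⟩

lemma RelExp.add_le_right (e e' : RelExp k w) : (e.add e').rel ≤ e'.rel :=
  ⟨_, _, monomial_mem_polyGrading k w e.1 1, by rw [add_val, mul_comm]; rfl⟩

lemma isRelevant_monomial_of_closure (hw : AddSubgroup.closure (Set.range w) = ⊤) (e : Fin n →₀ ℕ)
    (h : ∀ i, ∃ N : ℕ, 0 < N ∧ N • w i ∈ AddSubgroup.closure
      (unitDegrees (polyGrading k w) (monomial e (1 : k)) (Finsupp.weight w e))) :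
    IsRelevant (polyGrading k w) (monomial e (1 : k)) :=
  ⟨_, monomial_mem_polyGrading k w e 1, finiteIndex_of_nsmul_mem hw h⟩

/-- The product of all variables is relevant, as the variables are units in its localization. -/
lemma isRelevant_prod (hw : AddSubgroup.closure (Set.range w) = ⊤) :
    IsRelevant (polyGrading k w) (monomial (Finsupp.equivFunOnFinite.symm 1) (1 : k)) := by
  refine isRelevant_monomial_of_closure hw _ fun i ↦ ⟨1, one_pos, AddSubgroup.subset_closure ?_⟩
  have h := weight_mem_unitDegrees (k := k) (w := w) (e := Finsupp.equivFunOnFinite.symm 1)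
    (u := Finsupp.single i 1) (N := 1) (fun j ↦ by
      rw [Finsupp.single_apply]; split_ifs <;> simp)
  simpa [Finsupp.weight_single] using h

/-- A homogeneous polynomial outside a prime ideal has a monomial outside the prime ideal. -/
lemma exists_monomial_notMem {P : Ideal (MvPolynomial (Fin n) k)} {a : MvPolynomial (Fin n) k}
    {d : D} (ha : a ∈ polyGrading k w d) (haP : a ∉ P) :
    ∃ u, Finsupp.weight w u = d ∧ monomial u (1 : k) ∉ P := by
  by_contra! h
  refine haP ?_
  rw [a.as_sum]
  refine sum_mem fun u hu ↦ ?_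
  have := P.mul_mem_left (C (a.coeff u)) (h u (weight_eq_of_mem_support ha hu))
  rwa [C_mul_monomial, mul_one] at this

/-- The relevant locus is covered by the non-vanishing loci of relevant monomials: if `f` is
relevant, the divisors of powers of `f` whose degrees have finite index have monomials
that do not vanish at a given point. -/
lemma exists_relExp (hw : AddSubgroup.closure (Set.range w) = ⊤)
    (x : (relevantLocus (polyGrading k w)).toScheme) :
    ∃ e : RelExp k w, x ∈ Set.range (locusι e.rel) := by
  obtain ⟨f, hf⟩ := (mem_relevantLocus _).mp x.2
  set P := PrimeSpectrum.asIdeal ((relevantLocus (polyGrading k w)).ι x) with hP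
  have hprime : P.IsPrime := PrimeSpectrum.isPrime _
  choose d N n' m a b hd ha hb hab using fun i ↦ f.isRelevant.exists_data (w i)
  have haP (i) : a i ∉ P := fun h ↦ by
    have h1 := P.mul_mem_right (b i) h
    rw [hab] at h1
    exact hf (hprime.mem_of_pow_mem _ h1)
  -- `a i` divides a power of `f` and has degree `(N i + 1) • w i + n' i • d i`, where `f` has
  -- degree `d i`, so `(N i + 1) • w i` is a combination of the degrees of the monomials `T ^ u i`
  -- of `a i` and `T ^ v i` of `f`
  choose u hu huP using fun i ↦ exists_monomial_notMem (ha i) (haP i)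
  choose v hv hvP using fun i ↦ exists_monomial_notMem (hd i) hf
  let e : Fin n →₀ ℕ := ∑ i, (u i + v i)
  have heP : monomial e (1 : k) ∉ P := by
    have h1 : monomial e (1 : k) = ∏ i, (monomial (u i) 1 * monomial (v i) 1) := by
      simp only [monomial_mul, one_mul, e, monomial_sum_one]
    rw [h1, hprime.prod_mem_iff]
    rintro ⟨i, -, hi⟩
    exact (hprime.mem_or_mem hi).elim (huP i) (hvP i)
  have hle (i) : u i + v i ≤ 1 • e := by
    rw [one_smul]
    exact Finset.single_le_sum (f := fun i ↦ u i + v i) (fun _ _ ↦ zero_le) (Finset.mem_univ i)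
  refine ⟨⟨e, isRelevant_monomial_of_closure hw e fun i ↦ ⟨N i + 1, Nat.succ_pos _, ?_⟩⟩,
    mem_range_locusι.mpr heP⟩
  have h1 := AddSubgroup.subset_closure
    (weight_mem_unitDegrees (k := k) (w := w) (le_self_add.trans (hle i)))
  have h2 := AddSubgroup.subset_closure
    (weight_mem_unitDegrees (k := k) (w := w) (le_add_self.trans (hle i)))
  rw [hu] at h1
  rw [hv] at h2
  simpa using sub_mem h1 (nsmul_mem h2 (n' i))

end RelevantMonomials

/-! ### Localizations of the polynomial ring in the ring of Laurent polynomials -/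

section Laurent

open MvPolynomial

variable (k : Type u) [Field k] {n : ℕ}

/-- The inclusion of polynomials in Laurent polynomials. -/
noncomputable def toLaurent : MvPolynomial (Fin n) k →ₐ[k] AddMonoidAlgebra k (Fin n → ℤ) :=
  MvPolynomial.aeval (R := k) fun i : Fin n ↦
    (AddMonoidAlgebra.single (Pi.single i 1) 1 : AddMonoidAlgebra k (Fin n → ℤ))

/-- The exponent of a monomial as an element of the character group of the torus. -/
def expChar : (Fin n →₀ ℕ) →+ (Fin n → ℤ) where
  toFun u i := u i
  map_zero' := by ext; simp
  map_add' u v := by ext; simp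

lemma expChar_apply (u : Fin n →₀ ℕ) (i : Fin n) : expChar u i = u i := rfl

lemma expChar_injective : Function.Injective (expChar (n := n)) := fun u v h ↦ by
  ext i
  exact Nat.cast_injective (R := ℤ) (congrFun h i)

lemma exists_expChar_eq {c : Fin n → ℤ} (hc : 0 ≤ c) : ∃ u, expChar u = c :=
  ⟨Finsupp.equivFunOnFinite.symm fun i ↦ (c i).toNat, by
    ext i
    exact Int.toNat_of_nonneg (hc i)⟩

lemma toLaurent_monomial (u : Fin n →₀ ℕ) (r : k) :
    toLaurent k (monomial u r) = AddMonoidAlgebra.single (expChar u) r := by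
  have h (i : Fin n) (l : ℕ) :
      (AddMonoidAlgebra.single (Pi.single i 1) 1 : AddMonoidAlgebra k (Fin n → ℤ)) ^ l =
        AddMonoidAlgebra.single (expChar (Finsupp.single i l)) 1 := by
    rw [AddMonoidAlgebra.single_pow, one_pow]
    congr 1
    ext j
    by_cases hij : i = j
    · subst hij; simp [expChar_apply]
    · simp [expChar_apply, Ne.symm hij]
  rw [monomial_eq, map_mul, algHom_C, map_finsuppProd, Finsupp.prod]
  simp only [map_pow, toLaurent, aeval_X, h]
  have h2 (s : Finset (Fin n)) (g : Fin n → (Fin n → ℤ)) :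
      ∏ i ∈ s, (AddMonoidAlgebra.single (g i) 1 : AddMonoidAlgebra k (Fin n → ℤ)) =
        AddMonoidAlgebra.single (∑ i ∈ s, g i) 1 := by
    induction s using Finset.cons_induction with
    | empty => rfl
    | cons a s ha ih =>
      rw [Finset.prod_cons, Finset.sum_cons, ih, AddMonoidAlgebra.single_mul_single, one_mul]
  rw [h2, ← map_sum]
  have h3 : ∑ i ∈ u.support, Finsupp.single i (u i) = u := u.sum_single
  rw [h3, ← Algebra.smul_def, AddMonoidAlgebra.smul_single, smul_eq_mul, mul_one]

lemma toLaurent_injective : Function.Injective (toLaurent k (n := n)) := by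
  rw [injective_iff_map_eq_zero]
  intro a ha
  ext u
  have h : (toLaurent k a).coeff (expChar u) = a.coeff u := by
    conv_lhs => rw [a.as_sum]
    rw [map_sum]
    simp only [toLaurent_monomial]
    rw [AddMonoidAlgebra.coeff_sum, Finsupp.finsetSum_apply]
    simp only [AddMonoidAlgebra.coeff_single, Finsupp.single_apply, expChar_injective.eq_iff]
    simp only [Finset.sum_ite_eq', mem_support_iff]
    split_ifs with h
    · rfl
    · exact (notMem_support_iff.mp h).symm
  rw [← h, ha]
  simp

variable (e : Fin n →₀ ℕ)

lemma isUnit_toLaurent : IsUnit (toLaurent k (monomial e (1 : k))) := by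
  refine IsUnit.of_mul_eq_one (AddMonoidAlgebra.single (-expChar e) 1) ?_
  rw [toLaurent_monomial, AddMonoidAlgebra.single_mul_single, add_neg_cancel, one_mul]
  rfl

/-- The inclusion of the localization of the polynomial ring at a monomial in the ring of Laurent
polynomials. -/
noncomputable def awayToLaurent :
    Localization.Away (monomial e (1 : k)) →+* AddMonoidAlgebra k (Fin n → ℤ) :=
  Localization.awayLift (toLaurent k).toRingHom _ (isUnit_toLaurent k e)

lemma awayToLaurent_algebraMap (a : MvPolynomial (Fin n) k) :
    awayToLaurent k e (algebraMap _ _ a) = toLaurent k a :=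
  IsLocalization.Away.lift_eq _ (isUnit_toLaurent k e) a

lemma awayToLaurent_mk (a : MvPolynomial (Fin n) k) (l : ℕ) :
    awayToLaurent k e (Localization.mk a ⟨monomial e 1 ^ l, l, rfl⟩) =
      ∑ u ∈ a.support, AddMonoidAlgebra.single (expChar u - l • expChar e) (a.coeff u) := by
  have h1 := congrArg (awayToLaurent k e) (mk_mul_algebraMap (monomial e (1 : k)) a l)
  rw [map_mul, awayToLaurent_algebraMap, awayToLaurent_algebraMap, map_pow] at h1
  rw [← ((isUnit_toLaurent k e).pow l).mul_left_inj]
  refine h1.trans ?_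
  conv_lhs => rw [a.as_sum]
  rw [map_sum, Finset.sum_mul]
  refine Finset.sum_congr rfl fun u _ ↦ ?_
  rw [toLaurent_monomial, toLaurent_monomial, AddMonoidAlgebra.single_pow,
    AddMonoidAlgebra.single_mul_single, one_pow, mul_one, sub_add_cancel]

lemma awayToLaurent_injective : Function.Injective (awayToLaurent k e) := by
  rw [injective_iff_map_eq_zero]
  intro r hr
  obtain ⟨a, l, rfl⟩ := exists_eq_mk r
  have h1 := congrArg (awayToLaurent k e) (mk_mul_algebraMap (monomial e (1 : k)) a l)
  rw [map_mul, hr, zero_mul, awayToLaurent_algebraMap, eq_comm] at h1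
  rw [(injective_iff_map_eq_zero _).mp (toLaurent_injective k) a h1, Localization.mk_zero]

/-- The exponents of Laurent monomials that are elements of the localization at `T ^ e`. -/
def awayMonoid : AddSubmonoid (Fin n → ℤ) where
  carrier := {c | ∃ l : ℕ, 0 ≤ c + l • expChar e}
  zero_mem' := ⟨0, by simp⟩
  add_mem' := by
    rintro a b ⟨l, hl⟩ ⟨l', hl'⟩
    have h : a + b + (l + l') • expChar e = (a + l • expChar e) + (b + l' • expChar e) := by
      rw [add_smul]; abel
    exact ⟨l + l', h ▸ add_nonneg hl hl'⟩

variable {k}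

lemma mem_range_monoidAlgMap {C : Type} [AddCommMonoid C] {M : Type} [AddCommGroup M] (ψ : C →+ M)
    (c : C) (r : k) :
    AddMonoidAlgebra.single (ψ c) r ∈ (monoidAlgMap k ψ).toRingHom.range :=
  ⟨AddMonoidAlgebra.single c r, monoidAlgMap_single k ψ c r⟩

lemma range_monoidAlgMap_le {C : Type} [AddCommMonoid C] {M : Type} [AddCommGroup M] {ψ : C →+ M}
    {B : Subring (AddMonoidAlgebra k M)}
    (h : ∀ c (r : k), AddMonoidAlgebra.single (ψ c) r ∈ B) :
    (monoidAlgMap k ψ).toRingHom.range ≤ B := by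
  rintro _ ⟨x, rfl⟩
  change monoidAlgMap k ψ x ∈ B
  induction x using AddMonoidAlgebra.induction_linear with
  | zero => simp
  | add x y hx hy => rw [map_add]; exact add_mem hx hy
  | single c r => rw [monoidAlgMap_single]; exact h c r

lemma monoidAlgMap_injective {C : Type} [AddCommMonoid C] {M : Type} [AddCommMonoid M] {ψ : C →+ M}
    (hψ : Function.Injective ψ) : Function.Injective (monoidAlgMap k ψ) :=
  AddMonoidAlgebra.mapDomain_injective hψ

lemma range_awayToLaurent : (awayToLaurent k e).range =
    (monoidAlgMap k (awayMonoid e).subtype).toRingHom.range := by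
  apply le_antisymm
  · rintro _ ⟨r, rfl⟩
    obtain ⟨a, l, rfl⟩ := exists_eq_mk r
    rw [awayToLaurent_mk]
    refine sum_mem fun u _ ↦ mem_range_monoidAlgMap (awayMonoid e).subtype
      ⟨expChar u - l • expChar e, l, ?_⟩ _
    rw [sub_add_cancel]
    exact fun i ↦ Int.natCast_nonneg _
  · refine range_monoidAlgMap_le fun ⟨c, l, hl⟩ r ↦ ?_
    obtain ⟨u, hu⟩ := exists_expChar_eq hl
    refine ⟨Localization.mk (monomial u r) ⟨monomial e 1 ^ l, l, rfl⟩, ?_⟩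
    classical
    rw [awayToLaurent_mk, support_monomial]
    split_ifs with h
    · simp [h]
    · rw [Finset.sum_singleton, hu, coeff_monomial, if_pos rfl, add_sub_cancel_right]
      rfl

section Grading

variable {D : Type u} [AddCommGroup D] [DecidableEq D] (w : Fin n → D)

/-- The degree of a Laurent monomial. -/
def charDeg : (Fin n → ℤ) →+ D where
  toFun c := ∑ i, c i • w i
  map_zero' := by simp
  map_add' a b := by simp [add_smul, Finset.sum_add_distrib]

lemma charDeg_expChar (u : Fin n →₀ ℕ) : charDeg w (expChar u) = Finsupp.weight w u := by
  rw [Finsupp.weight_apply, Finsupp.sum_fintype _ _ (by simp)]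
  simp [charDeg, expChar_apply]

/-- A basis of the group of characters of degree zero. -/
lemma exists_charDeg_ker : ∃ (m : ℕ) (φ : (Fin m → ℤ) →+ (Fin n → ℤ)), Function.Injective φ ∧
    ∀ c, c ∈ Set.range φ ↔ charDeg w c = 0 := by
  obtain ⟨m, ⟨b⟩⟩ := Submodule.nonempty_basis_of_pid (Pi.basisFun ℤ (Fin n))
    (LinearMap.ker (charDeg w).toIntLinearMap)
  refine ⟨m, ((LinearMap.ker (charDeg w).toIntLinearMap).subtype.comp
    b.equivFun.symm.toLinearMap).toAddMonoidHom, ?_, fun c ↦ ?_⟩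
  · exact Subtype.val_injective.comp b.equivFun.symm.injective
  · constructor
    · rintro ⟨x, rfl⟩
      exact (b.equivFun.symm x).2
    · exact fun hc ↦
        ⟨b.equivFun ⟨c, hc⟩, congrArg Subtype.val (b.equivFun.symm_apply_apply ⟨c, hc⟩)⟩

variable {w} {m : ℕ} {φ : (Fin m → ℤ) →+ (Fin n → ℤ)} (hφ : ∀ c, c ∈ Set.range φ ↔ charDeg w c = 0)

include hφ in
/-- The degree zero part of the localization at `T ^ e` consists of the Laurent polynomials with
exponents of degree zero in the monoid of `T ^ e`. -/
lemma range_awayZeroToLaurent (d : D) (hd : Finsupp.weight w e = d) :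
    ((awayToLaurent k e).comp (algebraMap (Away (polyGrading k w) (monomial e (1 : k)))
      (Localization.Away (monomial e (1 : k))))).range =
    (monoidAlgMap k (φ.comp ((awayMonoid e).comap φ).subtype)).toRingHom.range := by
  have he : monomial e (1 : k) ∈ polyGrading k w d := hd ▸ monomial_mem_polyGrading k w e 1
  apply le_antisymm
  · rintro _ ⟨z, rfl⟩
    obtain ⟨l, a, ha, rfl⟩ := Away.mk_surjective (polyGrading k w) he z
    rw [RingHom.comp_apply, HomogeneousLocalization.algebraMap_apply, Away.val_mk, awayToLaurent_mk]
    refine sum_mem fun u hu ↦ ?_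
    obtain ⟨c, hc⟩ := (hφ (expChar u - l • expChar e)).mpr (by
      rw [map_sub, map_nsmul, charDeg_expChar, charDeg_expChar, weight_eq_of_mem_support ha hu, hd,
        sub_self])
    rw [← hc]
    refine mem_range_monoidAlgMap (φ.comp ((awayMonoid e).comap φ).subtype) ⟨c, l, ?_⟩ _
    rw [hc, sub_add_cancel]
    exact fun i ↦ Int.natCast_nonneg _
  · refine range_monoidAlgMap_le fun ⟨c, l, hl⟩ r ↦ ?_
    obtain ⟨u, hu⟩ := exists_expChar_eq hl
    have hu' : Finsupp.weight w u = l • d := by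
      rw [← charDeg_expChar, hu, map_add, (hφ _).mp ⟨c, rfl⟩, map_nsmul, charDeg_expChar, hd,
        zero_add]
    refine ⟨Away.mk (polyGrading k w) he l (monomial u r)
      (hu' ▸ monomial_mem_polyGrading k w u r), ?_⟩
    rw [RingHom.comp_apply, HomogeneousLocalization.algebraMap_apply, Away.val_mk]
    classical
    rw [awayToLaurent_mk, support_monomial]
    split_ifs with h
    · simp [h]
    · rw [Finset.sum_singleton, hu, coeff_monomial, if_pos rfl, add_sub_cancel_right]
      rfl

end Grading

end Laurent

section Equiv

/-- Rings that are embedded in a third one with the same image are isomorphic over it. -/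
lemma exists_ringEquiv_of_range_eq {B B' L : Type*} [CommRing B] [CommRing B'] [CommRing L]
    {α : B →+* L} {β : B' →+* L} (hα : Function.Injective α) (hβ : Function.Injective β)
    (h : α.range = β.range) : ∃ ε : B ≃+* B', ∀ b, β (ε b) = α b := by
  let eα := RingEquiv.ofBijective α.rangeRestrict
    ⟨fun x y h ↦ hα (congrArg Subtype.val h), α.rangeRestrict_surjective⟩
  let eβ := RingEquiv.ofBijective β.rangeRestrict
    ⟨fun x y h ↦ hβ (congrArg Subtype.val h), β.rangeRestrict_surjective⟩
  refine ⟨eα.trans ((RingEquiv.subringCongr h).trans eβ.symm), fun b ↦ ?_⟩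
  exact congrArg Subtype.val (eβ.apply_symm_apply (RingEquiv.subringCongr h (eα b)))

end Equiv

/-! ### The toric atlas of the relevant locus -/

section PolynomialAtlas

open MvPolynomial

variable {k : Type u} [Field k] {n : ℕ}

/-- The localization of the polynomial ring at `T ^ e` is a monoid algebra. -/
lemma exists_awayEquiv (e : Fin n →₀ ℕ) :
    ∃ ε : Localization.Away (monomial e (1 : k)) ≃+* AddMonoidAlgebra k (awayMonoid e),
      ∀ r, monoidAlgMap k (awayMonoid e).subtype (ε r) = awayToLaurent k e r :=
  exists_ringEquiv_of_range_eq (awayToLaurent_injective k e)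
    (monoidAlgMap_injective Subtype.val_injective) (range_awayToLaurent e)

lemma awayMonoid_mono {e e' : Fin n →₀ ℕ} (h : e ≤ e') : awayMonoid e ≤ awayMonoid e' := by
  rintro c ⟨l, hl⟩
  refine ⟨l, hl.trans (add_le_add_right (nsmul_le_nsmul_right (fun i ↦ ?_) l) c)⟩
  exact Int.ofNat_le.mpr (h i)

/-- The localization at the product of all variables is the ring of Laurent polynomials. -/
lemma awayMonoid_one : awayMonoid (Finsupp.equivFunOnFinite.symm 1 : Fin n →₀ ℕ) = ⊤ := by
  refine eq_top_iff.mpr fun c _ ↦ ⟨∑ i, (c i).natAbs, fun j ↦ ?_⟩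
  have h1 : (c j).natAbs ≤ ∑ i, (c i).natAbs :=
    Finset.single_le_sum (f := fun i ↦ (c i).natAbs) (fun _ _ ↦ zero_le) (Finset.mem_univ j)
  have h2 : (expChar (Finsupp.equivFunOnFinite.symm 1 : Fin n →₀ ℕ)) j = 1 := by
    simp [expChar_apply]
  have h3 : (c + (∑ i, (c i).natAbs) • expChar (Finsupp.equivFunOnFinite.symm 1 : Fin n →₀ ℕ)) j =
      c j + (∑ i, (c i).natAbs : ℕ) := by
    rw [Pi.add_apply, Pi.smul_apply, h2, nsmul_eq_mul, mul_one]
  refine (?_ : (0 : ℤ) ≤ _).trans_eq h3.symm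
  omega

variable {D : Type u} [AddCommGroup D] [DecidableEq D] {w : Fin n → D}

/-- The relevant locus over `k`. -/
noncomputable abbrev locusOverBase (k : Type u) [Field k] (w : Fin n → D) : Over (Spec (.of k)) :=
  (Over.map (specZeroToBase k w)).obj (locusOver (polyGrading k w))

namespace RelExp

/-- The inclusion of the localization at a relevant monomial in the ring of Laurent polynomials. -/
noncomputable def toLaurent (e : RelExp k w) :
    Localization.Away e.rel.val →+* AddMonoidAlgebra k (Fin n → ℤ) :=
  awayToLaurent k e.1

lemma toLaurent_algebraMap (e : RelExp k w) (a : MvPolynomial (Fin n) k) :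
    e.toLaurent (algebraMap _ _ a) = MultiProj.toLaurent k a :=
  awayToLaurent_algebraMap k e.1 a

lemma toLaurent_lift {e e' : RelExp k w} (h : e'.rel ≤ e.rel) (r : Localization.Away e.rel.val) :
    e'.toLaurent (Rel.lift h r) = e.toLaurent r := by
  have h1 : e'.toLaurent.comp (Rel.lift h) = e.toLaurent := by
    refine IsLocalization.ringHom_ext (Submonoid.powers e.rel.val) (RingHom.ext fun a ↦ ?_)
    rw [RingHom.comp_assoc, Rel.lift_comp]
    exact (e'.toLaurent_algebraMap a).trans (e.toLaurent_algebraMap a).symm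
  exact DFunLike.congr_fun h1 r

/-- The isomorphism of the localization at a relevant monomial with a monoid algebra. -/
noncomputable def equiv (e : RelExp k w) :
    Localization.Away e.rel.val ≃+* AddMonoidAlgebra k (awayMonoid e.1) :=
  (exists_awayEquiv e.1).choose

lemma equiv_spec (e : RelExp k w) (r : Localization.Away e.rel.val) :
    monoidAlgMap k (awayMonoid e.1).subtype (e.equiv r) = e.toLaurent r :=
  (exists_awayEquiv e.1).choose_spec r

lemma equiv_lift {e e' : RelExp k w} (h : e'.rel ≤ e.rel) (hC : awayMonoid e.1 ≤ awayMonoid e'.1)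
    (r : Localization.Away e.rel.val) :
    e'.equiv (Rel.lift h r) = monoidAlgMap k (AddSubmonoid.inclusion hC) (e.equiv r) := by
  apply monoidAlgMap_injective (k := k) (ψ := (awayMonoid e'.1).subtype) Subtype.val_injective
  rw [equiv_spec, toLaurent_lift, ← equiv_spec, ← AlgHom.comp_apply]
  refine DFunLike.congr_fun (monoidAlg_algHom_ext fun c ↦ ?_) _
  rw [AlgHom.comp_apply, monoidAlgMap_single, monoidAlgMap_single, monoidAlgMap_single]
  rfl

/-- The isomorphism of `Spec k[C]` with the spectrum of the localization at a relevant monomial. -/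
noncomputable def iso (e : RelExp k w) :
    Spec (.of (AddMonoidAlgebra k (awayMonoid e.1))) ⟶ Spec (.of (Localization.Away e.rel.val)) :=
  Spec.map (CommRingCat.ofHom e.equiv.toRingHom)

instance (e : RelExp k w) : IsIso e.iso := by
  have : IsIso (CommRingCat.ofHom e.equiv.toRingHom) :=
    inferInstanceAs (IsIso e.equiv.toCommRingCatIso.hom)
  unfold iso
  infer_instance

end RelExp

/-- The chart of the relevant locus given by a relevant monomial. -/
noncomputable def locusChart (e : RelExp k w) : toricChart k (awayMonoid e.1) ⟶ locusOverBase k w :=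
  Over.homMk (e.iso ≫ locusι e.rel) (by
    change (e.iso ≫ locusι e.rel) ≫ ((relevantLocus _).ι ≫ Spec.map _) ≫ Spec.map _ =
      Spec.map (CommRingCat.ofHom (algebraMap k (AddMonoidAlgebra k (awayMonoid e.1))))
    rw [Category.assoc, Category.assoc, locusι_comp_assoc, specAway, RelExp.iso, ← Spec.map_comp,
      ← Spec.map_comp, ← Spec.map_comp]
    congr 1
    refine CommRingCat.hom_ext (RingHom.ext fun r ↦ ?_)
    apply monoidAlgMap_injective (k := k) (ψ := (awayMonoid e.1).subtype) Subtype.val_injective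
    refine (e.equiv_spec _).trans ((e.toLaurent_algebraMap _).trans ?_)
    exact ((toLaurent k).commutes r).trans ((monoidAlgMap k _).commutes r).symm)

lemma range_locusChart (e : RelExp k w) :
    Set.range (locusChart e).left = Set.range (locusι e.rel) :=
  (Scheme.Hom.surjective e.iso).range_comp (locusι e.rel)

lemma range_locusι_add (e e' : RelExp k w) :
    Set.range (locusι e.rel) ∩ Set.range (locusι e'.rel) ⊆ Set.range (locusι (e.add e').rel) := by
  rintro x ⟨h, h'⟩
  rw [mem_range_locusι] at *
  rw [RelExp.add_val]
  exact fun hx ↦ ((PrimeSpectrum.isPrime ((relevantLocus _).ι x)).mem_or_mem hx).elim h h'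

lemma locusChart_trans {e e' : RelExp k w} (h : e'.rel ≤ e.rel)
    (hC : awayMonoid e.1 ≤ awayMonoid e'.1) :
    toricChartTrans k hC ≫ locusChart e = locusChart e' := by
  apply Over.OverMorphism.ext
  change Spec.map (CommRingCat.ofHom (monoidAlgMap k (AddSubmonoid.inclusion hC)).toRingHom) ≫
    e.iso ≫ locusι e.rel = e'.iso ≫ locusι e'.rel
  rw [← locusTrans_comp h, locusTrans, ← Category.assoc, ← Category.assoc, RelExp.iso, RelExp.iso,
    ← Spec.map_comp, ← Spec.map_comp]
  congr 2
  refine CommRingCat.hom_ext (RingHom.ext fun r ↦ ?_)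
  exact (RelExp.equiv_lift h hC r).symm

/-- The toric atlas of the relevant locus given by the relevant monomials. -/
noncomputable def locusAtlas (hw : AddSubgroup.closure (Set.range w) = ⊤) :
    ToricAtlas k n (locusOverBase k w) where
  I := RelExp k w
  C e := awayMonoid e.1
  chart := locusChart
  isOpenImmersion e := inferInstanceAs (IsOpenImmersion (e.iso ≫ locusι e.rel))
  covers x := by
    obtain ⟨e, he⟩ := exists_relExp hw x
    exact ⟨e, (range_locusChart e).ge he⟩
  overlap e e' := ⟨e.add e', awayMonoid_mono le_self_add, awayMonoid_mono le_add_self,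
    locusChart_trans (e.add_le_left e') _, locusChart_trans (e.add_le_right e') _, by
      rw [range_locusChart, range_locusChart, range_locusChart]
      exact range_locusι_add e e'⟩
  base := ⟨_, isRelevant_prod hw⟩
  base_eq_top := awayMonoid_one

lemma locusAtlas_embed (hw : AddSubgroup.closure (Set.range w) = ⊤) :
    (locusAtlas (k := k) hw).embed.left ≫ (relevantLocus (polyGrading k w)).ι =
      torusToAffine k := by
  let e : RelExp k w := ⟨_, isRelevant_prod hw⟩
  change (Spec.map (CommRingCat.ofHom (monoidAlgMap k (awayMonoid e.1).subtype).toRingHom) ≫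
    e.iso ≫ locusι e.rel) ≫ _ = Spec.map (CommRingCat.ofHom (toLaurent k).toRingHom)
  rw [Category.assoc, Category.assoc, locusι_comp, specAway, RelExp.iso, ← Spec.map_comp,
    ← Spec.map_comp]
  congr 1
  refine CommRingCat.hom_ext (RingHom.ext fun a ↦ ?_)
  exact (e.equiv_spec _).trans (e.toLaurent_algebraMap _)

end PolynomialAtlas

/-! ### The toric atlas of Proj -/

section ProjAtlas

open MvPolynomial

variable {k : Type u} [Field k] {n : ℕ} {D : Type u} [AddCommGroup D] [DecidableEq D]
  {w : Fin n → D} {m : ℕ} {φ : (Fin m → ℤ) →+ (Fin n → ℤ)} (hinj : Function.Injective φ)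
  (hφ : ∀ c, c ∈ Set.range φ ↔ charDeg w c = 0)

namespace RelExp

include hinj hφ in
lemma exists_zeroEquiv (e : RelExp k w) :
    ∃ ε : Away (polyGrading k w) e.rel.val ≃+* AddMonoidAlgebra k ((awayMonoid e.1).comap φ),
      ∀ z, monoidAlgMap k (φ.comp ((awayMonoid e.1).comap φ).subtype) (ε z) = e.toLaurent z.val :=
  exists_ringEquiv_of_range_eq
    (α := e.toLaurent.comp (algebraMap (Away (polyGrading k w) e.rel.val)
      (Localization.Away e.rel.val)))
    ((awayToLaurent_injective k e.1).comp (val_injective _))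
    (monoidAlgMap_injective (hinj.comp Subtype.val_injective))
    (range_awayZeroToLaurent e.1 hφ _ rfl)

/-- The isomorphism of the degree zero part of the localization at a relevant monomial with
a monoid algebra. -/
noncomputable def zeroEquiv (e : RelExp k w) :
    Away (polyGrading k w) e.rel.val ≃+* AddMonoidAlgebra k ((awayMonoid e.1).comap φ) :=
  (e.exists_zeroEquiv hinj hφ).choose

lemma zeroEquiv_spec (e : RelExp k w) (z : Away (polyGrading k w) e.rel.val) :
    monoidAlgMap k (φ.comp ((awayMonoid e.1).comap φ).subtype) (e.zeroEquiv hinj hφ z) =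
      e.toLaurent z.val :=
  (e.exists_zeroEquiv hinj hφ).choose_spec z

lemma zeroEquiv_lift {e e' : RelExp k w} (h : e'.rel ≤ e.rel)
    (hC : (awayMonoid e.1).comap φ ≤ (awayMonoid e'.1).comap φ)
    (z : Away (polyGrading k w) e.rel.val) :
    e'.zeroEquiv hinj hφ (Rel.awayMap h z) =
      monoidAlgMap k (AddSubmonoid.inclusion hC) (e.zeroEquiv hinj hφ z) := by
  apply monoidAlgMap_injective (k := k) (ψ := φ.comp ((awayMonoid e'.1).comap φ).subtype)
    (hinj.comp Subtype.val_injective)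
  rw [zeroEquiv_spec, Rel.val_awayMap, toLaurent_lift, ← zeroEquiv_spec hinj hφ,
    ← AlgHom.comp_apply]
  refine DFunLike.congr_fun (monoidAlg_algHom_ext fun c ↦ ?_) _
  rw [AlgHom.comp_apply, monoidAlgMap_single, monoidAlgMap_single, monoidAlgMap_single]
  rfl

/-- The isomorphism of `Spec k[C]` with the spectrum of the degree zero part of the localization
at a relevant monomial. -/
noncomputable def zeroIso (e : RelExp k w) :
    Spec (.of (AddMonoidAlgebra k ((awayMonoid e.1).comap φ))) ⟶
      Spec (.of (Away (polyGrading k w) e.rel.val)) :=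
  Spec.map (CommRingCat.ofHom (e.zeroEquiv hinj hφ).toRingHom)

instance (e : RelExp k w) : IsIso (e.zeroIso hinj hφ) := by
  have : IsIso (CommRingCat.ofHom (e.zeroEquiv hinj hφ).toRingHom) :=
    inferInstanceAs (IsIso (e.zeroEquiv hinj hφ).toCommRingCatIso.hom)
  unfold zeroIso
  infer_instance

variable (φ) in
/-- The inclusion of the degree zero part of the monoid of `T ^ e`. -/
def monoidIncl (e : RelExp k w) : (awayMonoid e.1).comap φ →+ awayMonoid e.1 :=
  (φ.comp ((awayMonoid e.1).comap φ).subtype).codRestrict _ fun c ↦ c.2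

lemma equiv_val (e : RelExp k w) (z : Away (polyGrading k w) e.rel.val) :
    e.equiv z.val = monoidAlgMap k (e.monoidIncl φ) (e.zeroEquiv hinj hφ z) := by
  apply monoidAlgMap_injective (k := k) (ψ := (awayMonoid e.1).subtype) Subtype.val_injective
  rw [equiv_spec, ← zeroEquiv_spec hinj hφ, ← AlgHom.comp_apply]
  refine DFunLike.congr_fun (monoidAlg_algHom_ext fun c ↦ ?_) _
  rw [AlgHom.comp_apply, monoidAlgMap_single, monoidAlgMap_single, monoidAlgMap_single]
  rfl

lemma iso_awayToChart (e : RelExp k w) : e.iso ≫ awayToChart (polyGrading k w) e.rel =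
    Spec.map (CommRingCat.ofHom (monoidAlgMap k (e.monoidIncl φ)).toRingHom) ≫
      e.zeroIso hinj hφ := by
  rw [iso, zeroIso, awayToChart, ← Spec.map_comp, ← Spec.map_comp]
  congr 1
  exact CommRingCat.hom_ext (RingHom.ext fun z ↦ equiv_val hinj hφ e z)

end RelExp

lemma projι_projOver_hom (f : Rel (polyGrading k w)) : projι _ f ≫ (projOver k w).hom =
    Spec.map (CommRingCat.ofHom ((fromZeroRingHom (polyGrading k w) (Submonoid.powers f.val)).comp
      (algebraMap k (polyGrading k w 0)))) := by
  have h : projι _ f ≫ projToSpecZero (polyGrading k w) =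
      Spec.map (CommRingCat.ofHom (fromZeroRingHom _ (Submonoid.powers f.val))) :=
    colimit.ι_desc _ _
  change projι _ f ≫ projToSpecZero (polyGrading k w) ≫ Spec.map _ = _
  rw [← Category.assoc, h, ← Spec.map_comp]
  rfl

/-- The chart of `Proj` given by a relevant monomial. -/
noncomputable def projChart (e : RelExp k w) :
    toricChart k ((awayMonoid e.1).comap φ) ⟶ projOver k w :=
  Over.homMk (e.zeroIso hinj hφ ≫ projι _ e.rel) (by
    refine (Category.assoc _ _ _).trans ((congrArg _ (projι_projOver_hom e.rel)).trans ?_)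
    change _ = Spec.map (CommRingCat.ofHom
      (algebraMap k (AddMonoidAlgebra k ((awayMonoid e.1).comap φ))))
    refine (Spec.map_comp _ _).symm.trans
      (congrArg Spec.map (CommRingCat.hom_ext (RingHom.ext fun r ↦ ?_)))
    apply monoidAlgMap_injective (k := k) (ψ := φ.comp ((awayMonoid e.1).comap φ).subtype)
      (hinj.comp Subtype.val_injective)
    refine (e.zeroEquiv_spec hinj hφ _).trans ((e.toLaurent_algebraMap (C r)).trans ?_)
    exact ((toLaurent k).commutes r).trans ((monoidAlgMap k _).commutes r).symm)

lemma range_projChart (e : RelExp k w) :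
    Set.range (projChart hinj hφ e).left = Set.range (projι (polyGrading k w) e.rel) :=
  (Scheme.Hom.surjective (e.zeroIso hinj hφ)).range_comp (projι _ e.rel)

lemma range_projι_add (e e' : RelExp k w) :
    Set.range (projι _ e.rel) ∩ Set.range (projι _ e'.rel) ⊆
      Set.range (projι _ (e.add e').rel) := by
  rintro y ⟨h, h'⟩
  obtain ⟨x, rfl⟩ := toProj_surjective y
  rw [toProj_mem_range_projι] at *
  exact range_locusι_add e e' ⟨h, h'⟩

lemma projChart_trans {e e' : RelExp k w} (h : e'.rel ≤ e.rel)
    (hC : (awayMonoid e.1).comap φ ≤ (awayMonoid e'.1).comap φ) :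
    toricChartTrans k hC ≫ projChart hinj hφ e = projChart hinj hφ e' := by
  apply Over.OverMorphism.ext
  change Spec.map (CommRingCat.ofHom (monoidAlgMap k (AddSubmonoid.inclusion hC)).toRingHom) ≫
    e.zeroIso hinj hφ ≫ projι _ e.rel = e'.zeroIso hinj hφ ≫ projι _ e'.rel
  rw [← chartTrans_projι h, chartTrans, ← Category.assoc, ← Category.assoc, RelExp.zeroIso,
    RelExp.zeroIso, ← Spec.map_comp, ← Spec.map_comp]
  congr 2
  exact CommRingCat.hom_ext (RingHom.ext fun r ↦ (RelExp.zeroEquiv_lift hinj hφ h hC r).symm)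

lemma exists_mem_range_projι (hw : AddSubgroup.closure (Set.range w) = ⊤)
    (y : proj (polyGrading k w)) : ∃ e : RelExp k w, y ∈ Set.range (projι _ e.rel) := by
  obtain ⟨x, rfl⟩ := toProj_surjective y
  obtain ⟨e, he⟩ := exists_relExp hw x
  exact ⟨e, toProj_mem_range_projι.mpr he⟩

/-- The toric atlas of `Proj` given by the relevant monomials. -/
noncomputable def projAtlas (hw : AddSubgroup.closure (Set.range w) = ⊤) :
    ToricAtlas k m (projOver k w) where
  I := RelExp k w
  C e := (awayMonoid e.1).comap φ
  chart := projChart hinj hφ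
  isOpenImmersion e := inferInstanceAs (IsOpenImmersion (e.zeroIso hinj hφ ≫ projι _ e.rel))
  covers y := by
    obtain ⟨e, he⟩ := exists_mem_range_projι hw y
    exact ⟨e, (range_projChart hinj hφ e).ge he⟩
  overlap e e' := ⟨e.add e', fun _ h ↦ awayMonoid_mono le_self_add h,
    fun _ h ↦ awayMonoid_mono le_add_self h,
    projChart_trans hinj hφ (e.add_le_left e') _, projChart_trans hinj hφ (e.add_le_right e') _, by
      rw [range_projChart, range_projChart, range_projChart]
      exact range_projι_add e e'⟩
  base := ⟨_, isRelevant_prod hw⟩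
  base_eq_top := by
    rw [awayMonoid_one, AddSubmonoid.comap_top]

lemma locusChart_toProjOver (e : RelExp k w) : locusChart e ≫ toProjOver k w =
    monoidSpecMap k (e.monoidIncl φ) ≫ projChart hinj hφ e := by
  apply Over.OverMorphism.ext
  change (e.iso ≫ locusι e.rel) ≫ toProj _ =
    Spec.map (CommRingCat.ofHom (monoidAlgMap k (e.monoidIncl φ)).toRingHom) ≫
      e.zeroIso hinj hφ ≫ projι _ e.rel
  rw [Category.assoc, locusι_toProj, ← Category.assoc, ← Category.assoc, e.iso_awayToChart hinj hφ]

/-- The canonical morphism is given on charts by inclusions of monoids, compatibly with the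
inclusion of the group of characters of degree zero. -/
lemma locusAtlas_comp (hw : AddSubgroup.closure (Set.range w) = ⊤)
    (i : (locusAtlas (k := k) hw).I) :
    ∃ (j : (projAtlas (k := k) hinj hφ hw).I)
      (β : (projAtlas (k := k) hinj hφ hw).C j →+ (locusAtlas (k := k) hw).C i),
      ((locusAtlas (k := k) hw).C i).subtype.comp β =
        φ.comp ((projAtlas (k := k) hinj hφ hw).C j).subtype ∧
      (locusAtlas (k := k) hw).chart i ≫ toProjOver k w =
        monoidSpecMap k β ≫ (projAtlas (k := k) hinj hφ hw).chart j :=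
  ⟨i, RelExp.monoidIncl φ i, rfl, locusChart_toProjOver hinj hφ i⟩

end ProjAtlas

/-! ### Products of epimorphisms -/

section Epi

open scoped TensorProduct

variable {k : Type u} [Field k]

/-- The retraction forgets the monomials with exponent outside the image of `ψ`. -/
lemma hasRetraction_monoidAlgMap {C C' : Type} [AddCommMonoid C] [AddCommMonoid C'] {ψ : C →+ C'}
    (hψ : Function.Injective ψ) (h : ∀ a c, ψ a + c ∈ Set.range ψ → c ∈ Set.range ψ) :
    HasRetraction (monoidAlgMap k ψ).toRingHom := by
  refine ⟨AddMonoidAlgebra.comapDomainAddMonoidHom ψ hψ, ?_, fun r s ↦ ?_⟩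
  · rw [AddMonoidAlgebra.one_def, AddMonoidAlgebra.one_def, ← map_zero ψ]
    exact AddMonoidAlgebra.comapDomain_single_map ψ hψ _ _
  · induction r using AddMonoidAlgebra.induction_linear with
    | zero => simp
    | add r r' h h' => rw [map_add, add_mul, map_add, h, h', add_mul]
    | single a x =>
      induction s using AddMonoidAlgebra.induction_linear with
      | zero => simp
      | add s s' h h' => rw [mul_add, map_add, h, h', map_add, mul_add]
      | single c y =>
        change AddMonoidAlgebra.comapDomain ψ hψ (monoidAlgMap k ψ (AddMonoidAlgebra.single a x) *
          AddMonoidAlgebra.single c y) = AddMonoidAlgebra.single a x *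
            AddMonoidAlgebra.comapDomain ψ hψ (AddMonoidAlgebra.single c y)
        rw [monoidAlgMap_single, AddMonoidAlgebra.single_mul_single]
        by_cases hc : c ∈ Set.range ψ
        · obtain ⟨b, rfl⟩ := hc
          rw [← map_add, AddMonoidAlgebra.comapDomain_single_map,
            AddMonoidAlgebra.comapDomain_single_map, AddMonoidAlgebra.single_mul_single]
        · have h0 (c) (hc : c ∉ Set.range ψ) (z : k) :
              AddMonoidAlgebra.comapDomain ψ hψ (AddMonoidAlgebra.single c z) = 0 := by
            ext; simp [hc]
          rw [h0 c hc, h0 _ fun h' ↦ hc (h a c h'), mul_zero]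

lemma surjective_algMap {R : CommRingCat.{u}} {B B' : Type u} [CommRing B] [CommRing B']
    [Algebra R B] [Algebra R B'] {β : B →ₐ[R] B'} (hβ : HasRetraction β.toRingHom) :
    Surjective (algMap β).left :=
  ⟨hβ.comap_surjective⟩

lemma epi_of_epi_comp_iso {𝒞 : Type*} [Category 𝒞] {X Y Z : 𝒞} (f : X ⟶ Y) (e : Y ≅ Z)
    (h : Epi (f ≫ e.hom)) : Epi f := by
  rw [← Category.comp_id f, ← e.hom_inv_id, ← Category.assoc]
  exact epi_comp _ _

/-- Products of morphisms of affine schemes with a retraction are epimorphisms. -/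
lemma epi_tensorHom_algMap {R : CommRingCat.{u}} {H B H' B' : Type u} [CommRing H] [CommRing B]
    [CommRing H'] [CommRing B'] [Algebra R H] [Algebra R B] [Algebra R H'] [Algebra R B']
    {α : H →ₐ[R] H'} {β : B →ₐ[R] B'} (hα : HasRetraction α.toRingHom)
    (hβ : HasRetraction β.toRingHom) : Epi (algMap α ⊗ₘ algMap β).left := by
  have h : (algMap α ⊗ₘ algMap β).left ≫ (pullbackSpecIso R H B).hom =
      (pullbackSpecIso R H' B').hom ≫
        Spec.map (CommRingCat.ofHom (Algebra.TensorProduct.map α β).toRingHom) := by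
    refine (?_ : _ = ((algMap α ⊗ₘ algMap β) ≫ coactMap (AlgHom.id R (H ⊗[R] B))).left).trans ?_
    · refine congrArg (fun f ↦ (algMap α ⊗ₘ algMap β).left ≫ f) ?_
      exact ((congrArg _ (Spec.map_id _)).trans (Category.comp_id _)).symm
    · rw [tensorHom_coactMap]
      rfl
  have := epi_SpecMap_of_hasRetraction (hα.tensor hβ)
  have h' : Epi ((pullbackSpecIso R H' B').hom ≫
      Spec.map (CommRingCat.ofHom (Algebra.TensorProduct.map α β).toRingHom)) := epi_comp _ _
  rw [← h] at h'
  exact epi_of_epi_comp_iso _ (pullbackSpecIso R H B) h'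

variable {n m : ℕ} {D : Type u} [AddCommGroup D] [DecidableEq D] {w : Fin n → D}
  {φ : (Fin m → ℤ) →+ (Fin n → ℤ)} (hinj : Function.Injective φ)
  (hφ : ∀ c, c ∈ Set.range φ ↔ charDeg w c = 0)

include hinj in
lemma hasRetraction_monoidAlgMap_of_injective : HasRetraction (monoidAlgMap k φ).toRingHom := by
  refine hasRetraction_monoidAlgMap hinj ?_
  rintro a c ⟨b, hb⟩
  exact ⟨b - a, by rw [map_sub, hb, add_sub_cancel_left]⟩

include hinj in
lemma hasRetraction_monoidIncl (e : RelExp k w) :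
    HasRetraction (monoidAlgMap k (e.monoidIncl φ)).toRingHom := by
  refine hasRetraction_monoidAlgMap (fun a b h ↦ Subtype.ext (hinj (congrArg Subtype.val h))) ?_
  rintro a c ⟨b, hb⟩
  have h : φ (b.1 - a.1) = c := by
    have : φ b.1 = φ a.1 + c := congrArg Subtype.val hb
    rw [map_sub, this, add_sub_cancel_left]
  refine ⟨⟨b.1 - a.1, ?_⟩, Subtype.ext h⟩
  rw [AddSubmonoid.mem_comap, h]
  exact c.2

include hinj in
lemma surjective_torusMap : Surjective (torusMap (k := k) φ).left :=
  surjective_algMap (R := .of k) (hasRetraction_monoidAlgMap_of_injective hinj)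

include hinj in
lemma epi_torusMap_tensor : Epi (torusMap (k := k) φ ⊗ₘ torusMap (k := k) φ) :=
  have : Epi (torusMap (k := k) φ ⊗ₘ torusMap (k := k) φ).left :=
    epi_tensorHom_algMap (R := .of k) (hasRetraction_monoidAlgMap_of_injective hinj)
      (hasRetraction_monoidAlgMap_of_injective hinj)
  Over.epi_of_epi_left _

include hinj hφ in
lemma epi_torusMap_tensor_toProjOver (hw : AddSubgroup.closure (Set.range w) = ⊤) :
    Epi (torusMap (k := k) φ ⊗ₘ toProjOver k w) := by
  refine ⟨fun {Z} a b hab ↦ (projAtlas hinj hφ hw).whiskerLeft_hom_ext _ fun (e : RelExp k w) ↦ ?_⟩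
  have : Epi (torusMap (k := k) φ ⊗ₘ monoidSpecMap k (e.monoidIncl φ)).left :=
    epi_tensorHom_algMap (R := .of k) (hasRetraction_monoidAlgMap_of_injective hinj)
      (hasRetraction_monoidIncl hinj e)
  have := Over.epi_of_epi_left (torusMap (k := k) φ ⊗ₘ monoidSpecMap k (e.monoidIncl φ))
  refine (cancel_epi (torusMap (k := k) φ ⊗ₘ monoidSpecMap k (e.monoidIncl φ))).mp ?_
  have h : (torusMap (k := k) φ ⊗ₘ monoidSpecMap k (e.monoidIncl φ)) ≫
      (torus k m ◁ projChart hinj hφ e) =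
      (torus k n ◁ locusChart e) ≫ (torusMap (k := k) φ ⊗ₘ toProjOver k w) := by
    rw [← id_tensorHom, ← id_tensorHom, tensorHom_comp_tensorHom, tensorHom_comp_tensorHom,
      locusChart_toProjOver hinj hφ, Category.id_comp, Category.comp_id]
  have h' (a : torus k m ⊗ projOver k w ⟶ Z) :
      (torusMap (k := k) φ ⊗ₘ monoidSpecMap k (e.monoidIncl φ)) ≫
        (torus k m ◁ projChart hinj hφ e) ≫ a =
      (torus k n ◁ locusChart e) ≫ (torusMap (k := k) φ ⊗ₘ toProjOver k w) ≫ a := by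
    rw [← Category.assoc, h, Category.assoc]
  exact (h' a).trans ((congrArg _ hab).trans (h' b).symm)

end Epi

/-! ### Normality and finiteness -/

section NormalPrevariety

lemma isIntegrallyClosed_stalk_Spec (R : Type u) [CommRing R] [IsDomain R] [IsIntegrallyClosed R]
    (x : PrimeSpectrum R) : IsIntegrallyClosed ((Spec (.of R)).presheaf.stalk x) := by
  have : IsIntegrallyClosed (Localization.AtPrime x.asIdeal) :=
    isIntegrallyClosed_of_isLocalization (R := R) _ x.asIdeal.primeCompl
      x.asIdeal.primeCompl_le_nonZeroDivisors
  have : IsIntegrallyClosed ((Spec.structureSheaf R).presheaf.stalk x) :=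
    .of_equiv (IsLocalization.algEquiv x.asIdeal.primeCompl
      (Localization.AtPrime x.asIdeal) _).toRingEquiv
  exact this

lemma isIntegrallyClosed_stalk_of_isOpenImmersion {X Y : Scheme.{u}} (j : X ⟶ Y)
    [IsOpenImmersion j] (x : X) [IsIntegrallyClosed (X.presheaf.stalk x)] :
    IsIntegrallyClosed (Y.presheaf.stalk (j x)) :=
  .of_equiv (asIso (j.stalkMap x)).commRingCatIsoToRingEquiv.symm

variable {k : Type u} [Field k]

instance {m : ℕ} (C : AddSubmonoid (Fin m → ℤ)) : IsDomain (AddMonoidAlgebra k C) :=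
  (monoidAlgMap_injective (k := k) (ψ := C.subtype) Subtype.val_injective).isDomain
    (monoidAlgMap k C.subtype).toRingHom

namespace ToricAtlas

variable {m : ℕ} {Y : Over (Spec (.of k))} (𝒯 : ToricAtlas k m Y)

/-- The open cover given by the charts. -/
noncomputable def cover : Y.left.OpenCover :=
  overCover _ 𝒯.chart 𝒯.covers

include 𝒯 in
/-- The charts are spectra of domains. -/
lemma isReduced : IsReduced Y.left :=
  have (i : 𝒯.cover.I₀) : IsReduced (𝒯.cover.X i) :=
    inferInstanceAs (IsReduced (Spec (.of (AddMonoidAlgebra k (𝒯.C i)))))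
  IsReduced.of_openCover _ 𝒯.cover

lemma locallyOfFiniteType (hC : ∀ i, (𝒯.C i).FG) : LocallyOfFiniteType Y.hom := by
  have : IsZariskiLocalAtSource @LocallyOfFiniteType.{u} :=
    HasRingHomProperty.instIsZariskiLocalAtSource (Q := RingHom.FiniteType)
  refine IsZariskiLocalAtSource.of_openCover (P := @LocallyOfFiniteType) 𝒯.cover fun (i : 𝒯.I) ↦ ?_
  have : AddMonoid.FG (𝒯.C i) := (AddMonoid.fg_iff_addSubmonoid_fg _).mpr (hC i)
  have h : LocallyOfFiniteType
      (Spec.map (CommRingCat.ofHom (algebraMap k (AddMonoidAlgebra k (𝒯.C i))))) := by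
    rw [HasRingHomProperty.Spec_iff (P := @LocallyOfFiniteType)]
    exact RingHom.finiteType_algebraMap.mpr inferInstance
  exact (congrArg (fun f ↦ LocallyOfFiniteType f) (Over.w (𝒯.chart i))).mpr h

lemma isIntegrallyClosed_stalk (hC : ∀ i, IsIntegrallyClosed (AddMonoidAlgebra k (𝒯.C i)))
    (y : Y.left) : IsIntegrallyClosed (Y.left.presheaf.stalk y) := by
  obtain ⟨i, x, rfl⟩ := 𝒯.covers y
  have := hC i
  have h := isIntegrallyClosed_stalk_Spec (AddMonoidAlgebra k (𝒯.C i))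
  have : IsIntegrallyClosed ((toricChart k (𝒯.C i)).left.presheaf.stalk x) := h x
  exact isIntegrallyClosed_stalk_of_isOpenImmersion (𝒯.chart i).left x

lemma isNormalPrevariety [IrreducibleSpace Y.left] [CompactSpace Y.left]
    (hfg : ∀ i, (𝒯.C i).FG) (hC : ∀ i, IsIntegrallyClosed (AddMonoidAlgebra k (𝒯.C i))) :
    IsNormalPrevariety Y :=
  have := 𝒯.isReduced
  { isReduced := this
    locallyOfFiniteType := 𝒯.locallyOfFiniteType hfg
    quasiCompact := (quasiCompact_iff_compactSpace Y.hom).mpr inferInstance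
    isIntegral := isIntegral_of_irreducibleSpace_of_isReduced _
    isIntegrallyClosed := 𝒯.isIntegrallyClosed_stalk hC }

end ToricAtlas

section Polynomial

open MvPolynomial

variable {n m : ℕ} {D : Type u} [AddCommGroup D] [DecidableEq D] {w : Fin n → D}
  {φ : (Fin m → ℤ) →+ (Fin n → ℤ)} (hinj : Function.Injective φ)
  (hφ : ∀ c, c ∈ Set.range φ ↔ charDeg w c = 0)

/-- A version of Gordan's lemma: the exponents `c = u - l • e` in the monoid of `T ^ e` with
`δ c = 0` come from the pairs `(u, l)` of natural exponents with `δ u = δ (l • e)`, which form a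
finitely generated monoid by Dickson's lemma. -/
lemma fg_awayMonoid_inf_mker (e : Fin n →₀ ℕ) {N : Type*} [AddGroup N] (δ : (Fin n → ℤ) →+ N) :
    (awayMonoid e ⊓ AddMonoidHom.mker δ).FG := by
  let f : (Fin n →₀ ℕ) × ℕ →+ (Fin n → ℤ) := expChar.comp (AddMonoidHom.fst _ _)
  let g : (Fin n →₀ ℕ) × ℕ →+ (Fin n → ℤ) :=
    ((multiplesHom _) (expChar e)).comp (AddMonoidHom.snd _ _)
  have h := (AddSubmonoid.fg_eqLocusM (δ.comp f) (δ.comp g)).map (f - g)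
  convert h
  ext c
  constructor
  · rintro ⟨⟨l, hl⟩, hc⟩
    obtain ⟨u, hu⟩ := exists_expChar_eq hl
    have hc : δ c = 0 := hc
    refine ⟨(u, l), ?_, ?_⟩
    · change δ (expChar u) = δ (l • expChar e)
      rw [hu, map_add, hc, zero_add]
    · change expChar u - l • expChar e = c
      rw [hu, add_sub_cancel_right]
  · rintro ⟨⟨u, l⟩, hx, rfl⟩
    have hx : δ (expChar u) = δ (l • expChar e) := hx
    change expChar u - l • expChar e ∈ _
    refine ⟨⟨l, ?_⟩, ?_⟩
    · rw [sub_add_cancel]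
      exact fun i ↦ Int.natCast_nonneg _
    · exact (map_sub δ _ _).trans (sub_eq_zero.mpr hx)

lemma fg_awayMonoid (e : Fin n →₀ ℕ) : (awayMonoid e).FG := by
  have h := fg_awayMonoid_inf_mker e (0 : (Fin n → ℤ) →+ ℤ)
  rwa [AddMonoidHom.mker_zero, inf_top_eq] at h

include hinj hφ in
lemma fg_comap_awayMonoid (e : Fin n →₀ ℕ) : ((awayMonoid e).comap φ).FG := by
  refine AddSubmonoid.FG.map_injective φ hinj ?_
  convert fg_awayMonoid_inf_mker e (charDeg w)
  ext c
  constructor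
  · rintro ⟨b, hb, rfl⟩
    exact ⟨hb, (hφ _).mp ⟨b, rfl⟩⟩
  · rintro ⟨hc, hc'⟩
    obtain ⟨b, rfl⟩ := (hφ c).mpr hc'
    exact ⟨b, hc, rfl⟩

lemma isIntegrallyClosed_awayMonoid (e : Fin n →₀ ℕ) :
    IsIntegrallyClosed (AddMonoidAlgebra k (awayMonoid e)) := by
  obtain ⟨ε, -⟩ := exists_awayEquiv (k := k) e
  have : IsIntegrallyClosed (Localization.Away (monomial e (1 : k))) :=
    isIntegrallyClosed_of_isLocalization (R := MvPolynomial (Fin n) k) _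
      (Submonoid.powers (monomial e (1 : k)))
      (powers_le_nonZeroDivisors_of_noZeroDivisors (monomial_eq_zero.not.mpr one_ne_zero))
  exact .of_equiv ε

include hinj in
/-- Integral closedness descends along the retraction to the degree zero part. -/
lemma isIntegrallyClosed_comap_awayMonoid (e : RelExp k w) :
    IsIntegrallyClosed (AddMonoidAlgebra k ((awayMonoid e.1).comap φ)) :=
  have := isIntegrallyClosed_awayMonoid (k := k) e.1
  (hasRetraction_monoidIncl hinj e).isIntegrallyClosed

variable (hw : AddSubgroup.closure (Set.range w) = ⊤)

include hw in
lemma irreducibleSpace_locus : IrreducibleSpace (locusOverBase k w).left := by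
  have : Nonempty (relevantLocus (polyGrading k w)).toScheme :=
    ⟨(locusAtlas (k := k) hw).embed.left (⊥ : PrimeSpectrum (AddMonoidAlgebra k (Fin n → ℤ)))⟩
  have := isIntegral_of_isOpenImmersion (relevantLocus (polyGrading k w)).ι
  exact inferInstanceAs (IrreducibleSpace (relevantLocus (polyGrading k w)).toScheme)

lemma compactSpace_locus : CompactSpace (locusOverBase k w).left := by
  have : TopologicalSpace.NoetherianSpace (Spec (.of (MvPolynomial (Fin n) k))) := inferInstance
  exact isCompact_iff_compactSpace.mp
    (this.isCompact (relevantLocus (polyGrading k w) : Set (Spec (.of (MvPolynomial (Fin n) k)))))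

include hw in
lemma isNormalPrevariety_locus : IsNormalPrevariety (locusOverBase k w) :=
  have := irreducibleSpace_locus (k := k) hw
  have := compactSpace_locus (k := k) (w := w)
  (locusAtlas hw).isNormalPrevariety (fun e ↦ fg_awayMonoid e.1)
    fun e ↦ isIntegrallyClosed_awayMonoid e.1

include hw in
/-- Quasi-compactness and irreducibility are inherited from the relevant locus, and all else can be
checked on charts. -/
lemma isNormalPrevariety_proj : IsNormalPrevariety (projOver k w) := by
  obtain ⟨m, φ, hinj, hφ⟩ := exists_charDeg_ker w
  have : IrreducibleSpace (relevantLocus (polyGrading k w)).toScheme := irreducibleSpace_locus hw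
  have : CompactSpace (relevantLocus (polyGrading k w)).toScheme := compactSpace_locus
  have hsurj := toProj_surjective (𝒜 := polyGrading k w)
  have hcont := (toProj (polyGrading k w)).continuous
  have : IrreducibleSpace (projOver k w).left := hsurj.irreducibleSpace hcont
  have : CompactSpace (projOver k w).left := hsurj.compactSpace hcont
  exact (projAtlas hinj hφ hw).isNormalPrevariety (fun e ↦ fg_comap_awayMonoid hinj hφ e.1)
    fun e ↦ isIntegrallyClosed_comap_awayMonoid hinj e

end Polynomial

end NormalPrevariety

/-! ### The canonical morphism as a prequotient -/

section Prequotient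

variable {k : Type u} [Field k] {n m : ℕ} {D : Type u} [AddCommGroup D] [DecidableEq D]
  {w : Fin n → D} (hw : AddSubgroup.closure (Set.range w) = ⊤)

include hw in
lemma isGoodPrequotient_toProjOver :
    IsGoodPrequotient (groupScheme (polyGrading k w)) (locusOver (polyGrading k w))
      (specZeroToBase k w) (projOver k w) (toProjOver k w) where
  isPrevariety_source := (isNormalPrevariety_locus hw).toIsPrevariety
  isPrevariety_target := (isNormalPrevariety_proj hw).toIsPrevariety
  isInvariant := isInvariant_toProj (𝒜 := polyGrading k w)
  surjective := inferInstanceAs (Surjective (toProj (polyGrading k w)))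
  isAffineHom := inferInstanceAs (IsAffineHom (toProj (polyGrading k w)))
  injective_app := toProj_app_injective
  range_app := range_toProj_app

lemma toProjOver_hom_ext {Z : Over (Spec (.of k))} {g h : projOver k w ⟶ Z}
    (hgh : toProjOver k w ≫ g = toProjOver k w ≫ h) : g = h := by
  have := epi_toProj (𝒜 := polyGrading k w)
  refine Over.OverMorphism.ext ((cancel_epi (toProj (polyGrading k w))).mp ?_)
  exact congrArg (fun f ↦ f.left) hgh

lemma exists_toProjOver_comp_eq {Z : Over (Spec (.of k))} {f : locusOverBase k w ⟶ Z}
    (hf : IsInvariant (groupScheme (polyGrading k w)) (locusOver (polyGrading k w)) f.left) :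
    ∃ g : projOver k w ⟶ Z, toProjOver k w ≫ g = f := by
  obtain ⟨g, hg⟩ := exists_toProj_comp_eq hf
  have := epi_toProj (𝒜 := polyGrading k w)
  have h : g ≫ Z.hom = (projOver k w).hom := by
    refine (cancel_epi (toProj (polyGrading k w))).mp ?_
    exact (Category.assoc _ _ _).symm.trans ((congrArg (· ≫ Z.hom) hg).trans
      ((Over.w f).trans (Over.w (toProjOver k w)).symm))
  exact ⟨Over.homMk g h, Over.OverMorphism.ext hg⟩

variable {φ : (Fin m → ℤ) →+ (Fin n → ℤ)} (hinj : Function.Injective φ)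
  (hφ : ∀ c, c ∈ Set.range φ ↔ charDeg w c = 0)

lemma isToricHom_of_toProjOver_comp {Z : Over (Spec (.of k))} {l : ℕ} {tZ : ToricStructure l Z}
    {g : projOver k w ⟶ Z}
    (h : IsToricHom (locusAtlas hw).toricStructure tZ (toProjOver k w ≫ g)) :
    IsToricHom (projAtlas hinj hφ hw).toricStructure tZ g := by
  have hcomp := locusAtlas_comp (k := k) hinj hφ hw
  have := isMonHom_torusMap (k := k) φ
  have := surjective_torusMap (k := k) hinj
  have := epi_torusMap_tensor (k := k) hinj
  have := epi_torusMap_tensor_toProjOver (k := k) hinj hφ hw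
  exact isToricHom_of_comp (tX := (locusAtlas hw).toricStructure)
    (tY := (projAtlas hinj hφ hw).toricStructure) (torusMap φ) (ToricAtlas.embed_comp hcomp)
    (ToricAtlas.act_comp hcomp) h

lemma isToricPrequotient_toProjOver :
    IsToricPrequotient (groupScheme (polyGrading k w)) (locusOver (polyGrading k w))
      (specZeroToBase k w) (projOver k w) (locusAtlas hw).toricStructure
      (projAtlas hinj hφ hw).toricStructure (toProjOver k w) where
  isNormalPrevariety_source := isNormalPrevariety_locus hw
  isNormalPrevariety_target := isNormalPrevariety_proj hw
  isToricHom := ToricAtlas.isToricHom (locusAtlas_comp hinj hφ hw)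
  isInvariant := isInvariant_toProj (𝒜 := polyGrading k w)
  existsUnique_factorization Z l tZ _ f hf hinv := by
    obtain ⟨g, rfl⟩ := exists_toProjOver_comp_eq hinv
    exact ⟨g, ⟨isToricHom_of_toProjOver_comp hw hinj hφ hf, rfl⟩,
      fun h hh ↦ toProjOver_hom_ext hh.2⟩

end Prequotient

end MultiProj

theorem mainTheorem10 {k : Type u} [Field k] [IsAlgClosed k]
    {D : Type u} [AddCommGroup D] [DecidableEq D] [AddGroup.FG D] (n : ℕ) (w : Fin n → D)
    (hw : AddSubgroup.closure {d : D | polyGrading k w d ≠ ⊥} = ⊤) :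
    IsGoodPrequotient (groupScheme (polyGrading k w)) (locusOver (polyGrading k w))
      (specZeroToBase k w) (projOver k w) (toProjOver k w) ∧
    ∃ (tX : ToricStructure n
        ((Over.map (specZeroToBase k w)).obj (locusOver (polyGrading k w))))
      (m : ℕ) (tY : ToricStructure m (projOver k w)),
      tX.embed.left ≫ (relevantLocus (polyGrading k w)).ι = torusToAffine k ∧
      IsToricPrequotient (groupScheme (polyGrading k w)) (locusOver (polyGrading k w))
        (specZeroToBase k w) (projOver k w) tX tY (toProjOver k w) := by
  have hw' := closure_range_eq_top hw
  obtain ⟨m, φ, hinj, hφ⟩ := exists_charDeg_ker w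
  refine ⟨isGoodPrequotient_toProjOver hw', (locusAtlas hw').toricStructure, m,
    (projAtlas hinj hφ hw').toricStructure, ?_, ?_⟩
  · exact locusAtlas_embed hw'
  · exact isToricPrequotient_toProjOver hw' hinj hφ
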